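/- Let $\Gamma$ be a finite graph embedded in a closed connected non-orientable surface $\Sigma$ as the 1-skeleton of a cellular decomposition $X$, with positive edge weights $\mathrm w(e)$. Let $Z=\sum_D\prod_{e\in D}\mathrm w(e)$, the sum over all perfect matchings (dimer configurations) $D$ of $\Gamma$. Assume that $\Gamma$ has an even number of vertices, numbered $1,\dots,2n$. By the classification of surfaces, $\Sigma=\Sigma_g\#\mathbb RP^2$ or $\Sigma=\Sigma_g\#\mathcal K$, with $\Sigma_g$ the closed orientable surface of genus $g\ge 0$ and $\mathcal K$ the Klein bottle; put $b=1$ in the first case and $b=2$ in the second. *Curves.* Let $\alpha_1,\dots,\alpha_{2g}$ and $\beta_1,\dots,\beta_b$ be simple closed curves on $\Sigma$, transverse to $\Gamma$ (they avoid the vertices and cross the edges), such that the $\alpha_j$ are two-sided and meet each other transversally, outside $\Gamma$, the $\beta_\ell$ are one-sided, disjoint from each other and from the $\alpha_j$, and the classes of all these curves form a basis of $H_1(\Sigma;\mathbb Z_2)$ (so the $[\alpha_j]$ form a basis of $H_1(\Sigma_g;\mathbb Z_2)$ and the $[\beta_\ell]$ one of $H_1(\mathbb RP^2;\mathbb Z_2)$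 resp. $H_1(\mathcal K;\mathbb Z_2)$). Put $\omega(e)=e\cdot\sum_\ell\beta_\ell\in\mathbb Z_2$ for every edge $e$. Let $\Sigma'$ be $\Sigma$ cut along the $\beta_\ell$, with a fixed orientation, called counterclockwise; it restricts to a local orientation at every vertex of $\Gamma$, and the local orientations at the ends of $e$ agree along $e$ if and only if $\omega(e)=0$. *Kasteleyn orientations.* For an orientation $K$ of the edges and an oriented closed walk $C$ in $\Gamma$, let $n^K(C)$ be the number of edges of $C$, with multiplicity, that are traversed against $K$. For a face $f$ and a direction along $\partial f$, label each vertex on $\partial f$ by $+$ if, at this vertex, $f$ lies to the left of $\partial f$, and by $-$ otherwise. $K$ is a Kasteleyn orientation on $(X,\omega)$ if $n^K(\partial f)$ plus the number of edges of $\partial f$ joining two vertices labelled $-$ is odd, for every face $f$ and either direction. *The cycles $C_\gamma$.* Give each of the curves $\gamma$ a direction and a starting point on $\Gamma$, and let $W_\gamma$ be the walk in $\Gamma$ that runs alongside $\gamma$, once around, with $\gamma$ to its immediate left in $\Sigma'$: in each face that $\gamma$ traverses, it runs along the part of the boundary of the face that $\gamma$ cuts off on this side. Each of these parts is assumed to contain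 a vertex of $\Gamma$. For $\gamma=\alpha_j$ put $C_\gamma=W_\gamma$. For $\gamma=\beta_\ell$ the walk $W_\gamma$ joins the two ends of the edge $e_\ell$ on which $\beta_\ell$ starts, and $C_\gamma$ is $W_\gamma$ closed up by $e_\ell$. It is assumed that $e_\ell$ meets $\beta_\ell$ exactly once and no other $\beta_m$, and that the edges of all the $W_\gamma$ are disjoint from all the $\beta_m$. Let $K$ be a Kasteleyn orientation on $(X,\omega)$ such that $n^K(C_\gamma)$ is odd for each $\gamma\in\{\alpha_j,\beta_\ell\}$. For $\epsilon\in\mathbb Z_2^{2g}$ let $K_\epsilon$ be obtained from $K$ by inverting the orientation of an edge each time it crosses some $\alpha_j$ with $\epsilon_j=1$; if $b=2$, let $K'_\epsilon$ be obtained from $K_\epsilon$ by inverting the orientation of an edge each time it crosses $\beta_1$. For an orientation $L$ let $A^L$ be the complex skew-symmetric $2n\times 2n$ matrix with entries $$a_{jk}=\sum_e \varepsilon^L_{jk}(e)\,i^{\omega(e)}\,\mathrm w(e),$$ the sum over the edges $e$ between $j$ and $k$, where $\varepsilon^L_{jk}(e)=1$ if $L$ orients $e$ from $j$ to $k$ and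 $-1$ if from $k$ to $j$ (loops are ignored). Then $$Z=\frac1{2^g}\Big|\sum_{\epsilon\in\mathbb Z_2^{2g}}(-1)^{\sum_{j<k}\epsilon_j\epsilon_k\,\alpha_j\cdot\alpha_k}\Big(\mathrm{Re}\,\mathrm{Pf}(A^{K_\epsilon})+\mathrm{Im}\,\mathrm{Pf}(A^{K_\epsilon})\Big)\Big|$$ if $\Sigma=\Sigma_g\#\mathbb RP^2$, and $$Z=\frac1{2^g}\Big|\sum_{\epsilon\in\mathbb Z_2^{2g}}(-1)^{\sum_{j<k}\epsilon_j\epsilon_k\,\alpha_j\cdot\alpha_k}\Big(\mathrm{Im}\,\mathrm{Pf}(A^{K_\epsilon})+\mathrm{Re}\,\mathrm{Pf}(A^{K'_\epsilon})\Big)\Big|$$ if $\Sigma=\Sigma_g\#\mathcal K$. -/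

import Mathlib

open scoped Classical

noncomputable section

/-! ### Cellular decompositions of closed surfaces -/

/-- A cellular decomposition of a closed connected surface, given by its flags. A flag is a triple
(vertex, edge at it, face at both), i.e. a triangle of the barycentric subdivision; it is the same
thing as an edge of the graph directed away from one of its ends together with one of its two sides.
`τ₀`, `τ₁`, `τ₂` are the adjacencies of triangles: they exchange the vertex, the edge, the face of
a flag and keep the other two. The surface is the union of the triangles, and (`F` being finite)
every cellular decomposition with at least one edge arises in this way. Loops, multiple edges,
vertices of degree one and faces that meet themselves are allowed. -/
structure CellSurface (F : Type*) where
  τ₀ : Equiv.Perm F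
  τ₁ : Equiv.Perm F
  τ₂ : Equiv.Perm F
  τ₀_invol : ∀ x, τ₀ (τ₀ x) = x
  τ₁_invol : ∀ x, τ₁ (τ₁ x) = x
  τ₂_invol : ∀ x, τ₂ (τ₂ x) = x
  comm : ∀ x, τ₀ (τ₂ x) = τ₂ (τ₀ x)
  τ₀_ne : ∀ x, τ₀ x ≠ x
  τ₁_ne : ∀ x, τ₁ x ≠ x
  τ₂_ne : ∀ x, τ₂ x ≠ x
  τ₀τ₂_ne : ∀ x, τ₀ (τ₂ x) ≠ x
  connected : ∀ x y, ∃ s ∈ Subgroup.closure {τ₀, τ₁, τ₂}, s x = y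

/-- The set of orbits of the group generated by a set of permutations. -/
abbrev OrbitSet {F : Type*} (S : Set (Equiv.Perm F)) : Type _ :=
  MulAction.orbitRel.Quotient (Subgroup.closure S) F

instance OrbitSet.fintype {F : Type*} [Fintype F] (S : Set (Equiv.Perm F)) :
    Fintype (OrbitSet S) :=
  Fintype.ofFinite _

namespace CellSurface

variable {F : Type*} [Fintype F]

/-- The 0-cells. -/
abbrev Vertex (X : CellSurface F) : Type _ := OrbitSet {X.τ₁, X.τ₂}

/-- The 1-cells, i.e. the edges of the graph `Γ`. -/
abbrev Edge (X : CellSurface F) : Type _ := OrbitSet {X.τ₀, X.τ₂}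

/-- The 2-cells. -/
abbrev Face (X : CellSurface F) : Type _ := OrbitSet {X.τ₀, X.τ₁}

/-- The vertex of a flag: the tail of the directed edge. -/
def vert (X : CellSurface F) (x : F) : X.Vertex := Quotient.mk _ x

/-- The head of the directed edge. -/
def head (X : CellSurface F) (x : F) : X.Vertex := X.vert (X.τ₀ x)

/-- The edge of a flag. -/
def edge (X : CellSurface F) (x : F) : X.Edge := Quotient.mk _ x

/-- Following the boundary of the face of a flag: from a directed side to the next one. -/
def next (X : CellSurface F) : Equiv.Perm F := X.τ₁ * X.τ₀

/-- The number of sides of the face of a flag. Its boundary, followed in the direction of `x`, is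
`x, next x, …, next^(sides x - 1) x`. -/
def sides (X : CellSurface F) (x : F) : ℕ := Function.minimalPeriod X.next x

def eulerChar (X : CellSurface F) : ℤ :=
  (Fintype.card X.Vertex : ℤ) - Fintype.card X.Edge + Fintype.card X.Face

/-- The triangles cannot be coherently oriented. -/
def IsNonorientable (X : CellSurface F) : Prop :=
  ¬ ∃ s : F → ZMod 2, ∀ x, s (X.τ₀ x) = s x + 1 ∧ s (X.τ₁ x) = s x + 1 ∧ s (X.τ₂ x) = s x + 1

/-! ### First homology mod 2, computed from the dual cell decomposition

The dual decomposition has a 2-cell, a 1-cell, a 0-cell for every vertex, edge, face of `X`. -/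

/-- Dual 1-cycles: 1-chains with zero boundary at every face. -/
def cycles (X : CellSurface F) : Submodule (ZMod 2) (X.Edge → ZMod 2) where
  carrier := {c | ∀ x, ∑ i ∈ Finset.range (X.sides x), c (X.edge ((X.next ^ i) x)) = 0}
  zero_mem' := by intro x; simp
  add_mem' := by
    intro a b ha hb x
    simp only [Set.mem_ofPred_eq] at ha hb
    simp [Finset.sum_add_distrib, ha x, hb x]
  smul_mem' := by
    intro r a ha x
    simp only [Set.mem_ofPred_eq] at ha
    simp [← Finset.mul_sum, ha x]

/-- Dual 1-boundaries: the boundary of a sum of dual 2-cells contains the dual of an edge once for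
every end of the edge among the vertices that occur in the sum. -/
def boundaries (X : CellSurface F) : Submodule (ZMod 2) (X.Edge → ZMod 2) where
  carrier := {c | ∃ h : X.Vertex → ZMod 2, ∀ x, c (X.edge x) = h (X.vert x) + h (X.head x)}
  zero_mem' := ⟨0, by intro x; simp⟩
  add_mem' := by
    rintro a b ⟨h, hh⟩ ⟨k, hk⟩
    exact ⟨h + k, fun x => by simp only [Pi.add_apply, hh x, hk x]; ring⟩
  smul_mem' := by
    rintro r a ⟨h, hh⟩
    exact ⟨r • h, fun x => by simp only [Pi.smul_apply, hh x, smul_add]⟩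

/-- `H₁(Σ; ℤ/2)`. -/
abbrev H₁ (X : CellSurface F) : Type _ := X.cycles ⧸ X.boundaries.comap X.cycles.subtype

/-- The 1-chains `v i` are cycles whose classes form a basis of `H₁(Σ; ℤ/2)`. -/
def IsHomologyBasis (X : CellSurface F) {ι : Type*} (v : ι → X.Edge → ZMod 2) : Prop :=
  ∃ b : Module.Basis ι (ZMod 2) X.H₁,
    ∀ i, ∃ z : X.cycles, (z : X.Edge → ZMod 2) = v i ∧ b i = Submodule.Quotient.mk z

/-! ### Closed curves transverse to the graph

Give every edge length 1 and identify every face with a convex polygon. A pair `(x, t)` with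
`0 < t < 1` is the point of the edge of `x` at distance `t` from the vertex of `x`, seen on the
boundary of the face of `x`. Up to isotopy a closed curve transverse to `Γ` is a cyclic sequence of
chords of the polygons. -/

/-- A closed curve `γ` transverse to `Γ`, with a direction, a starting point on `Γ` and a choice of
one side of `γ`, which is carried along `γ`.

At its `k`-th crossing, `γ` enters the face of `flag k` through the point `(flag k, t k)`, and the
vertex of `flag k` is the end of the crossed edge on the chosen side of `γ`. It leaves that face at
the `(k+1)`-st crossing. The part of the boundary of the face cut off by this chord on the chosen
side consists of a segment of the edge of `flag k`, of `r k` whole sides, which are, directed as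
`γ`, `τ₁ (flag k), next (τ₁ (flag k)), …`, and of a segment of the edge of `flag (k + 1)`. In
particular it contains a vertex.

After `len` crossings `γ` is back at its starting point, with the same chosen side if `γ` is
two-sided, and with the other one if `γ` is one-sided. Values at indices above `len` are
irrelevant. -/
structure Curve (X : CellSurface F) where
  len : ℕ
  len_pos : 0 < len
  flag : ℕ → F
  t : ℕ → ℝ
  r : ℕ → ℕ
  t_pos : ∀ k, k ≤ len → 0 < t k
  t_lt : ∀ k, k ≤ len → t k < 1
  chord : ∀ k, k < len → (X.next ^ r k) (X.τ₁ (flag k)) = X.τ₂ (flag (k + 1))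
  chord_lt : ∀ k, k < len → t k + r k + t (k + 1) < X.sides (flag k)
  closed : (flag len = flag 0 ∧ t len = t 0) ∨ (flag len = X.τ₀ (flag 0) ∧ t len = 1 - t 0)

/-- Two pairs `(x, t)` define the same point of `Γ`. -/
def SamePoint (X : CellSurface F) (x : F) (t : ℝ) (y : F) (u : ℝ) : Prop :=
  ((y = x ∨ y = X.τ₂ x) ∧ u = t) ∨ ((y = X.τ₀ x ∨ y = X.τ₀ (X.τ₂ x)) ∧ u = 1 - t)

namespace Curve

variable {X : CellSurface F}

def TwoSided (γ : X.Curve) : Prop := γ.flag γ.len = γ.flag 0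

def OneSided (γ : X.Curve) : Prop := γ.flag γ.len = X.τ₀ (γ.flag 0)

/-- The number of points in which `γ` meets the edge `e`. -/
def crossings (γ : X.Curve) (e : X.Edge) : ℕ :=
  ((Finset.range γ.len).filter fun k => X.edge (γ.flag k) = e).card

/-- The intersection number mod 2 of `γ` with the edges, that is, the dual 1-chain of `γ`. -/
def chain (γ : X.Curve) (e : X.Edge) : ZMod 2 := (γ.crossings e : ZMod 2)

/-- The boundary point `(z, s)` of the polygon lies in the part of the boundary that the `k`-th
chord cuts off on the chosen side; `z` is a side directed as this part is. -/
def CutsOff (γ : X.Curve) (k : ℕ) (z : F) (s : ℝ) : Prop :=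
  ∃ i : ℤ, (X.next ^ i) (X.τ₁ (γ.flag k)) = z ∧ -γ.t k < i + s ∧ i + s < γ.r k + γ.t (k + 1)

/-- The same, for a side `z` of any direction. -/
def OnSide (γ : X.Curve) (k : ℕ) (z : F) (s : ℝ) : Prop :=
  γ.CutsOff k z s ∨ γ.CutsOff k (X.τ₀ z) (1 - s)

/-- The `k`-th chord of `γ` and the `l`-th chord of `δ` cross: they lie in the same polygon and
their end points alternate on its boundary. -/
def ChordsCross (γ δ : X.Curve) (k l : ℕ) : Prop :=
  Xor (γ.OnSide k (δ.flag l) (δ.t l)) (γ.OnSide k (X.τ₂ (δ.flag (l + 1))) (δ.t (l + 1)))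

/-- `γ` is a simple closed curve. -/
def IsSimple (γ : X.Curve) : Prop :=
  (∀ k l, k < l → l < γ.len → ¬ X.SamePoint (γ.flag k) (γ.t k) (γ.flag l) (γ.t l)) ∧
  ∀ k l, k < γ.len → l < γ.len → ¬ γ.ChordsCross γ k l

/-- `γ` and `δ` have no common point on `Γ`. -/
def Generic (γ δ : X.Curve) : Prop :=
  ∀ k l, k < γ.len → l < δ.len → ¬ X.SamePoint (γ.flag k) (γ.t k) (δ.flag l) (δ.t l)

/-- `γ` and `δ` are disjoint. -/
def IsDisjoint (γ δ : X.Curve) : Prop :=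
  γ.Generic δ ∧ ∀ k l, k < γ.len → l < δ.len → ¬ γ.ChordsCross δ k l

/-- The intersection number mod 2 of `γ` and `δ`. -/
def inter (γ δ : X.Curve) : ZMod 2 :=
  ∑ k ∈ Finset.range γ.len, ∑ l ∈ Finset.range δ.len, if γ.ChordsCross δ k l then 1 else 0

/-- The walk in `Γ` (a list of directed edges) that follows `γ` once along its chosen side, through
all the vertices adjacent to `γ` on that side. It starts at the vertex of `flag 0` and ends at that
of `flag len`. -/
def sideWalk (γ : X.Curve) : List F :=
  (List.range γ.len).flatMap fun k =>
    (List.range (γ.r k)).map fun i => (X.next ^ i) (X.τ₁ (γ.flag k))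

/-- For one-sided `γ`: `sideWalk` joins the two ends of the edge which `γ` crosses at its starting
point; closed up by this edge it is a closed walk. -/
def oneSidedWalk (γ : X.Curve) : List F := γ.sideWalk ++ [X.τ₀ (γ.flag 0)]

end Curve

/-- Simple closed curves `α₁, …, α_{2g}` and `β₁, …, β_b` transverse to `Γ`. The `β`'s are one-sided,
disjoint from each other and from the `α`'s, the `α`'s are two-sided, and the classes of all of
them form a basis of `H₁(Σ; ℤ/2)`. The `α`'s may cross each other, but not on `Γ`. -/
structure CurveSystem (X : CellSurface F) (g b : ℕ) where
  α : Fin (2 * g) → X.Curve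
  β : Fin b → X.Curve
  α_simple : ∀ j, (α j).IsSimple
  β_simple : ∀ l, (β l).IsSimple
  α_twoSided : ∀ j, (α j).TwoSided
  β_oneSided : ∀ l, (β l).OneSided
  α_generic : ∀ j k, j ≠ k → (α j).Generic (α k)
  β_disjoint : ∀ l m, l ≠ m → (β l).IsDisjoint (β m)
  αβ_disjoint : ∀ j l, (α j).IsDisjoint (β l)
  basis : X.IsHomologyBasis (Sum.elim (fun j => (α j).chain) fun l => (β l).chain)

namespace CurveSystem

variable {X : CellSurface F} {g b : ℕ}

/-- The cochain `ω(e) = e · ∑ β_l`. -/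
def ω (S : X.CurveSystem g b) (e : X.Edge) : ZMod 2 := ∑ l, (S.β l).chain e

/-- None of the `β`'s meets the edge `e`. -/
def AvoidsEdge (S : X.CurveSystem g b) (e : X.Edge) : Prop := ∀ l, (S.β l).crossings e = 0

end CurveSystem

/-- Local orientations at the vertices such that the orientations at the ends of an edge `e` agree
along `e` if and only if `ω e = 0`. `sign x = 0` (that is, `+`) means that at the vertex of `x` the
face of `x` lies to the left of the directed edge of `x`. If `ω` counts the intersections with the
curves `β_l`, this is an orientation of the surface cut along these curves. -/
structure LocalOrientation (X : CellSurface F) (ω : X.Edge → ZMod 2) where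
  sign : F → ZMod 2
  sign_τ₁ : ∀ x, sign (X.τ₁ x) = sign x + 1
  sign_τ₂ : ∀ x, sign (X.τ₂ x) = sign x + 1
  sign_τ₀ : ∀ x, sign (X.τ₀ x) = sign x + 1 + ω (X.edge x)

/-! ### Orientations of the edges -/

/-- An orientation of the edges of `Γ`: `dir x = 0` if the directed edge of `x` has the chosen
direction, `dir x = 1` if it has the opposite one. -/
structure EdgeOrientation (X : CellSurface F) where
  dir : F → ZMod 2
  dir_τ₂ : ∀ x, dir (X.τ₂ x) = dir x
  dir_τ₀ : ∀ x, dir (X.τ₀ x) = dir x + 1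

namespace EdgeOrientation

variable {X : CellSurface F}

/-- The parity of the number of edges of a walk that are directed against `K`. -/
def disagree (K : X.EdgeOrientation) (C : List F) : ZMod 2 := (C.map K.dir).sum

/-- Invert `K` on the edges `e` with `c e = 1`. -/
def twist (K : X.EdgeOrientation) (c : X.Edge → ZMod 2) : X.EdgeOrientation where
  dir x := K.dir x + c (X.edge x)
  dir_τ₂ x := by
    have h : X.edge (X.τ₂ x) = X.edge x :=
      Quotient.sound ⟨⟨X.τ₂, Subgroup.subset_closure (by simp)⟩, rfl⟩
    rw [h, K.dir_τ₂]
  dir_τ₀ x := by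
    have h : X.edge (X.τ₀ x) = X.edge x :=
      Quotient.sound ⟨⟨X.τ₀, Subgroup.subset_closure (by simp)⟩, rfl⟩
    rw [h, K.dir_τ₀]; ring

/-- The Kasteleyn curvature of `K` at a lift to the orientation cover of the face of `x`. The
boundary of the face, followed in the direction of `x`, lifts to the positively oriented boundary
of one of the two lifts of the face, and the sign of the lifted vertex at the tail of the directed
side `y` is `o.sign y`. The curvature counts the edges directed against `K`, plus the edges that
join two vertices labelled `-`, plus 1. -/
def curvature (K : X.EdgeOrientation) {ω : X.Edge → ZMod 2} (o : X.LocalOrientation ω) (x : F) :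
    ZMod 2 :=
  ∑ i ∈ Finset.range (X.sides x),
      (K.dir ((X.next ^ i) x) +
        if o.sign ((X.next ^ i) x) = 1 ∧ o.sign ((X.next ^ (i + 1)) x) = 1 then 1 else 0) + 1

/-- `K` is a Kasteleyn orientation on `(X, ω)`. -/
def IsKasteleyn (K : X.EdgeOrientation) {ω : X.Edge → ZMod 2} (o : X.LocalOrientation ω) : Prop :=
  ∀ x, K.curvature o x = 0

/-- `K` directs the edge `e` from the vertex `u` to the vertex `v`. -/
def Directs (K : X.EdgeOrientation) (e : X.Edge) (u v : X.Vertex) : Prop :=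
  ∃ x, X.edge x = e ∧ X.vert x = u ∧ X.head x = v ∧ K.dir x = 0

/-- `1` (resp. `-1`) if `e` is oriented from `u` to `v` (resp. from `v` to `u`); `0` if `e` is a loop
or does not join `u` and `v`. -/
def ε (K : X.EdgeOrientation) (e : X.Edge) (u v : X.Vertex) : ℂ :=
  (if K.Directs e u v then 1 else 0) - (if K.Directs e v u then 1 else 0)

/-- The weighted adjacency matrix `A^{K,ω}`, the vertices being numbered by `num`. -/
def adjMatrix (K : X.EdgeOrientation) (ω : X.Edge → ZMod 2) (w : X.Edge → ℝ) {n : ℕ}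
    (num : X.Vertex ≃ Fin (2 * n)) : Matrix (Fin (2 * n)) (Fin (2 * n)) ℂ :=
  fun j k => ∑ e : X.Edge,
    K.ε e (num.symm j) (num.symm k) * Complex.I ^ (ω e).val * (w e : ℂ)

end EdgeOrientation

namespace CurveSystem

variable {X : CellSurface F} {g b : ℕ}

/-- `o` being an orientation of the surface cut along the `β`'s, the cycles associated to the curves
are as they should be: every curve lies to the left of its walk; the walk of `α_j` is disjoint from
the `β`'s; the walk of `β_l` consists of an edge that meets `β_l` exactly once and no other `β_m`,
and of edges that are disjoint from the `β`'s. -/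
structure IsAdapted (S : X.CurveSystem g b) (o : X.LocalOrientation S.ω) : Prop where
  α_left : ∀ j, o.sign (X.τ₁ ((S.α j).flag 0)) = 0
  β_left : ∀ l, o.sign (X.τ₁ ((S.β l).flag 0)) = 0
  α_avoids : ∀ j, ∀ y ∈ (S.α j).sideWalk, S.AvoidsEdge (X.edge y)
  β_avoids : ∀ l, ∀ y ∈ (S.β l).sideWalk, S.AvoidsEdge (X.edge y)
  β_once : ∀ l, (S.β l).crossings (X.edge ((S.β l).flag 0)) = 1
  β_other : ∀ l m, m ≠ l → (S.β m).crossings (X.edge ((S.β l).flag 0)) = 0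

/-- `n^K(C_γ)` is odd for all `γ` among the `α_j` and the `β_l`. -/
def IsNormalized (S : X.CurveSystem g b) (K : X.EdgeOrientation) : Prop :=
  (∀ j, K.disagree (S.α j).sideWalk = 1) ∧ ∀ l, K.disagree (S.β l).oneSidedWalk = 1

/-- `K_ε`: invert `K` on an edge each time it meets `α_j` with `ε_j = 1`. -/
def twisted (S : X.CurveSystem g b) (K : X.EdgeOrientation) (ε : Fin (2 * g) → ZMod 2) :
    X.EdgeOrientation :=
  K.twist fun e => ∑ j, ε j * (S.α j).chain e

/-- `(-1) ^ ∑_{j<k} ε_j ε_k α_j·α_k`. -/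
def coeff (S : X.CurveSystem g b) (ε : Fin (2 * g) → ZMod 2) : ℝ :=
  (-1) ^ (∑ j, ∑ k, if j < k then ε j * ε k * (S.α j).inter (S.α k) else 0).val

end CurveSystem

/-! ### The dimer model -/

/-- `D` is a dimer configuration (a perfect matching) of `Γ`. -/
def IsDimer (X : CellSurface F) (D : Finset X.Edge) : Prop :=
  (∀ x, X.edge x ∈ D → X.vert x ≠ X.head x) ∧
  ∀ v, ∃! e, e ∈ D ∧ ∃ x, X.vert x = v ∧ X.edge x = e

/-- The partition function of the dimer model on `Γ` with edge weights `w`. -/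
def partitionFunction (X : CellSurface F) (w : X.Edge → ℝ) : ℝ :=
  ∑ D ∈ (Finset.univ : Finset (Finset X.Edge)).filter X.IsDimer, ∏ e ∈ D, w e

end CellSurface

/-- The Pfaffian of a skew-symmetric matrix of size `2n`. Every matching of the indices is
represented by the unique permutation `σ` with `σ(2k) < σ(2k+1)` for all `k` and
`σ(0) < σ(2) < σ(4) < …`. -/
def pfaffian {n : ℕ} (A : Matrix (Fin (2 * n)) (Fin (2 * n)) ℂ) : ℂ :=
  ∑ σ ∈ (Finset.univ : Finset (Equiv.Perm (Fin (2 * n)))).filter (fun σ =>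
      (∀ k : Fin n, σ ⟨2 * k, by omega⟩ < σ ⟨2 * k + 1, by omega⟩) ∧
      ∀ k l : Fin n, k < l → σ ⟨2 * k, by omega⟩ < σ ⟨2 * l, by omega⟩),
    ((Equiv.Perm.sign σ : ℤ) : ℂ) * ∏ k : Fin n, A (σ ⟨2 * k, by omega⟩) (σ ⟨2 * k + 1, by omega⟩)

end

/-! Place all half-edges of `Γ` on a line, ordered by the number of their vertex and clockwise
around each vertex from a base corner (`HalfEdgeOrder`), and draw the edges as arcs over this line.
Crossing numbers of arcs give a symmetric matrix on edges, `link`. Adding `ω e * ω f`, and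
correcting the diagonal to zero, gives `signMatrix`; let `q` be a quadratic function on 1-chains mod
2 with this polarization and with `q e` recording how `K` directs the arc `e`.

Expanding the Pfaffian, a dimer configuration `D` contributes its weight times `(-1)^q(D) i^ω(D)`,
with `ω(D)` read as 0 or 1 (`pfaffian_adjMatrix`). Crossings of arcs account for the sign of the
permutation, and the terms `ω e * ω f` for reducing a product of powers of `i` modulo 2. Twisting
`K` along a curve `γ` multiplies the contribution by `(-1)^(γ·D)`.

Two configurations differ by a cycle of the graph, so the task is to see how `q` changes when a
cycle `C` is added. Let `C` run alongside a dual curve `γ`. The pairing of an edge with `C` under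
`interMatrix` is its intersection number with `γ`, up to the coboundary of the number of base
corners lying between `C` and `γ` (`sum_interMatrix`). A perfect matching pairs with the coboundary
of `h` to the sum of `h` over all vertices, so this error is the total number of those base corners.
The same number is `q(C)` for boundaries of faces, by the Kasteleyn condition (`quadratic_face`),
and for the walks along the `α_j` and `β_l`, by the parity condition (`quadratic_twoSided`,
`quadratic_oneSided`). The two cancel, and `q(D + C) = q(D) + γ·D + ω(D) ω(C)` (`quadratic_add`).

To evaluate `q(C)`, the cyclic list of half-edges along `C` is bracketed by edges (`halves`) or by
corners (`passes`). Summing the order over pairs in the first bracketing gives `q`; in the second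
the half-edges at a corner are neighbours in the rotation, and what remains are base corners and
contacts of `C` with itself. Contacts cancel for a face; for a simple curve they are computed from
the fact that its chords do not cross.

By duality the face boundaries and the walks along the curves span all cycles
(`mem_span_generators`). Let `p(D)` be the combination of the `α_j` with the same intersection
numbers with the `α_j` as `D`, and `Q` the quadratic function `∑_{j<k} a_j a_k α_j·α_k`. Then `q(D)
+ Q(p(D)) + ∑_{l<m} (β_l·D)(β_m·D)` is the same for all `D` (`sign_eq`).

Summing `(-1)^Q(ε) (-1)^(∑ ε_j α_j·D)` over `ε` completes the square and gives `(-1)^Q(p(D))` times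
a Gauss sum of absolute value `2^g` (`sum_zsign_quad_add`, `gauss_sum_sq`). It remains to produce
the `β`-term from real and imaginary parts. For one `β` it is absent, and `Re + Im` replaces
`i^ω(D)` by 1. For two, it vanishes when `ω(D) = 1`, the imaginary case; when `ω(D) = 0` both
intersection numbers equal `β_1·D`, and twisting the real part by `β_1` supplies the sign. -/

set_option linter.unusedSectionVars false

/-! ### Indicators -/

/-- The indicator of a proposition, with values in `ℤ/2`. -/
noncomputable def iv (p : Prop) : ZMod 2 := if p then 1 else 0

theorem iv_true {p : Prop} (h : p) : iv p = 1 := if_pos h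

theorem iv_false {p : Prop} (h : ¬ p) : iv p = 0 := if_neg h

theorem iv_congr {p q : Prop} (h : p ↔ q) : iv p = iv q := by rw [propext h]

theorem iv_not (p : Prop) : iv (¬ p) = 1 + iv p := by
  by_cases h : p <;> simp [iv, h]
  rfl

theorem iv_or {p q : Prop} (h : ¬ (p ∧ q)) : iv (p ∨ q) = iv p + iv q := by
  by_cases hp : p <;> by_cases hq : q <;> simp_all [iv]

theorem zmod2_add_self (a : ZMod 2) : a + a = 0 := CharTwo.add_self_eq_zero a

theorem zmod2_cases (a : ZMod 2) : a = 0 ∨ a = 1 := by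
  revert a; decide

theorem zmod2_mul_self (a : ZMod 2) : a * a = a := by
  revert a; decide

theorem zmod2_add_eq_zero {a b : ZMod 2} : a + b = 0 ↔ a = b := by
  revert a b; decide

namespace CellSurface

variable {F : Type*} [Fintype F] {X : CellSurface F}

/-! ### Cells of flags -/

theorem vert_τ₁ (X : CellSurface F) (x : F) : X.vert (X.τ₁ x) = X.vert x :=
  Quotient.sound ⟨⟨X.τ₁, Subgroup.subset_closure (by simp)⟩, rfl⟩

theorem vert_τ₂ (X : CellSurface F) (x : F) : X.vert (X.τ₂ x) = X.vert x :=
  Quotient.sound ⟨⟨X.τ₂, Subgroup.subset_closure (by simp)⟩, rfl⟩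

theorem edge_τ₀ (X : CellSurface F) (x : F) : X.edge (X.τ₀ x) = X.edge x :=
  Quotient.sound ⟨⟨X.τ₀, Subgroup.subset_closure (by simp)⟩, rfl⟩

theorem edge_τ₂ (X : CellSurface F) (x : F) : X.edge (X.τ₂ x) = X.edge x :=
  Quotient.sound ⟨⟨X.τ₂, Subgroup.subset_closure (by simp)⟩, rfl⟩

theorem head_τ₀ (X : CellSurface F) (x : F) : X.head (X.τ₀ x) = X.vert x := by
  rw [head, X.τ₀_invol]

theorem head_τ₂ (X : CellSurface F) (x : F) : X.head (X.τ₂ x) = X.head x := by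
  rw [head, X.comm, vert_τ₂, head]

/-- A set of flags that is stable under two involutions contains the orbits of its elements. -/
theorem orbit_induction {S : Set (Equiv.Perm F)} {p : F → Prop}
    (hS : ∀ s ∈ S, ∀ x, p x ↔ p (s x)) {x y : F}
    (h : (Quotient.mk _ x : OrbitSet S) = Quotient.mk _ y) (hx : p x) : p y := by
  have key : ∀ s ∈ Subgroup.closure S, ∀ z, p z ↔ p (s z) := by
    intro s hs
    induction hs using Subgroup.closure_induction with
    | mem s hs => exact hS s hs
    | one => intro z; rfl
    | mul a b _ _ ha hb => intro z; rw [hb z, ha (b z)]; rfl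
    | inv a _ ha => intro z; rw [ha (a⁻¹ z)]; simp
  have h' : MulAction.orbitRel (Subgroup.closure S) F x y := Quotient.exact h
  obtain ⟨⟨s, hs⟩, hxy⟩ := h'
  have hsy : s y = x := hxy
  rw [key s hs y, hsy]
  exact hx

theorem edge_eq_iff {x y : F} :
    X.edge x = X.edge y ↔ y = x ∨ y = X.τ₂ x ∨ y = X.τ₀ x ∨ y = X.τ₀ (X.τ₂ x) := by
  constructor
  · intro h
    refine orbit_induction (S := {X.τ₀, X.τ₂})
      (p := fun y => y = x ∨ y = X.τ₂ x ∨ y = X.τ₀ x ∨ y = X.τ₀ (X.τ₂ x)) ?_ h (Or.inl rfl)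
    have h2 : ∀ s : Equiv.Perm F, (∀ z, s (s z) = z) →
        (∀ z, (z = x ∨ z = X.τ₂ x ∨ z = X.τ₀ x ∨ z = X.τ₀ (X.τ₂ x)) →
          (s z = x ∨ s z = X.τ₂ x ∨ s z = X.τ₀ x ∨ s z = X.τ₀ (X.τ₂ x))) →
        ∀ z, (z = x ∨ z = X.τ₂ x ∨ z = X.τ₀ x ∨ z = X.τ₀ (X.τ₂ x)) ↔
          (s z = x ∨ s z = X.τ₂ x ∨ s z = X.τ₀ x ∨ s z = X.τ₀ (X.τ₂ x)) := by
      intro s hs himp z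
      refine ⟨himp z, fun h => ?_⟩
      have := himp _ h
      rwa [hs z] at this
    intro s hs
    rcases hs with rfl | rfl
    · refine h2 _ X.τ₀_invol ?_
      rintro z (rfl | rfl | rfl | rfl) <;> simp [X.τ₀_invol]
    · refine h2 _ X.τ₂_invol ?_
      rintro z (rfl | rfl | rfl | rfl) <;> simp [X.τ₂_invol, ← X.comm]
  · rintro (rfl | rfl | rfl | rfl) <;> simp [edge_τ₀, edge_τ₂]

/-- Two flags belong to the same half-edge. -/
def SameHalf (X : CellSurface F) (x y : F) : Prop := y = x ∨ y = X.τ₂ x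

theorem SameHalf.symm {x y : F} (h : X.SameHalf x y) : X.SameHalf y x := by
  rcases h with rfl | rfl
  · exact Or.inl rfl
  · exact Or.inr (X.τ₂_invol x).symm

theorem sameHalf_comm {x y : F} : X.SameHalf x y ↔ X.SameHalf y x :=
  ⟨SameHalf.symm, SameHalf.symm⟩

theorem sameHalf_τ₂_left {x y : F} : X.SameHalf (X.τ₂ x) y ↔ X.SameHalf x y := by
  simp only [SameHalf, X.τ₂_invol]; tauto

theorem sameHalf_τ₂_right {x y : F} : X.SameHalf x (X.τ₂ y) ↔ X.SameHalf x y := by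
  rw [sameHalf_comm, sameHalf_τ₂_left, sameHalf_comm]

theorem SameHalf.vert_eq {x y : F} (h : X.SameHalf x y) : X.vert x = X.vert y := by
  rcases h with rfl | rfl
  · rfl
  · rw [vert_τ₂]

theorem not_sameHalf_τ₀ (x : F) : ¬ X.SameHalf x (X.τ₀ x) := by
  rintro (h | h)
  · exact X.τ₀_ne x h
  · exact X.τ₀τ₂_ne x (by rw [X.comm, h, X.τ₂_invol])

/-- The half-edges are ordered linearly: by the number of the vertex first, and clockwise around
every vertex, starting after a base corner. `lt x y` is the indicator of `x < y`, and a corner is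
represented by its flag of sign `0`. -/
structure HalfEdgeOrder (X : CellSurface F) {ω : X.Edge → ZMod 2} (o : X.LocalOrientation ω)
    {n : ℕ} (num : X.Vertex ≃ Fin n) where
  lt : F → F → ZMod 2
  base : F → ZMod 2
  lt_τ₂_left : ∀ x y, lt (X.τ₂ x) y = lt x y
  lt_τ₂_right : ∀ x y, lt x (X.τ₂ y) = lt x y
  lt_self : ∀ x, lt x x = 0
  lt_add : ∀ x y, lt x y + lt y x = 1 + iv (X.SameHalf x y)
  lt_corner : ∀ x y, o.sign y = 0 →
    lt x (X.τ₁ y) + lt x y = iv (X.SameHalf x (X.τ₁ y)) + base y * iv (X.vert x = X.vert y)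
  lt_of_vert_ne : ∀ x y, X.vert x ≠ X.vert y → lt x y = iv (num (X.vert x) < num (X.vert y))

/-! ### Construction of the order from the rotation around each vertex. -/

section Construction

variable {ω : X.Edge → ZMod 2} (o : X.LocalOrientation ω)

/-- The flag of sign `0` in the half-edge of `x`. -/
noncomputable def posFlag (x : F) : F := if o.sign x = 0 then x else X.τ₂ x

theorem posFlag_sameHalf (x : F) : X.SameHalf x (posFlag o x) := by
  unfold posFlag
  split_ifs
  · exact Or.inl rfl
  · exact Or.inr rfl

theorem posFlag_τ₂ (x : F) : posFlag o (X.τ₂ x) = posFlag o x := by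
  unfold posFlag
  rw [o.sign_τ₂]
  rcases zmod2_cases (o.sign x) with h | h
  · simp [h, X.τ₂_invol]
  · simp [h]; intro h'; exact absurd h' (by decide)

theorem posFlag_of_sign {x : F} (h : o.sign x = 0) : posFlag o x = x := if_pos h

theorem posFlag_of_sign_one {x : F} (h : o.sign x = 1) : posFlag o x = X.τ₂ x := by
  unfold posFlag; rw [h]; simp

/-- The first half-edge at a vertex. -/
noncomputable def firstFlag (v : X.Vertex) : F := posFlag o (Quotient.out v)

theorem exists_rotation (x : F) :
    ∃ i : ℕ, ((X.τ₁ * X.τ₂) ^ i) (firstFlag o (X.vert x)) = posFlag o x := by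
  set ρ := X.τ₁ * X.τ₂ with hρ
  set b := firstFlag o (X.vert x)
  have hfin : ∀ z : F, (∃ i : ℤ, (ρ ^ i) b = z) → ∃ i : ℕ, (ρ ^ i) b = z := by
    rintro z ⟨i, rfl⟩
    obtain ⟨j, hj⟩ := (isOfFinOrder_of_finite ρ).mem_powers_iff_mem_zpowers.2 ⟨i, rfl⟩
    exact ⟨j, by simp only at hj; rw [hj]⟩
  apply hfin
  have hx : (Quotient.mk _ (Quotient.out (X.vert x)) : OrbitSet {X.τ₁, X.τ₂}) = Quotient.mk _ x :=
    Quotient.out_eq _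
  refine orbit_induction (S := {X.τ₁, X.τ₂}) (p := fun z => ∃ i : ℤ, (ρ ^ i) b = posFlag o z) ?_ hx
    ⟨0, rfl⟩
  intro s hs z
  rcases hs with rfl | rfl
  · have step : ∀ z, (∃ i : ℤ, (ρ ^ i) b = posFlag o z) →
        ∃ i : ℤ, (ρ ^ i) b = posFlag o (X.τ₁ z) := by
      rintro z ⟨i, hi⟩
      rcases zmod2_cases (o.sign z) with h | h
      -- If `z` has sign 0, the positive flag of the half-edge of `τ₁ z` is `τ₂ (τ₁ z)`, one
      -- rotation step before `z`; for sign 1 it is one step after.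
      · refine ⟨-1 + i, ?_⟩
        rw [posFlag_of_sign_one o (by rw [o.sign_τ₁, h]; rfl), zpow_add, Equiv.Perm.mul_apply, hi,
          posFlag_of_sign o h]
        rw [zpow_neg_one, Equiv.Perm.inv_eq_iff_eq]
        simp [hρ, X.τ₁_invol, X.τ₂_invol]
      · refine ⟨1 + i, ?_⟩
        rw [posFlag_of_sign o (by rw [o.sign_τ₁, h]; rfl), zpow_add, Equiv.Perm.mul_apply, hi,
          posFlag_of_sign_one o h]
        simp [hρ, X.τ₂_invol]
    refine ⟨step z, fun h => ?_⟩
    have := step _ h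
    rwa [X.τ₁_invol] at this
  · simp only [posFlag_τ₂]

/-- The position of the half-edge of `x` among those at its vertex. -/
noncomputable def rotationIndex (x : F) : ℕ := Nat.find (exists_rotation o x)

theorem rotationIndex_spec (x : F) :
    ((X.τ₁ * X.τ₂) ^ rotationIndex o x) (firstFlag o (X.vert x)) = posFlag o x :=
  Nat.find_spec (exists_rotation o x)

theorem rotationIndex_le {x : F} {i : ℕ}
    (h : ((X.τ₁ * X.τ₂) ^ i) (firstFlag o (X.vert x)) = posFlag o x) : rotationIndex o x ≤ i :=
  Nat.find_min' _ h

theorem rotationIndex_τ₂ (x : F) : rotationIndex o (X.τ₂ x) = rotationIndex o x := by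
  apply le_antisymm
  · apply rotationIndex_le
    rw [vert_τ₂, posFlag_τ₂, rotationIndex_spec]
  · apply rotationIndex_le
    rw [← posFlag_τ₂, ← rotationIndex_spec, vert_τ₂]

theorem sameHalf_iff_rotationIndex {x y : F} (hv : X.vert x = X.vert y) :
    X.SameHalf x y ↔ rotationIndex o x = rotationIndex o y := by
  constructor
  · rintro (rfl | rfl)
    · rfl
    · rw [rotationIndex_τ₂]
  · intro h
    have hp : posFlag o x = posFlag o y := by
      rw [← rotationIndex_spec, ← rotationIndex_spec, h, hv]
    have h1 := posFlag_sameHalf o x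
    have h2 := posFlag_sameHalf o y
    rw [hp] at h1
    rcases h1 with h1 | h1 <;> rcases h2 with h2 | h2
    · exact Or.inl (h2.symm.trans h1)
    · right; rw [← h1, h2, X.τ₂_invol]
    · right; rw [← h1, h2]
    · left; exact X.τ₂.injective (h2.symm.trans h1)

theorem posFlag_τ₁ {y : F} (hy : o.sign y = 0) : posFlag o (X.τ₁ y) = X.τ₂ (X.τ₁ y) :=
  posFlag_of_sign_one o (by rw [o.sign_τ₁, hy]; rfl)

theorem rotationIndex_τ₁_of_succ {y : F} (hy : o.sign y = 0) {j : ℕ}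
    (hj : rotationIndex o y = j + 1) : rotationIndex o (X.τ₁ y) = j := by
  have hs := rotationIndex_spec o y
  rw [hj, pow_succ', Equiv.Perm.mul_apply, posFlag_of_sign o hy] at hs
  apply le_antisymm
  · apply rotationIndex_le
    rw [vert_τ₁, posFlag_τ₁ o hy]
    apply (X.τ₁ * X.τ₂).injective
    rw [hs]; simp [X.τ₁_invol, X.τ₂_invol]
  · have h1 := rotationIndex_spec o (X.τ₁ y)
    rw [vert_τ₁, posFlag_τ₁ o hy] at h1
    have h2 : rotationIndex o y ≤ rotationIndex o (X.τ₁ y) + 1 := by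
      apply rotationIndex_le
      rw [pow_succ', Equiv.Perm.mul_apply, h1, posFlag_of_sign o hy]
      simp [X.τ₁_invol, X.τ₂_invol]
    omega

/-- Rotating once more from the half-edge of `τ₁ y` returns to the first one, so its index plus one
is a period, and any larger index could be reduced by this period. Thus the corner of `y` is the one
where the cyclic order is cut open. -/
theorem rotationIndex_le_of_zero {x y : F} (hy : o.sign y = 0) (hv : X.vert x = X.vert y)
    (h0 : rotationIndex o y = 0) : rotationIndex o x ≤ rotationIndex o (X.τ₁ y) := by
  have hs := rotationIndex_spec o y
  rw [h0, posFlag_of_sign o hy] at hs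
  simp only [pow_zero, Equiv.Perm.coe_one, id_eq] at hs
  have h1 := rotationIndex_spec o (X.τ₁ y)
  rw [vert_τ₁, posFlag_τ₁ o hy, hs] at h1
  set p := rotationIndex o (X.τ₁ y)
  have h2 : ((X.τ₁ * X.τ₂) ^ (p + 1)) y = y := by
    rw [pow_succ', Equiv.Perm.mul_apply, h1]
    simp [X.τ₁_invol, X.τ₂_invol]
  by_contra hlt
  push Not at hlt
  have h3 := rotationIndex_spec o x
  rw [hv, hs] at h3
  have h4 : rotationIndex o x ≤ rotationIndex o x - (p + 1) := by
    apply rotationIndex_le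
    rw [hv, hs, ← h3]
    conv_rhs => rw [show rotationIndex o x = (rotationIndex o x - (p + 1)) + (p + 1) by omega,
      pow_add, Equiv.Perm.mul_apply, h2]
  omega

/-- The order is lexicographic in the number of the vertex and the rotation index, and the base
corner is the one before the first half-edge. For `lt_corner`: the half-edge of `τ₁ y` is the
predecessor of that of `y`, or the last one if `y` is first. -/
theorem nonempty_halfEdgeOrder {n : ℕ} (num : X.Vertex ≃ Fin n) :
    Nonempty (HalfEdgeOrder X o num) := by
  refine ⟨⟨fun x y => iv (num (X.vert x) < num (X.vert y) ∨
      (X.vert x = X.vert y ∧ rotationIndex o x < rotationIndex o y)),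
    fun y => iv (rotationIndex o y = 0), ?_, ?_, ?_, ?_, ?_, ?_⟩⟩
  · intro x y; simp only [vert_τ₂, rotationIndex_τ₂]
  · intro x y; simp only [vert_τ₂, rotationIndex_τ₂]
  · intro x; simp [iv]
  · intro x y
    by_cases hv : X.vert x = X.vert y
    · simp only [hv, lt_irrefl, true_and, false_or, sameHalf_iff_rotationIndex o hv]
      rcases lt_trichotomy (rotationIndex o x) (rotationIndex o y) with h | h | h
      · simp [iv, h, h.ne, h.not_gt]
      · simp [iv, h, zmod2_add_self]
      · simp [iv, h, h.ne', h.not_gt]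
    · have hs : ¬ X.SameHalf x y := fun h => hv h.vert_eq
      have hn : num (X.vert x) ≠ num (X.vert y) := fun h => hv (num.injective h)
      have hv' : ¬ X.vert y = X.vert x := fun h => hv h.symm
      simp only [hv, hv', false_and, or_false, iv_false hs, add_zero]
      rcases lt_or_gt_of_ne hn with h | h
      · simp [iv, h, h.not_gt]
      · simp [iv, h, h.not_gt]
  · intro x y hy
    simp only [vert_τ₁]
    by_cases hv : X.vert x = X.vert y
    · rw [iv_congr (sameHalf_iff_rotationIndex o (hv.trans (X.vert_τ₁ y).symm))]
      simp only [hv, lt_irrefl, true_and, false_or, iv_true (p := True) trivial, mul_one]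
      rcases Nat.eq_zero_or_pos (rotationIndex o y) with h0 | h0
      · have := rotationIndex_le_of_zero o hy hv h0
        rw [h0, iv_true (p := 0 = 0) rfl]
        rcases this.lt_or_eq with h | h
        · simp [iv, h, h.ne]
        · simp [iv, h, zmod2_add_self]
      · obtain ⟨j, hj⟩ : ∃ j, rotationIndex o y = j + 1 := ⟨rotationIndex o y - 1, by omega⟩
        rw [rotationIndex_τ₁_of_succ o hy hj, hj]
        rcases lt_trichotomy (rotationIndex o x) j with h | h | h
        · simp [iv, h, h.ne, show rotationIndex o x < j + 1 by omega, zmod2_add_self]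
        · simp [iv, h]
        · simp [iv, show ¬ rotationIndex o x < j by omega, h.ne',
            show ¬ rotationIndex o x < j + 1 by omega]
    · have hs : ¬ X.SameHalf x (X.τ₁ y) := fun h => hv (h.vert_eq.trans (X.vert_τ₁ y))
      simp [hv, iv_false hs, zmod2_add_self, iv_false (p := False)]
  · intro x y hv
    simp [hv]

end Construction

end CellSurface

/-! ### Sums over pairs of entries of lists -/

section Lists

variable {A : Type*}

/-- `∑ f a b` over the entries `a` of `l` and `b` of `l'`. -/
def crossSum (f : A → A → ZMod 2) (l l' : List A) : ZMod 2 :=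
  (l.map fun a => (l'.map (f a)).sum).sum

/-- `∑ f a b` over all pairs of entries of `l` with `a` preceding `b`. -/
def pairSum (f : A → A → ZMod 2) : List A → ZMod 2
  | [] => 0
  | a :: l => (l.map (f a)).sum + pairSum f l

theorem sum_map_add' (f g : A → ZMod 2) (l : List A) :
    (l.map fun a => f a + g a).sum = (l.map f).sum + (l.map g).sum := by
  induction l with
  | nil => simp
  | cons a l ih => simp only [List.map_cons, List.sum_cons, ih]; ring

@[simp] theorem crossSum_nil_left (f : A → A → ZMod 2) (l : List A) : crossSum f [] l = 0 := rfl

@[simp] theorem crossSum_nil_right (f : A → A → ZMod 2) (l : List A) : crossSum f l [] = 0 := by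
  simp [crossSum]

theorem crossSum_append_left (f : A → A → ZMod 2) (l₁ l₂ l : List A) :
    crossSum f (l₁ ++ l₂) l = crossSum f l₁ l + crossSum f l₂ l := by
  simp [crossSum]

theorem crossSum_append_right (f : A → A → ZMod 2) (l l₁ l₂ : List A) :
    crossSum f l (l₁ ++ l₂) = crossSum f l l₁ + crossSum f l l₂ := by
  simp [crossSum]

theorem crossSum_singleton_left (f : A → A → ZMod 2) (a : A) (l : List A) :
    crossSum f [a] l = (l.map (f a)).sum := by
  simp [crossSum]

theorem crossSum_singleton_right (f : A → A → ZMod 2) (a : A) (l : List A) :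
    crossSum f l [a] = (l.map fun b => f b a).sum := by
  simp [crossSum]

@[simp] theorem pairSum_nil (f : A → A → ZMod 2) : pairSum f [] = 0 := rfl

@[simp] theorem pairSum_singleton (f : A → A → ZMod 2) (a : A) : pairSum f [a] = 0 := by
  simp [pairSum]

theorem pairSum_append (f : A → A → ZMod 2) (l₁ l₂ : List A) :
    pairSum f (l₁ ++ l₂) = pairSum f l₁ + pairSum f l₂ + crossSum f l₁ l₂ := by
  induction l₁ with
  | nil => simp
  | cons a l ih =>
    rw [List.cons_append, pairSum, pairSum, ih]
    simp only [List.map_append, List.sum_append, crossSum, List.map_cons, List.sum_cons]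
    ring

theorem pairSum_add (f g : A → A → ZMod 2) (l : List A) :
    pairSum (fun a b => f a b + g a b) l = pairSum f l + pairSum g l := by
  induction l with
  | nil => simp
  | cons a l ih => rw [pairSum, pairSum, pairSum, ih, sum_map_add']; ring

theorem pairSum_congr {f g : A → A → ZMod 2} {l : List A}
    (h : ∀ a ∈ l, ∀ b ∈ l, f a b = g a b) : pairSum f l = pairSum g l := by
  induction l with
  | nil => rfl
  | cons a l ih =>
    rw [pairSum, pairSum, ih fun a ha b hb => h a (by simp [ha]) b (by simp [hb])]
    congr 2
    exact List.map_congr_left fun b hb => h a (by simp) b (by simp [hb])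

theorem sum_map_range (f : ℕ → ZMod 2) (n : ℕ) :
    ((List.range n).map f).sum = ∑ i ∈ Finset.range n, f i := by
  induction n with
  | zero => simp
  | succ n ih => rw [List.range_succ, Finset.sum_range_succ, ← ih]; simp

theorem sum_map_flatMap_range (f : A → ZMod 2) (g : ℕ → List A) (n : ℕ) :
    (((List.range n).flatMap g).map f).sum = ∑ k ∈ Finset.range n, ((g k).map f).sum := by
  induction n with
  | zero => simp
  | succ n ih => rw [List.range_succ, Finset.sum_range_succ, ← ih]; simp

theorem crossSum_flatMap_range_left (f : A → A → ZMod 2) (g : ℕ → List A) (l : List A) (n : ℕ) :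
    crossSum f ((List.range n).flatMap g) l = ∑ k ∈ Finset.range n, crossSum f (g k) l :=
  sum_map_flatMap_range _ g n

theorem pairSum_flatMap_range (f : A → A → ZMod 2) (g : ℕ → List A) (n : ℕ) :
    pairSum f ((List.range n).flatMap g) = ∑ k ∈ Finset.range n, pairSum f (g k) +
      ∑ l ∈ Finset.range n, ∑ k ∈ Finset.range l, crossSum f (g k) (g l) := by
  induction n with
  | zero => simp
  | succ n ih =>
    rw [List.range_succ, List.flatMap_append, pairSum_append, ih, Finset.sum_range_succ,
      Finset.sum_range_succ, crossSum_flatMap_range_left]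
    simp
    ring

theorem crossSum_map_range (f : A → A → ZMod 2) (y z : ℕ → A) (m n : ℕ) :
    crossSum f ((List.range m).map y) ((List.range n).map z) =
      ∑ i ∈ Finset.range m, ∑ j ∈ Finset.range n, f (y i) (z j) := by
  unfold crossSum
  rw [List.map_map, sum_map_range]
  refine Finset.sum_congr rfl fun i _ => ?_
  simp only [Function.comp_apply, List.map_map]
  rw [sum_map_range]; rfl

theorem pairSum_map_range (f : A → A → ZMod 2) (y : ℕ → A) (n : ℕ) :
    pairSum f ((List.range n).map y) =
      ∑ j ∈ Finset.range n, ∑ i ∈ Finset.range j, f (y i) (y j) := by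
  induction n with
  | zero => simp
  | succ n ih =>
    rw [List.range_succ, List.map_append, pairSum_append, ih, Finset.sum_range_succ]
    simp only [List.map_cons, List.map_nil, pairSum_singleton, crossSum_singleton_right,
      List.map_map, add_zero]
    rw [sum_map_range]
    rfl

/-- Pair sums over a concatenation of two-element blocks. -/
theorem pairSum_flatMap_pair (f : A → A → ZMod 2) (p q : A → A) (l : List A) :
    pairSum f (l.flatMap fun a => [p a, q a]) = (l.map fun a => f (p a) (q a)).sum +
      pairSum (fun a b => f (p a) (p b) + f (p a) (q b) + f (q a) (p b) + f (q a) (q b)) l := by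
  induction l with
  | nil => simp
  | cons a l ih =>
    rw [List.flatMap_cons, pairSum_append, ih, pairSum]
    have h : crossSum f [p a, q a] (l.flatMap fun a => [p a, q a]) =
        (l.map fun b => f (p a) (p b) + f (p a) (q b) + f (q a) (p b) + f (q a) (q b)).sum := by
      clear ih
      induction l with
      | nil => simp
      | cons b l ih =>
        rw [List.flatMap_cons, crossSum_append_right, ih]
        simp [crossSum]
        ring
    rw [h]
    simp [pairSum]
    ring

theorem sum_map_flatMap_pair (φ : A → ZMod 2) (p q : A → A) (l : List A) :
    ((l.flatMap fun a => [p a, q a]).map φ).sum = (l.map fun a => φ (p a) + φ (q a)).sum := by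
  induction l with
  | nil => simp
  | cons a l ih => rw [List.flatMap_cons, List.map_append, List.sum_append, ih]; simp

end Lists

/-! ### Quadratic functions over `ℤ/2` -/

section Quadratic

variable {ι : Type*} [Fintype ι]

/-- The bilinear form with matrix `M`. -/
def bilin (M : ι → ι → ZMod 2) (c d : ι → ZMod 2) : ZMod 2 := ∑ i, ∑ j, c i * d j * M i j

/-- The standard pairing. -/
def dot (c d : ι → ZMod 2) : ZMod 2 := ∑ i, c i * d i

theorem dot_add_right (c d d' : ι → ZMod 2) : dot c (d + d') = dot c d + dot c d' := by
  simp [dot, mul_add, Finset.sum_add_distrib]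

theorem dot_add_left (c c' d : ι → ZMod 2) : dot (c + c') d = dot c d + dot c' d := by
  simp [dot, add_mul, Finset.sum_add_distrib]

theorem dot_comm (c d : ι → ZMod 2) : dot c d = dot d c := by
  simp [dot, mul_comm]

theorem dot_smul_right (a : ZMod 2) (c d : ι → ZMod 2) : dot c (a • d) = a * dot c d := by
  simp only [dot, Finset.mul_sum, Pi.smul_apply, smul_eq_mul]
  exact Finset.sum_congr rfl fun i _ => by ring

theorem dot_sum_left {κ : Type*} (s : Finset κ) (a : κ → ZMod 2) (v : κ → ι → ZMod 2)
    (d : ι → ZMod 2) : dot (fun i => ∑ k ∈ s, a k * v k i) d = ∑ k ∈ s, a k * dot (v k) d := by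
  simp only [dot, Finset.sum_mul, Finset.mul_sum]
  rw [Finset.sum_comm]
  exact Finset.sum_congr rfl fun i _ => Finset.sum_congr rfl fun j _ => by ring

theorem bilin_add_left (M : ι → ι → ZMod 2) (c c' d : ι → ZMod 2) :
    bilin M (c + c') d = bilin M c d + bilin M c' d := by
  simp [bilin, add_mul, Finset.sum_add_distrib]

theorem bilin_add_right (M : ι → ι → ZMod 2) (c d d' : ι → ZMod 2) :
    bilin M c (d + d') = bilin M c d + bilin M c d' := by
  simp [bilin, mul_add, add_mul, Finset.sum_add_distrib]

theorem bilin_symm {M : ι → ι → ZMod 2} (hM : ∀ i j, M i j = M j i) (c d : ι → ZMod 2) :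
    bilin M c d = bilin M d c := by
  unfold bilin
  rw [Finset.sum_comm]
  refine Finset.sum_congr rfl fun i _ => Finset.sum_congr rfl fun j _ => ?_
  rw [hM, mul_comm (c j)]

theorem bilin_eq_dot (M : ι → ι → ZMod 2) (c d : ι → ZMod 2) :
    bilin M c d = dot c fun i => ∑ j, d j * M i j := by
  simp only [bilin, dot, Finset.mul_sum, mul_assoc]

/-- A symmetric matrix with zero diagonal is the polarization of quadratic functions with arbitrary
values on the standard basis. -/
theorem exists_quadratic [DecidableEq ι] (M : ι → ι → ZMod 2) (hM : ∀ i j, M i j = M j i)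
    (h0 : ∀ i, M i i = 0) (κ : ι → ZMod 2) :
    ∃ q : (ι → ZMod 2) → ZMod 2, q 0 = 0 ∧ (∀ i, q (Pi.single i 1) = κ i) ∧
      ∀ c d, q (c + d) = q c + q d + bilin M c d := by
  let e := Fintype.equivFin ι
  -- An upper triangular matrix with diagonal `κ` and `U + Uᵀ = M`; the quadratic function is `c ↦
  -- bilin U c c`.
  let U : ι → ι → ZMod 2 := fun i j => if i = j then κ i else if e i < e j then M i j else 0
  have hU : ∀ i j, U i j + U j i = M i j := by
    intro i j
    by_cases h : i = j
    · subst h; simp [h0, zmod2_add_self]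
    · have h' : j ≠ i := Ne.symm h
      have hne : e i ≠ e j := fun h'' => h (e.injective h'')
      simp only [U, h, h', if_false]
      rcases lt_or_gt_of_ne hne with h1 | h1
      · simp [h1, h1.not_gt]
      · simp [h1, h1.not_gt, hM]
  refine ⟨fun c => bilin U c c, by simp [bilin], ?_, ?_⟩
  · intro i
    simp only [bilin]
    rw [Finset.sum_eq_single i, Finset.sum_eq_single i]
    · simp [U]
    · intro j _ hj; simp [hj]
    · simp
    · intro j _ hj; simp [hj]
    · simp
  · intro c d
    change bilin U (c + d) (c + d) = bilin U c c + bilin U d d + bilin M c d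
    rw [bilin_add_left, bilin_add_right, bilin_add_right]
    have : bilin U d c + bilin U c d = bilin M c d := by
      unfold bilin
      rw [Finset.sum_comm, ← Finset.sum_add_distrib]
      refine Finset.sum_congr rfl fun i _ => ?_
      rw [← Finset.sum_add_distrib]
      refine Finset.sum_congr rfl fun j _ => ?_
      rw [← hU i j]; ring
    rw [← this]; ring

/-- The sum of standard basis vectors given by a list of indices. -/
def chainOf [DecidableEq ι] {A : Type*} (p : A → ι) (l : List A) : ι → ZMod 2 :=
  (l.map fun a => (Pi.single (p a) 1 : ι → ZMod 2)).sum

variable [DecidableEq ι] {A : Type*} (p : A → ι)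

theorem dot_chainOf (c : ι → ZMod 2) (l : List A) :
    dot c (chainOf p l) = (l.map fun a => c (p a)).sum := by
  induction l with
  | nil => simp [dot, chainOf]
  | cons a l ih =>
    have : chainOf p (a :: l) = Pi.single (p a) 1 + chainOf p l := by simp [chainOf]
    rw [this, dot_add_right, ih]
    simp [dot, Pi.single_apply]

theorem sum_chainOf_mul (c : ι → ZMod 2) (l : List A) :
    ∑ i, chainOf p l i * c i = (l.map fun a => c (p a)).sum := by
  rw [← dot_chainOf, dot_comm]; rfl

theorem chainOf_apply (l : List A) (i : ι) :
    chainOf p l i = (l.map fun a => iv (p a = i)).sum := by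
  have := sum_chainOf_mul p (fun j => iv (j = i)) l
  rw [← this, Finset.sum_eq_single i]
  · simp [iv]
  · intro j _ hj; simp [iv, hj]
  · simp

/-- Adding the entries one by one polarizes every pair. The list may repeat an index: the pair then
contributes a diagonal entry of `M`. -/
theorem quadratic_chainOf {M : ι → ι → ZMod 2} {q : (ι → ZMod 2) → ZMod 2} (h0 : q 0 = 0)
    (hq : ∀ c d, q (c + d) = q c + q d + bilin M c d) (l : List A) :
    q (chainOf p l) = (l.map fun a => q (Pi.single (p a) 1)).sum +
      pairSum (fun a b => M (p a) (p b)) l := by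
  induction l with
  | nil => simpa [chainOf] using h0
  | cons a l ih =>
    have : chainOf p (a :: l) = Pi.single (p a) 1 + chainOf p l := by simp [chainOf]
    rw [this, hq, ih, pairSum, bilin_eq_dot, dot_comm]
    have h1 : dot (fun i => ∑ j, chainOf p l j * M i j) (Pi.single (p a) 1) =
        ∑ j, chainOf p l j * M (p a) j := by
      simp [dot, Pi.single_apply]
    rw [h1, sum_chainOf_mul]
    simp
    ring

end Quadratic

namespace CellSurface

variable {F : Type*} [Fintype F] {X : CellSurface F}

theorem edge_out (e : X.Edge) : X.edge (Quotient.out e) = e := Quotient.out_eq e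

theorem exists_flag (e : X.Edge) : ∃ x, X.edge x = e := ⟨Quotient.out e, edge_out e⟩

theorem sameHalf_or_iff (x y : F) :
    (X.SameHalf x y ∨ X.SameHalf x (X.τ₀ y)) ↔ X.edge y = X.edge x := by
  rw [eq_comm, edge_eq_iff]
  unfold SameHalf
  have h1 : X.τ₀ y = x ↔ y = X.τ₀ x := by
    constructor
    · rintro rfl; rw [X.τ₀_invol]
    · rintro rfl; rw [X.τ₀_invol]
  have h2 : X.τ₀ y = X.τ₂ x ↔ y = X.τ₀ (X.τ₂ x) := by
    constructor
    · intro h; rw [← h, X.τ₀_invol]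
    · rintro rfl; rw [X.τ₀_invol]
  rw [h1, h2]; tauto

theorem iv_sameHalf_add (x y : F) :
    iv (X.SameHalf x y) + iv (X.SameHalf x (X.τ₀ y)) = iv (X.edge y = X.edge x) := by
  rw [← iv_or, iv_congr (sameHalf_or_iff x y)]
  rintro ⟨h1, h2⟩
  apply not_sameHalf_τ₀ (X := X) y
  rcases h1 with rfl | rfl
  · exact h2
  · rw [sameHalf_τ₂_left]; exact h2

/-! ### Corner systems -/

/-- The number mod 2 of occurrences in `Y` of the corner `{x, τ₁ x}`. -/
noncomputable def cornerCount (X : CellSurface F) (Y : List F) (x : F) : ZMod 2 :=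
  (Y.map fun y => iv (y = x ∨ y = X.τ₁ x)).sum

/-- A closed walk `E` in the graph together with the list `Y` of the corners that lie between the
walk and a dual closed curve with chain `c`. -/
structure IsCornerSystem (X : CellSurface F) (Y E : List F) (c : X.Edge → ZMod 2) : Prop where
  ends : ∀ φ : F → ZMod 2, (∀ x, φ (X.τ₂ x) = φ x) →
    (E.map fun x => φ x + φ (X.τ₀ x)).sum = (Y.map fun y => φ y + φ (X.τ₁ y)).sum
  side : ∀ x, X.cornerCount Y x + X.cornerCount Y (X.τ₀ x) = c (X.edge x)

namespace IsCornerSystem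

variable {Y E : List F} {c : X.Edge → ZMod 2}

theorem closed (S : X.IsCornerSystem Y E c) (h : X.Vertex → ZMod 2) :
    (E.map fun x => h (X.vert x) + h (X.head x)).sum = 0 := by
  have := S.ends (fun x => h (X.vert x)) fun x => by rw [vert_τ₂]
  rw [show (E.map fun x => h (X.vert x) + h (X.head x)).sum =
    (E.map fun x => h (X.vert x) + h (X.vert (X.τ₀ x))).sum from rfl, this]
  simp [vert_τ₁, zmod2_add_self]

/-- Test `ends` on the indicator of the half-edge of `x`. The walk uses this half-edge as often as
it uses the edge, and the corners that contain it are those of the flags `x` and `τ₂ x`. -/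
theorem cornerCount_add (S : X.IsCornerSystem Y E c) (x : F) :
    X.cornerCount Y x + X.cornerCount Y (X.τ₂ x) =
      (E.map fun y => iv (X.edge y = X.edge x)).sum := by
  have := S.ends (fun y => iv (X.SameHalf x y)) fun y => by rw [iv_congr sameHalf_τ₂_right]
  simp only [iv_sameHalf_add] at this
  rw [this, cornerCount, cornerCount, ← sum_map_add']
  congr 1
  refine List.map_congr_left fun y _ => ?_
  have h1 : X.τ₁ y = x ↔ y = X.τ₁ x := by
    constructor
    · rintro rfl; rw [X.τ₁_invol]
    · rintro rfl; rw [X.τ₁_invol]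
  have h2 : X.τ₁ y = X.τ₂ x ↔ y = X.τ₁ (X.τ₂ x) := by
    constructor
    · intro h; rw [← h, X.τ₁_invol]
    · rintro rfl; rw [X.τ₁_invol]
  have e1 : x ≠ X.τ₂ x := (X.τ₂_ne x).symm
  have e2 : X.τ₁ x ≠ X.τ₁ (X.τ₂ x) := fun h => e1 (X.τ₁.injective h)
  unfold SameHalf
  rw [h1, h2, iv_or, iv_or, iv_or, iv_or]
  · ring
  · rintro ⟨h, h'⟩; exact e2 (h.symm.trans h')
  · rintro ⟨h, h'⟩; exact e1 (h.symm.trans h')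
  · rintro ⟨h, h'⟩; exact X.τ₁_ne _ (h'.symm.trans h)
  · rintro ⟨h, h'⟩; exact X.τ₁_ne _ (h'.symm.trans h)

end IsCornerSystem

/-! ### Crossing numbers of edges and the intersection form on chains. -/

namespace HalfEdgeOrder

variable {ω : X.Edge → ZMod 2} {o : X.LocalOrientation ω} {n : ℕ} {num : X.Vertex ≃ Fin n}
  (H : HalfEdgeOrder X o num)

/-- The crossing number mod 2 of two edges drawn as arcs over the line of all half-edges. -/
def link (x y : F) : ZMod 2 :=
  H.lt x y + H.lt x (X.τ₀ y) + H.lt (X.τ₀ x) y + H.lt (X.τ₀ x) (X.τ₀ y)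

theorem link_τ₀_left (x y : F) : H.link (X.τ₀ x) y = H.link x y := by
  simp only [link, X.τ₀_invol]; ring

theorem link_τ₂_left (x y : F) : H.link (X.τ₂ x) y = H.link x y := by
  simp only [link, X.comm, H.lt_τ₂_left]

theorem link_congr_left {x x' : F} (h : X.edge x = X.edge x') (y : F) :
    H.link x' y = H.link x y := by
  rcases edge_eq_iff.1 h with rfl | rfl | rfl | rfl <;> simp [link_τ₀_left, link_τ₂_left]

theorem link_symm (x y : F) : H.link x y = H.link y x := by
  rw [← zmod2_add_eq_zero]
  have h : H.link x y + H.link y x = (H.lt x y + H.lt y x) + (H.lt x (X.τ₀ y) + H.lt (X.τ₀ y) x) +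
      (H.lt (X.τ₀ x) y + H.lt y (X.τ₀ x)) + (H.lt (X.τ₀ x) (X.τ₀ y) + H.lt (X.τ₀ y) (X.τ₀ x)) := by
    unfold link; ring
  rw [h]
  simp only [H.lt_add]
  have h1 := iv_sameHalf_add (X := X) x y
  have h2 := iv_sameHalf_add (X := X) (X.τ₀ x) y
  rw [edge_τ₀] at h2
  have h3 : (1 + iv (X.SameHalf x y) + (1 + iv (X.SameHalf x (X.τ₀ y))) +
      (1 + iv (X.SameHalf (X.τ₀ x) y)) + (1 + iv (X.SameHalf (X.τ₀ x) (X.τ₀ y)))) =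
      (1 + 1 + 1 + 1) + ((iv (X.SameHalf x y) + iv (X.SameHalf x (X.τ₀ y))) +
        (iv (X.SameHalf (X.τ₀ x) y) + iv (X.SameHalf (X.τ₀ x) (X.τ₀ y)))) := by ring
  rw [h3, h1, h2, zmod2_add_self (iv _)]
  rfl

theorem lt_add_τ₀ (x : F) : H.lt x (X.τ₀ x) + H.lt (X.τ₀ x) x = 1 := by
  rw [H.lt_add, iv_false (not_sameHalf_τ₀ x), add_zero]

theorem link_self (x : F) : H.link x x = 1 := by
  rw [link, H.lt_self, H.lt_self, zero_add, add_zero, lt_add_τ₀]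

theorem link_congr_right {y y' : F} (h : X.edge y = X.edge y') (x : F) :
    H.link x y' = H.link x y := by
  rw [link_symm, H.link_congr_left h, link_symm]

/-- The intersection form of the graph, on the level of chains. -/
noncomputable def interMatrix (e f : X.Edge) : ZMod 2 :=
  H.link (Quotient.out e) (Quotient.out f) + iv (e = f) * (1 + ω e)

theorem interMatrix_edge (x y : F) : H.interMatrix (X.edge x) (X.edge y) =
    H.link x y + iv (X.edge x = X.edge y) * (1 + ω (X.edge x)) := by
  rw [interMatrix, H.link_congr_left (edge_out (X.edge x)).symm,
    H.link_congr_right (edge_out (X.edge y)).symm]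

theorem interMatrix_symm (e f : X.Edge) : H.interMatrix e f = H.interMatrix f e := by
  unfold interMatrix
  rw [link_symm]
  by_cases h : e = f
  · subst h; rfl
  · rw [iv_false h, iv_false (Ne.symm h)]; ring

/-- The crossing matrix of the graph drawn in the plane, with cross-caps. -/
noncomputable def signMatrix (e f : X.Edge) : ZMod 2 := H.interMatrix e f + ω e * ω f

theorem signMatrix_symm (e f : X.Edge) : H.signMatrix e f = H.signMatrix f e := by
  rw [signMatrix, signMatrix, interMatrix_symm, mul_comm]

/-- An edge links itself once, so the diagonal entry is `1 + (1 + ω) + ω²`. Its vanishing is what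
allows a quadratic function with this polarization to take arbitrary values on single edges. -/
theorem signMatrix_self (e : X.Edge) : H.signMatrix e e = 0 := by
  rw [signMatrix, interMatrix, link_self, iv_true rfl, zmod2_mul_self]
  generalize ω e = a
  revert a; decide

/-- The sign of an edge: its orientation compared with the order of its half-edges. -/
noncomputable def edgeSign (K : X.EdgeOrientation) (e : X.Edge) : ZMod 2 :=
  K.dir (Quotient.out e) + H.lt (X.τ₀ (Quotient.out e)) (Quotient.out e)

theorem edgeSign_edge (K : X.EdgeOrientation) (x : F) :
    H.edgeSign K (X.edge x) = K.dir x + H.lt (X.τ₀ x) x := by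
  have key : ∀ x y : F, X.edge x = X.edge y →
      K.dir x + H.lt (X.τ₀ x) x = K.dir y + H.lt (X.τ₀ y) y := by
    intro x y h
    have h0 : ∀ x, K.dir (X.τ₀ x) + H.lt x (X.τ₀ x) = K.dir x + H.lt (X.τ₀ x) x := by
      intro x
      have h1 := H.lt_add_τ₀ x
      rw [K.dir_τ₀, ← zmod2_add_eq_zero]
      have : K.dir x + 1 + H.lt x (X.τ₀ x) + (K.dir x + H.lt (X.τ₀ x) x) =
        (K.dir x + K.dir x) + (1 + (H.lt x (X.τ₀ x) + H.lt (X.τ₀ x) x)) := by ring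
      rw [this, h1, zmod2_add_self]; rfl
    rcases edge_eq_iff.1 h with rfl | rfl | rfl | rfl
    · rfl
    · rw [K.dir_τ₂, X.comm, H.lt_τ₂_left, H.lt_τ₂_right]
    · rw [X.τ₀_invol, h0]
    · rw [X.τ₀_invol, h0, K.dir_τ₂, X.comm, H.lt_τ₂_left, H.lt_τ₂_right]
  exact key _ _ (edge_out (X.edge x))

/-- The flag of sign `0` of a corner. -/
noncomputable def cornerFlag (o : X.LocalOrientation ω) (y : F) : F :=
  if o.sign y = 0 then y else X.τ₁ y

/-- A form of `lt_corner` for corners given by either of their two flags. Among flags of sign 1,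
lying in the half-edge of `a` means being equal to `a`, so the contact term becomes the indicator of
the corner of `a`. -/
theorem lt_corner_of_sign_one {a : F} (ha : o.sign a = 1) (y : F) :
    H.lt a y + H.lt a (X.τ₁ y) = iv (y = a ∨ y = X.τ₁ a) +
      H.base (cornerFlag o y) * iv (X.vert y = X.vert a) := by
  have h2 : ∀ z, o.sign z = 1 → (X.SameHalf a z ↔ z = a) := by
    intro z hz
    refine ⟨?_, fun h => Or.inl h⟩
    rintro (h | h)
    · exact h
    · exfalso; rw [h, o.sign_τ₂, ha] at hz; exact absurd hz (by decide)
  rcases zmod2_cases (o.sign y) with hy | hy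
  · have hc : cornerFlag o y = y := if_pos hy
    rw [add_comm, H.lt_corner a y hy, hc, iv_congr (h2 _ (by rw [o.sign_τ₁, hy]; rfl)),
      iv_congr (eq_comm (a := X.vert a))]
    congr 1
    apply iv_congr
    constructor
    · rintro rfl; right; rw [X.τ₁_invol]
    · rintro (rfl | rfl)
      · rw [hy] at ha; exact absurd ha (by decide)
      · rw [X.τ₁_invol]
  · have hc : cornerFlag o y = X.τ₁ y := if_neg (by rw [hy]; decide)
    have := H.lt_corner a (X.τ₁ y) (by rw [o.sign_τ₁, hy]; rfl)
    rw [X.τ₁_invol, vert_τ₁] at this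
    rw [this, hc, iv_congr (h2 _ hy), iv_congr (eq_comm (a := X.vert a))]
    congr 1
    apply iv_congr
    refine ⟨Or.inl, ?_⟩
    rintro (h | rfl)
    · exact h
    · rw [o.sign_τ₁, ha] at hy; exact absurd hy (by decide)

/-- The number mod 2 of occurrences in `Y` of the base corner of `v`. -/
noncomputable def baseCount (Y : List F) (v : X.Vertex) : ZMod 2 :=
  (Y.map fun y => H.base (cornerFlag o y) * iv (X.vert y = v)).sum

theorem sum_baseCount (Y : List F) :
    ∑ v, H.baseCount Y v = (Y.map fun y => H.base (cornerFlag o y)).sum := by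
  unfold baseCount
  induction Y with
  | nil => simp
  | cons y Y ih =>
    simp only [List.map_cons, List.sum_cons, Finset.sum_add_distrib, ih]
    congr 1
    simp [iv]

theorem sum_lt_corner {a : F} (ha : o.sign a = 1) (Y : List F) :
    (Y.map fun y => H.lt a y + H.lt a (X.τ₁ y)).sum =
      X.cornerCount Y a + H.baseCount Y (X.vert a) := by
  rw [cornerCount, baseCount, ← sum_map_add']
  congr 1
  exact List.map_congr_left fun y _ => H.lt_corner_of_sign_one ha y

/-- The intersection numbers of edges with the walk of a corner system are, up to a coboundary, those
with the dual curve. -/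
theorem sum_interMatrix {Y E : List F} {c : X.Edge → ZMod 2} (S : X.IsCornerSystem Y E c) (x : F) :
    (E.map fun y => H.interMatrix (X.edge x) (X.edge y)).sum =
      c (X.edge x) + (H.baseCount Y (X.vert x) + H.baseCount Y (X.head x)) := by
  have key : ∀ x, o.sign x = 1 → (E.map fun y => H.interMatrix (X.edge x) (X.edge y)).sum =
      c (X.edge x) + (H.baseCount Y (X.vert x) + H.baseCount Y (X.head x)) := by
    intro x hx
    have hl : ∀ a, (E.map fun y => H.lt a y + H.lt a (X.τ₀ y)).sum =
        (Y.map fun y => H.lt a y + H.lt a (X.τ₁ y)).sum :=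
      fun a => S.ends (H.lt a) (H.lt_τ₂_right a)
    have h1 : (E.map fun y => H.interMatrix (X.edge x) (X.edge y)).sum =
        (E.map fun y => H.lt x y + H.lt x (X.τ₀ y)).sum +
        (E.map fun y => H.lt (X.τ₀ x) y + H.lt (X.τ₀ x) (X.τ₀ y)).sum +
        (E.map fun y => iv (X.edge y = X.edge x)).sum * (1 + ω (X.edge x)) := by
      rw [← List.sum_map_mul_right, ← sum_map_add', ← sum_map_add']
      congr 1
      refine List.map_congr_left fun y _ => ?_
      rw [interMatrix_edge, iv_congr (eq_comm (a := X.edge x)), link]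
      ring
    rw [h1, hl, hl, H.sum_lt_corner hx, ← S.cornerCount_add x]
    have hs := o.sign_τ₀ x
    rw [hx] at hs
    -- The two corners counted at the ends of the edge lie on opposite sides of it if `ω = 0` and on
    -- the same side if `ω = 1`. In the first case the diagonal term `1 + ω` moves one of them
    -- across the edge; then `side` applies in both cases.
    rcases zmod2_cases (ω (X.edge x)) with hω | hω
    · have h2 : (Y.map fun y => H.lt (X.τ₀ x) y + H.lt (X.τ₀ x) (X.τ₁ y)).sum =
          X.cornerCount Y (X.τ₂ (X.τ₀ x)) + H.baseCount Y (X.head x) := by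
        have := H.sum_lt_corner (a := X.τ₂ (X.τ₀ x)) (by rw [o.sign_τ₂, hs, hω]; rfl) Y
        simp only [H.lt_τ₂_left, vert_τ₂] at this
        exact this
      have h3 := S.side (X.τ₂ x)
      rw [X.comm, edge_τ₂] at h3
      rw [h2, ← h3, hω]
      linear_combination zmod2_add_self (X.cornerCount Y x)
    · have h2 := H.sum_lt_corner (a := X.τ₀ x) (by rw [hs, hω]; rfl) Y
      have h3 := S.side x
      rw [h2, ← h3, hω, show (1 + 1 : ZMod 2) = 0 from rfl, head]
      ring
  rcases zmod2_cases (o.sign x) with hx | hx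
  · have := key (X.τ₂ x) (by rw [o.sign_τ₂, hx]; rfl)
    rwa [edge_τ₂, vert_τ₂, head_τ₂] at this
  · exact key x hx

/-- The two half-edges of every directed edge of a walk. -/
def halves (X : CellSurface F) (E : List F) : List F := E.flatMap fun x => [x, X.τ₀ x]

/-- The incoming and the outgoing half-edge at every corner. -/
def passes (X : CellSurface F) (Y : List F) : List F := Y.flatMap fun y => [X.τ₁ y, y]

theorem sum_halves (φ : F → ZMod 2) (E : List F) :
    ((halves X E).map φ).sum = (E.map fun x => φ x + φ (X.τ₀ x)).sum :=
  sum_map_flatMap_pair φ (fun x => x) _ E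

theorem sum_passes (φ : F → ZMod 2) (Y : List F) :
    ((passes X Y).map φ).sum = (Y.map fun y => φ y + φ (X.τ₁ y)).sum := by
  rw [passes, sum_map_flatMap_pair]
  simp only [add_comm]

/-- The value of the quadratic function of an edge orientation on a walk. -/
theorem quadratic_walk (K : X.EdgeOrientation) {q : (X.Edge → ZMod 2) → ZMod 2} (h0 : q 0 = 0)
    (h1 : ∀ e, q (Pi.single e 1) = H.edgeSign K e)
    (hq : ∀ c d, q (c + d) = q c + q d + bilin H.signMatrix c d) (E : List F) :
    q (chainOf X.edge E) = K.disagree E + E.length + pairSum H.lt (halves X E) +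
      pairSum (fun x y => iv (X.edge x = X.edge y) * (1 + ω (X.edge x))) E +
      pairSum (fun x y => ω (X.edge x) * ω (X.edge y)) E := by
  rw [quadratic_chainOf X.edge h0 hq, halves, pairSum_flatMap_pair]
  have e1 : pairSum (fun a b => H.signMatrix (X.edge a) (X.edge b)) E =
      pairSum (fun a b => H.lt a b + H.lt a (X.τ₀ b) + H.lt (X.τ₀ a) b + H.lt (X.τ₀ a) (X.τ₀ b)) E +
      pairSum (fun x y => iv (X.edge x = X.edge y) * (1 + ω (X.edge x))) E +
      pairSum (fun x y => ω (X.edge x) * ω (X.edge y)) E := by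
    rw [← pairSum_add, ← pairSum_add]
    refine pairSum_congr fun a _ b _ => ?_
    rw [signMatrix, interMatrix_edge, link]
  -- `edgeSign` compares the head half-edge with the tail, while the list `halves` has the tail
  -- first. These comparisons differ by 1 for each edge, which produces the length.
  have e2 : (E.map fun a => q (Pi.single (X.edge a) 1)).sum =
      K.disagree E + E.length + (E.map fun a => H.lt a (X.τ₀ a)).sum := by
    clear e1
    induction E with
    | nil => simp [EdgeOrientation.disagree]
    | cons x E ih =>
      rw [List.map_cons, List.sum_cons, ih, h1, edgeSign_edge]
      simp only [EdgeOrientation.disagree, List.map_cons, List.sum_cons, List.length_cons]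
      push_cast
      have := H.lt_add_τ₀ x
      linear_combination zmod2_add_self (H.lt (X.τ₀ x) x) - this - zmod2_add_self 1
  rw [e1, e2]
  ring

end HalfEdgeOrder

end CellSurface

/-! ### Half-edges along the boundary of a face, bracketed by sides or by corners. -/

theorem zmod2_two : (2 : ZMod 2) = 0 := rfl

/-- Sums over pairs `i < j`, with both indices shifted. -/
theorem sum_pairs_succ (f : ℕ → ℕ → ZMod 2) (r : ℕ) :
    ∑ j ∈ Finset.range (r + 1), ∑ i ∈ Finset.range j, f i j =
      ∑ j ∈ Finset.range r, ((∑ i ∈ Finset.range j, f (i + 1) (j + 1)) + f 0 (j + 1)) := by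
  rw [Finset.sum_range_succ']
  simp only [Finset.range_zero, Finset.sum_empty, add_zero]
  exact Finset.sum_congr rfl fun j _ => Finset.sum_range_succ' _ _

/-- For a cyclic sequence of labels: the number of pairs of sign changes. -/
theorem sum_sign_changes (s : ℕ → ZMod 2) (m : ℕ) (hm : s m = s 0) :
    ∑ j ∈ Finset.range m, ∑ i ∈ Finset.range j, (s i + s (i + 1)) * (s j + s (j + 1)) =
      ∑ i ∈ Finset.range m, s i + ∑ i ∈ Finset.range m, s i * s (i + 1) := by
  have h1 : ∀ j, ∑ i ∈ Finset.range j, (s i + s (i + 1)) = s 0 + s j := by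
    intro j
    induction j with
    | zero => simp [zmod2_add_self]
    | succ j ih => rw [Finset.sum_range_succ, ih]; linear_combination zmod2_add_self (s j)
  have h2 : ∀ j, ∑ i ∈ Finset.range j, (s i + s (i + 1)) * (s j + s (j + 1)) =
      s 0 * (s j + s (j + 1)) + (s j + s j * s (j + 1)) := by
    intro j
    rw [← Finset.sum_mul, h1]
    linear_combination zmod2_mul_self (s j)
  simp only [h2]
  rw [Finset.sum_add_distrib, ← Finset.mul_sum, h1, hm, zmod2_add_self, Finset.sum_add_distrib]
  ring

namespace CellSurface

variable {F : Type*} [Fintype F] {X : CellSurface F}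

theorem next_apply (x : F) : X.next x = X.τ₁ (X.τ₀ x) := rfl

theorem next_pow_succ (x : F) (i : ℕ) : (X.next ^ (i + 1)) x = X.τ₁ (X.τ₀ ((X.next ^ i) x)) := by
  rw [pow_succ', Equiv.Perm.mul_apply, next_apply]

theorem τ₀_next_pow (x : F) (i : ℕ) : X.τ₀ ((X.next ^ i) x) = X.τ₁ ((X.next ^ (i + 1)) x) := by
  rw [next_pow_succ, X.τ₁_invol]

/-- The boundary of a face does not contain both directions of a side. -/
theorem next_pow_ne_τ₁ (i : ℕ) : ∀ x : F, (X.next ^ i) x ≠ X.τ₁ x := by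
  induction i using Nat.strong_induction_on with
  | _ i ih =>
    intro x hx
    match i with
    | 0 => exact X.τ₁_ne x (by simpa using hx.symm)
    | 1 =>
      rw [pow_one, next_apply] at hx
      exact X.τ₀_ne x (X.τ₁.injective hx)
    -- Removing the outermost step on both sides lowers the exponent by two and replaces `x` by
    -- `next x`. The descent ends at a fixed point of `τ₁` or `τ₀`.
    | i + 2 =>
      apply ih i (by omega) (X.next x)
      rw [pow_succ', Equiv.Perm.mul_apply, next_apply] at hx
      have h2 : (X.next ^ (i + 1)) x = X.τ₀ x := by
        have := X.τ₁.injective hx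
        rw [← X.τ₀_invol ((X.next ^ (i + 1)) x), this]
      rw [pow_succ, Equiv.Perm.mul_apply] at h2
      rw [h2, next_apply, X.τ₁_invol]

theorem sides_pos (x : F) : 0 < X.sides x := by
  refine Function.minimalPeriod_pos_of_mem_periodicPts ?_
  refine Function.mem_periodicPts.2 ⟨orderOf X.next, orderOf_pos _, ?_⟩
  rw [Function.IsPeriodicPt, Function.IsFixedPt, Equiv.Perm.iterate_eq_pow, pow_orderOf_eq_one]
  rfl

theorem next_pow_sides (x : F) : (X.next ^ X.sides x) x = x := by
  have := Function.isPeriodicPt_minimalPeriod X.next x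
  rw [Function.IsPeriodicPt, Function.IsFixedPt, Equiv.Perm.iterate_eq_pow] at this
  exact this

theorem next_pow_inj {x : F} {i j : ℕ} (hi : i < X.sides x) (hj : j < X.sides x)
    (h : (X.next ^ i) x = (X.next ^ j) x) : i = j := by
  rw [← Equiv.Perm.iterate_eq_pow, ← Equiv.Perm.iterate_eq_pow] at h
  exact Function.iterate_injOn_Iio_minimalPeriod hi hj h

theorem sameHalf_τ₀_τ₀ {x y : F} : X.SameHalf (X.τ₀ x) (X.τ₀ y) ↔ X.SameHalf x y := by
  unfold SameHalf
  rw [← X.comm, X.τ₀.injective.eq_iff, X.τ₀.injective.eq_iff]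

theorem sameHalf_τ₀_left {x y : F} : X.SameHalf (X.τ₀ x) y ↔ X.SameHalf x (X.τ₀ y) := by
  rw [← sameHalf_τ₀_τ₀, X.τ₀_invol]

namespace LocalOrientation

variable {ω : X.Edge → ZMod 2} (o : X.LocalOrientation ω)

theorem sign_next (x : F) : o.sign (X.next x) = o.sign x + ω (X.edge x) := by
  rw [next_apply, o.sign_τ₁, o.sign_τ₀]
  linear_combination zmod2_two

theorem sign_next_pow_succ (x : F) (i : ℕ) : o.sign ((X.next ^ (i + 1)) x) =
    o.sign ((X.next ^ i) x) + ω (X.edge ((X.next ^ i) x)) := by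
  rw [pow_succ', Equiv.Perm.mul_apply, sign_next]

end LocalOrientation

/-- The part of the boundary of a face that consists of `m` consecutive sides. -/
def arcWalk (X : CellSurface F) (x : F) (m : ℕ) : List F :=
  (List.range m).map fun i => (X.next ^ i) x

theorem arcWalk_succ (x : F) (m : ℕ) :
    X.arcWalk x (m + 1) = X.arcWalk x m ++ [(X.next ^ m) x] := by
  simp [arcWalk, List.range_succ]

theorem sum_arcWalk (φ : F → ZMod 2) (x : F) (m : ℕ) :
    ((X.arcWalk x m).map φ).sum = ∑ i ∈ Finset.range m, φ ((X.next ^ i) x) := by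
  rw [arcWalk, List.map_map, sum_map_range]; rfl

theorem arcWalk_length (x : F) (m : ℕ) : (X.arcWalk x m).length = m := by simp [arcWalk]

namespace HalfEdgeOrder

theorem length_halves (E : List F) : (halves X E).length = 2 * E.length := by
  induction E with
  | nil => rfl
  | cons x E ih =>
    have : halves X (x :: E) = [x, X.τ₀ x] ++ halves X E := rfl
    rw [this, List.length_append, ih]; simp; ring

theorem halves_arcWalk_succ (x : F) (m : ℕ) : halves X (X.arcWalk x (m + 1)) =
    halves X (X.arcWalk x m) ++ [(X.next ^ m) x, X.τ₀ ((X.next ^ m) x)] := by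
  simp [arcWalk_succ, halves]

/-- The half-edge at the head of a side is the incoming one at the next corner, so the two
bracketings of an arc give the same list except for one half-edge at each end. -/
theorem passes_arcWalk_succ (x : F) (m : ℕ) : passes X (X.arcWalk x (m + 1)) =
    [X.τ₁ x] ++ (halves X (X.arcWalk x m) ++ [(X.next ^ m) x]) := by
  induction m with
  | zero => simp [arcWalk, passes, halves]
  | succ m ih =>
    rw [arcWalk_succ, passes, List.flatMap_append]
    rw [passes] at ih
    rw [ih, halves_arcWalk_succ, τ₀_next_pow]
    simp

variable {ω : X.Edge → ZMod 2} {o : X.LocalOrientation ω} {n : ℕ} {num : X.Vertex ≃ Fin n}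
  (H : HalfEdgeOrder X o num)

/-- The half-edges of a corner are neighbours in the clockwise order, and the sign tells which one
comes first, unless the base corner separates them. The term with `SameHalf` takes care of vertices
of degree one. -/
theorem lt_pass (y : F) : H.lt (X.τ₁ y) y = H.base (cornerFlag o y) +
    ((1 + o.sign y) + o.sign y * iv (X.SameHalf (X.τ₁ y) y)) := by
  rcases zmod2_cases (o.sign y) with hy | hy
  · have hc : cornerFlag o y = y := if_pos hy
    have := H.lt_corner (X.τ₁ y) y hy
    rw [H.lt_self, zero_add, iv_true (show X.SameHalf _ _ from Or.inl rfl), vert_τ₁, iv_true rfl] at this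
    rw [this, hc, hy]; ring
  · have hc : cornerFlag o y = X.τ₁ y := if_neg (by rw [hy]; decide)
    have := H.lt_corner (X.τ₁ y) (X.τ₁ y) (by rw [o.sign_τ₁, hy]; rfl)
    rw [H.lt_self, add_zero, iv_true (p := X.vert _ = X.vert _) rfl, X.τ₁_invol] at this
    rw [this, hc, hy]; linear_combination -zmod2_two

/-- The crossing number of two passes at corners. -/
theorem lt_pass_pass (y z : F) :
    H.lt (X.τ₁ y) (X.τ₁ z) + H.lt (X.τ₁ y) z + H.lt y (X.τ₁ z) + H.lt y z =
      (1 + o.sign z) * (iv (X.SameHalf (X.τ₁ y) (X.τ₁ z)) + iv (X.SameHalf y (X.τ₁ z))) +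
      o.sign z * (iv (X.SameHalf (X.τ₁ y) z) + iv (X.SameHalf y z)) := by
  rcases zmod2_cases (o.sign z) with hz | hz
  · have h1 := H.lt_corner (X.τ₁ y) z hz
    have h2 := H.lt_corner y z hz
    rw [vert_τ₁] at h1
    rw [hz]
    linear_combination h1 + h2 + H.base z * zmod2_add_self (iv (X.vert y = X.vert z))
  · have hz' : o.sign (X.τ₁ z) = 0 := by rw [o.sign_τ₁, hz]; rfl
    have h1 := H.lt_corner (X.τ₁ y) (X.τ₁ z) hz'
    have h2 := H.lt_corner y (X.τ₁ z) hz'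
    rw [vert_τ₁, vert_τ₁, X.τ₁_invol] at h1
    rw [vert_τ₁, X.τ₁_invol] at h2
    rw [hz]
    linear_combination h1 + h2 + H.base (X.τ₁ z) * zmod2_add_self (iv (X.vert y = X.vert z)) -
      (iv (X.SameHalf (X.τ₁ y) (X.τ₁ z)) + iv (X.SameHalf y (X.τ₁ z))) * zmod2_two

/-- For two distinct passes the base corner enters once for each half-edge of the first pass, hence
twice, and cancels (`lt_pass_pass`). So base corners are counted once per pass, and only contacts,
that is, shared half-edges, remain. -/
theorem pairSum_passes (Y : List F) : pairSum H.lt (passes X Y) =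
    (Y.map fun y => H.base (cornerFlag o y)).sum +
    (Y.map fun y => (1 + o.sign y) + o.sign y * iv (X.SameHalf (X.τ₁ y) y)).sum +
    pairSum (fun y z =>
      (1 + o.sign z) * (iv (X.SameHalf (X.τ₁ y) (X.τ₁ z)) + iv (X.SameHalf y (X.τ₁ z))) +
      o.sign z * (iv (X.SameHalf (X.τ₁ y) z) + iv (X.SameHalf y z))) Y := by
  rw [passes, pairSum_flatMap_pair]
  simp only [lt_pass, lt_pass_pass, sum_map_add']

/-- Moving a half-edge from the front to the back of a list. -/
theorem pairSum_rotate (a : F) (m : List F) : pairSum H.lt (m ++ [a]) =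
    pairSum H.lt ([a] ++ m) + m.length + (m.map fun b => iv (X.SameHalf a b)).sum := by
  rw [pairSum_append, pairSum_append, crossSum_singleton_left, crossSum_singleton_right]
  have : (m.map fun b => H.lt b a).sum = (m.map (H.lt a)).sum + m.length +
      (m.map fun b => iv (X.SameHalf a b)).sum := by
    induction m with
    | nil => simp
    | cons b m ih =>
      simp only [List.map_cons, List.sum_cons, ih, List.length_cons]
      push_cast
      linear_combination H.lt_add a b - zmod2_add_self (H.lt a b)
  rw [this]; simp; ring

end HalfEdgeOrder

/-! ### Boundaries of faces -/

/-- The boundary of the face of `x`. -/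
noncomputable def faceWalk (X : CellSurface F) (x : F) : List F := X.arcWalk x (X.sides x)

theorem sum_faceWalk_next (φ : F → ZMod 2) (x : F) :
    ((X.faceWalk x).map fun y => φ (X.next y)).sum = ((X.faceWalk x).map φ).sum := by
  rw [faceWalk, sum_arcWalk, sum_arcWalk]
  have h := Finset.sum_range_succ (fun i => φ ((X.next ^ i) x)) (X.sides x)
  rw [Finset.sum_range_succ', next_pow_sides] at h
  have h' := add_right_cancel h
  rw [← h']
  refine Finset.sum_congr rfl fun i _ => ?_
  rw [pow_succ', Equiv.Perm.mul_apply]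

/-- The dual curve is a small circle inside the face, which meets no edge. Both conditions are a
shift by `next` along the boundary, since `τ₁ (next x) = τ₀ x`. -/
theorem isCornerSystem_face (x : F) :
    X.IsCornerSystem (X.faceWalk x) (X.faceWalk x) 0 where
  ends φ _ := by
    rw [sum_map_add', sum_map_add']
    congr 1
    rw [← sum_faceWalk_next (fun y => φ (X.τ₁ y))]
    simp only [next_apply, X.τ₁_invol]
  side y := by
    have h1 : ∀ z : F, z = X.τ₀ y ↔ X.next z = X.τ₁ y := by
      intro z
      rw [next_apply, X.τ₁.injective.eq_iff]
      constructor
      · rintro rfl; rw [X.τ₀_invol]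
      · intro h; rw [← h, X.τ₀_invol]
    have h2 : ∀ z : F, z = y ↔ X.next z = X.τ₁ (X.τ₀ y) := by
      intro z
      rw [next_apply, X.τ₁.injective.eq_iff, X.τ₀.injective.eq_iff]
    have h3 : ∀ w z : F, iv (z = w ∨ z = X.τ₁ w) = iv (z = w) + iv (z = X.τ₁ w) := by
      intro w z
      apply iv_or
      rintro ⟨h, h'⟩
      exact X.τ₁_ne w (h'.symm.trans h)
    simp only [cornerCount, h3, sum_map_add']
    have e1 : ((X.faceWalk x).map fun z => iv (z = X.τ₀ y)).sum =
        ((X.faceWalk x).map fun z => iv (z = X.τ₁ y)).sum := by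
      rw [← sum_faceWalk_next (fun z => iv (z = X.τ₁ y))]
      simp only [← h1]
    have e2 : ((X.faceWalk x).map fun z => iv (z = y)).sum =
        ((X.faceWalk x).map fun z => iv (z = X.τ₁ (X.τ₀ y))).sum := by
      rw [← sum_faceWalk_next (fun z => iv (z = X.τ₁ (X.τ₀ y)))]
      simp only [← h2]
    rw [e1, e2, Pi.zero_apply]
    linear_combination zmod2_add_self (((X.faceWalk x).map fun z => iv (z = X.τ₁ (X.τ₀ y))).sum) +
      zmod2_add_self (((X.faceWalk x).map fun z => iv (z = X.τ₁ y)).sum)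

/-! ### The quadratic function on the boundary of a face. -/

section FaceValue

variable {ω : X.Edge → ZMod 2} (o : X.LocalOrientation ω)

/-- Self-contacts of the boundary of a face cancel. -/
theorem face_contacts (x : F) {r : ℕ} (hr : X.sides x = r + 1) :
    pairSum (fun y z =>
      (1 + o.sign z) * (iv (X.SameHalf (X.τ₁ y) (X.τ₁ z)) + iv (X.SameHalf y (X.τ₁ z))) +
      o.sign z * (iv (X.SameHalf (X.τ₁ y) z) + iv (X.SameHalf y z))) (X.faceWalk x) +
    ((X.faceWalk x).map fun y => o.sign y * iv (X.SameHalf (X.τ₁ y) y)).sum +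
    pairSum (fun y z => iv (X.edge y = X.edge z) * (1 + ω (X.edge y))) (X.faceWalk x) +
    ((X.arcWalk x r).map fun y => iv (X.edge y = X.edge ((X.next ^ r) x))).sum = 0 := by
  set y : ℕ → F := fun i => (X.next ^ i) x with hy
  set s : ℕ → ZMod 2 := fun i => o.sign (y i) with hs
  set a : ℕ → ℕ → ZMod 2 := fun i j => iv (X.SameHalf (y i) (y j)) with ha
  set b : ℕ → ℕ → ZMod 2 := fun i j => iv (X.SameHalf (y i) (X.τ₀ (y j))) with hb
  have hτ : ∀ i, X.τ₁ (y (i + 1)) = X.τ₀ (y i) := fun i => (τ₀_next_pow x i).symm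
  have hy0 : X.τ₁ (y 0) = X.τ₀ (y r) := by
    rw [← hτ]; simp only [hy]; rw [← hr, next_pow_sides]; rfl
  have hsucc : ∀ i, s (i + 1) = s i + ω (X.edge (y i)) := o.sign_next_pow_succ x
  have hb' : ∀ i j, iv (X.SameHalf (X.τ₀ (y i)) (y j)) = b i j := fun i j =>
    iv_congr sameHalf_τ₀_left
  have hbs : ∀ i j, b i j = b j i := by
    intro i j; simp only [hb]; rw [iv_congr sameHalf_comm, iv_congr sameHalf_τ₀_left]
  have has : ∀ i j, a i j = a j i := fun i j => iv_congr sameHalf_comm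
  have ha' : ∀ i j, iv (X.SameHalf (X.τ₀ (y i)) (X.τ₀ (y j))) = a i j := fun i j =>
    iv_congr sameHalf_τ₀_τ₀
  have hb0 : ∀ i, b i i = 0 := fun i => iv_false (not_sameHalf_τ₀ _)
  have he : ∀ i j, iv (X.edge (y i) = X.edge (y j)) = a i j + b i j := by
    intro i j
    rw [iv_congr eq_comm]
    exact (iv_sameHalf_add (y i) (y j)).symm
  have heω : ∀ i j, iv (X.edge (y i) = X.edge (y j)) * (1 + ω (X.edge (y i))) =
      (a i j + b i j) * (1 + s j + s (j + 1)) := by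
    intro i j
    rw [he]
    have h0 : ω (X.edge (y j)) = s j + s (j + 1) := by
      rw [hsucc]; linear_combination -zmod2_add_self (s j)
    by_cases h : X.edge (y i) = X.edge (y j)
    · rw [h, h0]; ring
    · have := he i j
      rw [iv_false h] at this
      rw [← this]; ring
  -- If the last side runs along the same half-edge as an earlier one, the two are different flags,
  -- hence exchanged by `τ₂`. The signs at their heads are then opposite, and the head of the last
  -- side is the starting point.
  have hlast : ∀ i, i < r → a i r * (1 + s (i + 1) + s 0) = 0 := by
    intro i hi
    by_cases h : X.SameHalf (y i) (y r)
    · have h1 : y r = X.τ₂ (y i) := by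
        rcases h with h | h
        · have := next_pow_inj (x := x) (by omega) (by omega) h
          omega
        · exact h
      have h2 : o.sign (X.τ₁ (y 0)) = o.sign (X.τ₂ (X.τ₁ (y (i + 1)))) := by
        rw [hy0, h1, X.comm, hτ]
      rw [o.sign_τ₁, o.sign_τ₂, o.sign_τ₁] at h2
      have h3 : s 0 = s (i + 1) + 1 := by
        simp only [hs]; linear_combination h2
      rw [h3]
      linear_combination a i r * zmod2_add_self (1 + s (i + 1))
    · simp only [ha]; rw [iv_false h, zero_mul]
  -- If the last side is traversed against an earlier one, `next_pow_ne_τ₁` leaves only the case of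
  -- two different sides of the edge, where the signs agree.
  have hlast' : ∀ i, i < r → b i r * (s i + s 0) = 0 := by
    intro i hi
    by_cases h : X.SameHalf (y i) (X.τ₀ (y r))
    · rw [← hy0] at h
      rcases h with h | h
      · exact absurd h.symm (next_pow_ne_τ₁ i x)
      · have h2 : o.sign (X.τ₁ (y 0)) = o.sign (X.τ₂ (y i)) := by rw [h]
        rw [o.sign_τ₁, o.sign_τ₂] at h2
        have h3 : s 0 = s i := by
          simp only [hs]; linear_combination h2
        rw [h3, zmod2_add_self, mul_zero]
    · simp only [hb]; rw [iv_false h, zero_mul]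
  rw [faceWalk, hr, arcWalk, pairSum_map_range, pairSum_map_range, arcWalk, List.map_map,
    List.map_map, sum_map_range, sum_map_range]
  change ∑ j ∈ Finset.range (r + 1), ∑ i ∈ Finset.range j,
      ((1 + s j) * (iv (X.SameHalf (X.τ₁ (y i)) (X.τ₁ (y j))) + iv (X.SameHalf (y i) (X.τ₁ (y j)))) +
        s j * (iv (X.SameHalf (X.τ₁ (y i)) (y j)) + a i j)) +
    ∑ j ∈ Finset.range (r + 1), s j * iv (X.SameHalf (X.τ₁ (y j)) (y j)) +
    ∑ j ∈ Finset.range (r + 1), ∑ i ∈ Finset.range j,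
      iv (X.edge (y i) = X.edge (y j)) * (1 + ω (X.edge (y i))) +
    ∑ i ∈ Finset.range r, iv (X.edge (y i) = X.edge (y r)) = 0
  simp only [heω]
  simp only [he]
  have s1 : ∑ j ∈ Finset.range (r + 1), ∑ i ∈ Finset.range j,
      (1 + s j) * iv (X.SameHalf (X.τ₁ (y i)) (X.τ₁ (y j))) =
      ∑ j ∈ Finset.range r, (∑ i ∈ Finset.range j, (1 + s (j + 1)) * a i j) +
      ∑ j ∈ Finset.range r, (1 + s (j + 1)) * a r j := by
    rw [sum_pairs_succ, Finset.sum_add_distrib]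
    simp only [hτ, hy0, ha']
  have s2 : ∑ j ∈ Finset.range (r + 1), ∑ i ∈ Finset.range j,
      (1 + s j) * iv (X.SameHalf (y i) (X.τ₁ (y j))) =
      ∑ j ∈ Finset.range r, (∑ i ∈ Finset.range j, (1 + s (j + 1)) * b i j) := by
    rw [Finset.sum_range_succ']
    simp only [Finset.range_zero, Finset.sum_empty, add_zero, hτ]
    refine Finset.sum_congr rfl fun j _ => ?_
    rw [Finset.sum_range_succ]
    change _ + (1 + s (j + 1)) * b j j = _
    rw [hb0, mul_zero, add_zero]
  have s4 : ∑ j ∈ Finset.range (r + 1), ∑ i ∈ Finset.range j,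
      s j * iv (X.SameHalf (X.τ₁ (y i)) (y j)) +
      ∑ j ∈ Finset.range (r + 1), s j * iv (X.SameHalf (X.τ₁ (y j)) (y j)) =
      ∑ j ∈ Finset.range (r + 1), (∑ i ∈ Finset.range j, s j * b i j) +
      ∑ j ∈ Finset.range r, s j * b r j := by
    have : ∑ j ∈ Finset.range r, s j * b r j = ∑ j ∈ Finset.range (r + 1), s j * b r j := by
      rw [Finset.sum_range_succ, hb0, mul_zero, add_zero]
    rw [this, ← Finset.sum_add_distrib, ← Finset.sum_add_distrib]
    refine Finset.sum_congr rfl fun j _ => ?_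
    rw [← Finset.sum_range_succ (fun i => s j * iv (X.SameHalf (X.τ₁ (y i)) (y j))),
      Finset.sum_range_succ']
    simp only [hτ, hy0, hb']
  have hsplit : ∑ j ∈ Finset.range (r + 1), ∑ i ∈ Finset.range j,
      ((1 + s j) * (iv (X.SameHalf (X.τ₁ (y i)) (X.τ₁ (y j))) + iv (X.SameHalf (y i) (X.τ₁ (y j)))) +
        s j * (iv (X.SameHalf (X.τ₁ (y i)) (y j)) + a i j)) =
      ∑ j ∈ Finset.range (r + 1), ∑ i ∈ Finset.range j,
        (1 + s j) * iv (X.SameHalf (X.τ₁ (y i)) (X.τ₁ (y j))) +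
      ∑ j ∈ Finset.range (r + 1), ∑ i ∈ Finset.range j,
        (1 + s j) * iv (X.SameHalf (y i) (X.τ₁ (y j))) +
      ∑ j ∈ Finset.range (r + 1), ∑ i ∈ Finset.range j,
        s j * iv (X.SameHalf (X.τ₁ (y i)) (y j)) +
      ∑ j ∈ Finset.range (r + 1), ∑ i ∈ Finset.range j, s j * a i j := by
    simp only [← Finset.sum_add_distrib]
    refine Finset.sum_congr rfl fun j _ => Finset.sum_congr rfl fun i _ => ?_
    ring
  -- After the index shifts, the pairs of sides before the last cancel term by term. Pairs with the
  -- last side, together with the correction for the rotation of the list, are left for `hend`.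
  have hmain : ∀ j, ∑ i ∈ Finset.range j, (1 + s (j + 1)) * a i j +
      ∑ i ∈ Finset.range j, (1 + s (j + 1)) * b i j + ∑ i ∈ Finset.range j, s j * b i j +
      ∑ i ∈ Finset.range j, s j * a i j +
      ∑ i ∈ Finset.range j, (a i j + b i j) * (1 + s j + s (j + 1)) = 0 := by
    intro j
    simp only [← Finset.sum_add_distrib]
    refine Finset.sum_eq_zero fun i _ => ?_
    linear_combination (a i j + b i j) * zmod2_add_self (1 + s j + s (j + 1))
  have hend : ∑ j ∈ Finset.range r, (1 + s (j + 1)) * a r j + ∑ j ∈ Finset.range r, s j * b r j +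
      ∑ i ∈ Finset.range r, s r * b i r + ∑ i ∈ Finset.range r, s r * a i r +
      ∑ i ∈ Finset.range r, (a i r + b i r) * (1 + s r + s (r + 1)) +
      ∑ i ∈ Finset.range r, (a i r + b i r) = 0 := by
    have hs0 : s (r + 1) = s 0 := by
      simp only [hs, hy]; rw [← hr, next_pow_sides]; rfl
    simp only [← Finset.sum_add_distrib]
    refine Finset.sum_eq_zero fun i hi => ?_
    have hi := Finset.mem_range.1 hi
    rw [has r i, hbs r i, hs0]
    linear_combination hlast i hi + hlast' i hi + (a i r + b i r) * zmod2_add_self (1 + s r)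
  have hsum := Finset.sum_eq_zero (s := Finset.range r) fun j _ => hmain j
  simp only [Finset.sum_add_distrib] at hsum
  rw [hsplit, s1, s2]
  have s4' := s4
  simp only [Finset.sum_range_succ _ r] at s4' hsum hend ⊢
  linear_combination s4' + hsum + hend

theorem sum_iv_sign (x : F) (m : ℕ) : ∑ i ∈ Finset.range m,
    (if o.sign ((X.next ^ i) x) = 1 ∧ o.sign ((X.next ^ (i + 1)) x) = 1 then (1 : ZMod 2) else 0) =
    ∑ i ∈ Finset.range m, o.sign ((X.next ^ i) x) * o.sign ((X.next ^ (i + 1)) x) := by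
  refine Finset.sum_congr rfl fun i _ => ?_
  generalize o.sign ((X.next ^ i) x) = a
  generalize o.sign ((X.next ^ (i + 1)) x) = b
  revert a b; decide

variable {o} {n : ℕ} {num : X.Vertex ≃ Fin n} (H : HalfEdgeOrder X o num)

/-- The quadratic function of a Kasteleyn orientation on the boundary of a face. -/
theorem quadratic_face {K : X.EdgeOrientation} (hK : K.IsKasteleyn o)
    {q : (X.Edge → ZMod 2) → ZMod 2} (h0 : q 0 = 0)
    (h1 : ∀ e, q (Pi.single e 1) = H.edgeSign K e)
    (hq : ∀ c d, q (c + d) = q c + q d + bilin H.signMatrix c d) (x : F) :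
    q (chainOf X.edge (X.faceWalk x)) = ∑ v, H.baseCount (X.faceWalk x) v := by
  obtain ⟨r, hr⟩ : ∃ r, X.sides x = r + 1 := ⟨X.sides x - 1, by have := sides_pos (X := X) x; omega⟩
  rw [H.quadratic_walk K h0 h1 hq, H.sum_baseCount]
  have hlast : X.τ₀ ((X.next ^ r) x) = X.τ₁ x := by
    rw [τ₀_next_pow, ← hr, next_pow_sides]
  -- Both bracketings give the same cyclic list, but the half-edge of `τ₁ x` is last in one and
  -- first in the other. Moving it past an odd number of half-edges costs 1, plus the coincidences
  -- with the last edge.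
  have hinv : pairSum H.lt (HalfEdgeOrder.halves X (X.faceWalk x)) =
      pairSum H.lt (HalfEdgeOrder.passes X (X.faceWalk x)) + 1 +
      ((X.arcWalk x r).map fun y => iv (X.edge y = X.edge ((X.next ^ r) x))).sum := by
    rw [faceWalk, hr, HalfEdgeOrder.halves_arcWalk_succ, HalfEdgeOrder.passes_arcWalk_succ]
    have hl : HalfEdgeOrder.halves X (X.arcWalk x r) ++ [(X.next ^ r) x, X.τ₀ ((X.next ^ r) x)] =
        (HalfEdgeOrder.halves X (X.arcWalk x r) ++ [(X.next ^ r) x]) ++ [X.τ₁ x] := by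
      rw [hlast]; simp
    rw [hl, H.pairSum_rotate]
    have hlen : (((HalfEdgeOrder.halves X (X.arcWalk x r) ++ [(X.next ^ r) x]).length : ℕ) : ZMod 2)
        = 1 := by
      have : (HalfEdgeOrder.halves X (X.arcWalk x r)).length = 2 * r := by
        rw [HalfEdgeOrder.length_halves, arcWalk_length]
      rw [List.length_append, this]
      push_cast
      rw [zmod2_two]; simp
    rw [hlen, List.map_append, List.sum_append, HalfEdgeOrder.sum_halves]
    have hn : ¬ X.SameHalf (X.τ₁ x) ((X.next ^ r) x) := by
      rw [← hlast, sameHalf_comm]; exact not_sameHalf_τ₀ _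
    simp only [iv_sameHalf_add, List.map_cons, List.map_nil, List.sum_cons, List.sum_nil,
      iv_false hn, add_zero]
    rw [← hlast, edge_τ₀]
  have hc := face_contacts o x hr
  have hk := hK x
  rw [EdgeOrientation.curvature, Finset.sum_add_distrib, sum_iv_sign] at hk
  have hd : K.disagree (X.faceWalk x) = ∑ i ∈ Finset.range (X.sides x), K.dir ((X.next ^ i) x) := by
    rw [EdgeOrientation.disagree, faceWalk, sum_arcWalk]
  -- The sides with `ω = 1` are those along which the sign changes. `sum_sign_changes` converts
  -- pairs of them into the number of sides joining two vertices labelled `-`, as in the Kasteleyn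
  -- condition, and the number of vertices labelled `-`.
  have hω : pairSum (fun x y => ω (X.edge x) * ω (X.edge y)) (X.faceWalk x) =
      ∑ i ∈ Finset.range (X.sides x), o.sign ((X.next ^ i) x) +
      ∑ i ∈ Finset.range (X.sides x), o.sign ((X.next ^ i) x) * o.sign ((X.next ^ (i + 1)) x) := by
    rw [← sum_sign_changes (fun i => o.sign ((X.next ^ i) x)) _ (by simp [next_pow_sides]),
      faceWalk, arcWalk, pairSum_map_range]
    refine Finset.sum_congr rfl fun j _ => Finset.sum_congr rfl fun i _ => ?_
    have : ∀ i, ω (X.edge ((X.next ^ i) x)) =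
        o.sign ((X.next ^ i) x) + o.sign ((X.next ^ (i + 1)) x) := by
      intro i; rw [o.sign_next_pow_succ]; linear_combination -zmod2_add_self (o.sign ((X.next ^ i) x))
    rw [this, this]
  have hlen : ((X.faceWalk x).map fun y => (1 + o.sign y)).sum =
      (X.faceWalk x).length + ∑ i ∈ Finset.range (X.sides x), o.sign ((X.next ^ i) x) := by
    rw [faceWalk, sum_arcWalk, Finset.sum_add_distrib, arcWalk_length]; simp
  rw [hinv, H.pairSum_passes, hd, hω, sum_map_add', hlen]
  linear_combination hk + hc + zmod2_add_self ((X.faceWalk x).length : ZMod 2) +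
    zmod2_add_self (∑ i ∈ Finset.range (X.sides x), o.sign ((X.next ^ i) x))

end FaceValue

end CellSurface

theorem iv_xor (p q : Prop) : iv (Xor p q) = iv p + iv q := by
  by_cases hp : p <;> by_cases hq : q <;> simp [iv, hp, hq, zmod2_add_self]

theorem sum_range_shift (f : ℕ → ZMod 2) (m : ℕ) :
    ∑ k ∈ Finset.range m, f (k + 1) = ∑ k ∈ Finset.range m, f k + f 0 + f m := by
  have h := Finset.sum_range_succ f m
  rw [Finset.sum_range_succ'] at h
  linear_combination h - zmod2_add_self (f 0)

namespace CellSurface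

variable {F : Type*} [Fintype F] {X : CellSurface F}

theorem τ₁_eq_iff {x y : F} : X.τ₁ x = y ↔ x = X.τ₁ y := by
  constructor
  · rintro rfl; rw [X.τ₁_invol]
  · rintro rfl; rw [X.τ₁_invol]

theorem τ₀_eq_iff {x y : F} : X.τ₀ x = y ↔ x = X.τ₀ y := by
  constructor
  · rintro rfl; rw [X.τ₀_invol]
  · rintro rfl; rw [X.τ₀_invol]

theorem τ₂_eq_iff {x y : F} : X.τ₂ x = y ↔ x = X.τ₂ y := by
  constructor
  · rintro rfl; rw [X.τ₂_invol]
  · rintro rfl; rw [X.τ₂_invol]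

/-- `τ₁` conjugates `next` to its inverse, in the form `next^n τ₁ next^n = τ₁`, so both directions
of the boundary have the same period. -/
theorem sides_τ₁ (x : F) : X.sides (X.τ₁ x) = X.sides x := by
  unfold sides
  rw [Function.minimalPeriod_eq_minimalPeriod_iff]
  intro n
  have h : ∀ n : ℕ, ∀ x : F, (X.next ^ n) (X.τ₁ ((X.next ^ n) x)) = X.τ₁ x := by
    intro n
    induction n with
    | zero => intro x; rfl
    | succ n ih =>
      intro x
      rw [pow_succ', Equiv.Perm.mul_apply, next_apply, Equiv.Perm.mul_apply, next_apply,
        X.τ₁_invol]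
      have h2 : (X.next ^ n) (X.τ₀ ((X.next ^ n) x)) = X.τ₀ x := by
        have h3 := ih (X.next x)
        have hc : (X.next ^ n) (X.next x) = X.next ((X.next ^ n) x) := by
          rw [← Equiv.Perm.mul_apply, ← pow_succ, pow_succ', Equiv.Perm.mul_apply]
        rwa [hc, next_apply, X.τ₁_invol, next_apply, X.τ₁_invol] at h3
      rw [h2, X.τ₀_invol]
  simp only [Function.IsPeriodicPt, Function.IsFixedPt, Equiv.Perm.iterate_eq_pow]
  constructor
  · intro h1
    have := h n (X.τ₁ x)
    rw [h1, X.τ₁_invol] at this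
    exact this
  · intro h1
    have := h n x
    rwa [h1] at this

theorem next_zpow_eq_iff (x : F) (i j : ℤ) :
    (X.next ^ i) x = (X.next ^ j) x ↔ (X.sides x : ℤ) ∣ i - j := by
  have h := MulAction.zpow_smul_eq_iff_minimalPeriod_dvd (a := X.next) (b := x) (n := i - j)
  have h' : (X.next ^ (i - j)) x = x ↔ (X.sides x : ℤ) ∣ i - j := h
  rw [← h', sub_eq_add_neg, add_comm, zpow_add, Equiv.Perm.mul_apply, zpow_neg,
    Equiv.Perm.inv_eq_iff_eq]

/-! ### Curves -/

/-- The indicator of: on the side of `x`, the point `(y, u)` is nearer to the vertex of `x` than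
`(x, t)`. -/
noncomputable def nearer (X : CellSurface F) (x : F) (t : ℝ) (y : F) (u : ℝ) : ZMod 2 :=
  iv (y = x ∧ u < t) + iv (y = X.τ₀ x ∧ 1 - u < t)

theorem nearer_τ₂_τ₂ (x : F) (t : ℝ) (y : F) (u : ℝ) :
    X.nearer (X.τ₂ x) t (X.τ₂ y) u = X.nearer x t y u := by
  unfold nearer
  rw [X.comm, X.τ₂.injective.eq_iff, X.τ₂.injective.eq_iff]

theorem nearer_τ₂_left (x : F) (t : ℝ) (y : F) (u : ℝ) :
    X.nearer (X.τ₂ x) t y u = X.nearer x t (X.τ₂ y) u := by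
  rw [← nearer_τ₂_τ₂, X.τ₂_invol]

/-- Two boundary points of a polygon are different. -/
def Apart (X : CellSurface F) (x : F) (t : ℝ) (y : F) (u : ℝ) : Prop :=
  ¬ (y = x ∧ u = t) ∧ ¬ (y = X.τ₀ x ∧ u = 1 - t)

theorem apart_of_not_samePoint {x y : F} {t u : ℝ} (h : ¬ X.SamePoint x t y u) :
    X.Apart x t y u := by
  unfold SamePoint at h
  unfold Apart
  tauto

theorem apart_symm {x y : F} {t u : ℝ} (h : X.Apart x t y u) : X.Apart y u x t := by
  refine ⟨fun h' => h.1 ⟨h'.1.symm, h'.2.symm⟩, fun h' => h.2 ⟨?_, ?_⟩⟩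
  · rw [h'.1, X.τ₀_invol]
  · rw [h'.2]; ring

theorem samePoint_τ₂_right {x y : F} {t u : ℝ} :
    X.SamePoint x t (X.τ₂ y) u ↔ X.SamePoint x t y u := by
  unfold SamePoint
  simp only [τ₂_eq_iff, X.τ₂_invol, X.comm]
  tauto

theorem samePoint_τ₂_left {x y : F} {t u : ℝ} :
    X.SamePoint (X.τ₂ x) t y u ↔ X.SamePoint x t y u := by
  unfold SamePoint
  simp only [X.τ₂_invol]
  tauto

theorem samePoint_τ₀_left {x y : F} {t u : ℝ} :
    X.SamePoint (X.τ₀ x) (1 - t) y u ↔ X.SamePoint x t y u := by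
  unfold SamePoint
  rw [← X.comm, X.τ₀_invol, X.τ₀_invol, sub_sub_cancel]
  tauto

theorem samePoint_τ₀_right {x y : F} {t u : ℝ} :
    X.SamePoint x t (X.τ₀ y) (1 - u) ↔ X.SamePoint x t y u := by
  unfold SamePoint
  have h1 : 1 - u = t ↔ u = 1 - t := by constructor <;> intro h <;> linarith
  have h2 : 1 - u = 1 - t ↔ u = t := by constructor <;> intro h <;> linarith
  simp only [τ₀_eq_iff, X.τ₀_invol, h1, h2]
  tauto

namespace Curve

variable (γ : X.Curve)

/-- The corners cut off by the `k`-th chord, on the chosen side. -/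
def chordCorners (k : ℕ) : List F := X.arcWalk (X.τ₁ (γ.flag k)) (γ.r k + 1)

/-- The sides cut off by the `k`-th chord, on the chosen side. -/
def chordSides (k : ℕ) : List F := X.arcWalk (X.τ₁ (γ.flag k)) (γ.r k)

/-- The corners between a curve and its walk. -/
def cornerWalk : List F := (List.range γ.len).flatMap γ.chordCorners

theorem sideWalk_eq : γ.sideWalk = (List.range γ.len).flatMap γ.chordSides := rfl

theorem passes_chordCorners {k : ℕ} (hk : k < γ.len) :
    HalfEdgeOrder.passes X (γ.chordCorners k) = [γ.flag k] ++
      (HalfEdgeOrder.halves X (γ.chordSides k) ++ [X.τ₂ (γ.flag (k + 1))]) := by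
  rw [chordCorners, HalfEdgeOrder.passes_arcWalk_succ, X.τ₁_invol, γ.chord k hk, chordSides]

theorem sum_chord_ends {k : ℕ} (hk : k < γ.len) (φ : F → ZMod 2) (hφ : ∀ x, φ (X.τ₂ x) = φ x) :
    ((γ.chordSides k).map fun x => φ x + φ (X.τ₀ x)).sum =
      ((γ.chordCorners k).map fun y => φ y + φ (X.τ₁ y)).sum +
        (φ (γ.flag k) + φ (γ.flag (k + 1))) := by
  rw [← HalfEdgeOrder.sum_passes, ← HalfEdgeOrder.sum_halves, γ.passes_chordCorners hk]
  simp only [List.map_append, List.sum_append, List.map_cons, List.map_nil, List.sum_cons,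
    List.sum_nil, hφ, add_zero]
  linear_combination -zmod2_add_self (φ (γ.flag k)) - zmod2_add_self (φ (γ.flag (k + 1)))

/-- The corners cut off by a chord use, besides the half-edges of its sides, the half-edges on the
two crossed edges. Each crossed half-edge is the end of one chord and the beginning of the next, so
the sum telescopes to the starting point and the end point. -/
theorem sum_walk_ends (φ : F → ZMod 2) (hφ : ∀ x, φ (X.τ₂ x) = φ x) :
    (γ.sideWalk.map fun x => φ x + φ (X.τ₀ x)).sum =
      (γ.cornerWalk.map fun y => φ y + φ (X.τ₁ y)).sum +
        (φ (γ.flag 0) + φ (γ.flag γ.len)) := by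
  rw [sideWalk_eq, cornerWalk, sum_map_flatMap_range, sum_map_flatMap_range]
  rw [Finset.sum_congr rfl fun k hk => γ.sum_chord_ends (Finset.mem_range.1 hk) φ hφ,
    Finset.sum_add_distrib, Finset.sum_add_distrib, sum_range_shift (fun k => φ (γ.flag k))]
  linear_combination zmod2_add_self (∑ k ∈ Finset.range γ.len, φ (γ.flag k))

theorem iv_or_τ₁ (y x : F) : iv (y = x ∨ y = X.τ₁ x) = iv (y = x) + iv (y = X.τ₁ x) := by
  apply iv_or
  rintro ⟨h, h'⟩
  exact X.τ₁_ne x (h'.symm.trans h)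

theorem cornerCount_chordCorners (k : ℕ) (x : F) : X.cornerCount (γ.chordCorners k) x =
    ∑ i ∈ Finset.range (γ.r k + 1), (iv ((X.next ^ i) (X.τ₁ (γ.flag k)) = x) +
      iv ((X.next ^ i) (X.τ₁ (γ.flag k)) = X.τ₁ x)) := by
  rw [cornerCount, chordCorners, sum_arcWalk]
  simp only [iv_or_τ₁]

/-- Shifting along the part of the boundary cut off by a chord. -/
theorem sum_chord_shift {k : ℕ} (hk : k < γ.len) (x : F) :
    ∑ i ∈ Finset.range (γ.r k + 1), iv ((X.next ^ i) (X.τ₁ (γ.flag k)) = X.τ₁ x) =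
    ∑ i ∈ Finset.range (γ.r k + 1), iv ((X.next ^ i) (X.τ₁ (γ.flag k)) = X.τ₀ x) +
      (iv (γ.flag k = x) + iv (X.τ₂ (γ.flag (k + 1)) = X.τ₀ x)) := by
  have h : ∀ i : ℕ, iv ((X.next ^ (i + 1)) (X.τ₁ (γ.flag k)) = X.τ₁ x) =
      iv ((X.next ^ i) (X.τ₁ (γ.flag k)) = X.τ₀ x) := by
    intro i
    rw [next_pow_succ, X.τ₁.injective.eq_iff, τ₀_eq_iff]
  have h2 := sum_range_shift (fun i => iv ((X.next ^ i) (X.τ₁ (γ.flag k)) = X.τ₁ x)) (γ.r k + 1)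
  simp only [h, γ.chord k hk, pow_zero, Equiv.Perm.coe_one, id_eq, X.τ₁.injective.eq_iff] at h2
  linear_combination -h2 - zmod2_add_self (iv (γ.flag k = x)) -
    zmod2_add_self (iv (X.τ₂ (γ.flag (k + 1)) = X.τ₀ x))

/-- A whole side in the cut-off arc has a cut-off corner at both ends and contributes zero. Only the
sides through which the chord enters and leaves have one. -/
theorem cornerCount_chord_side {k : ℕ} (hk : k < γ.len) (x : F) :
    X.cornerCount (γ.chordCorners k) x + X.cornerCount (γ.chordCorners k) (X.τ₀ x) =
      (iv (γ.flag k = x) + iv (γ.flag k = X.τ₀ x)) +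
      (iv (X.τ₂ (γ.flag (k + 1)) = x) + iv (X.τ₂ (γ.flag (k + 1)) = X.τ₀ x)) := by
  rw [cornerCount_chordCorners, cornerCount_chordCorners, Finset.sum_add_distrib,
    Finset.sum_add_distrib, γ.sum_chord_shift hk, γ.sum_chord_shift hk, X.τ₀_invol]
  linear_combination
    zmod2_add_self (∑ i ∈ Finset.range (γ.r k + 1), iv ((X.next ^ i) (X.τ₁ (γ.flag k)) = x)) +
    zmod2_add_self (∑ i ∈ Finset.range (γ.r k + 1), iv ((X.next ^ i) (X.τ₁ (γ.flag k)) = X.τ₀ x))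

theorem cornerCount_cornerWalk (x : F) : X.cornerCount γ.cornerWalk x =
    ∑ k ∈ Finset.range γ.len, X.cornerCount (γ.chordCorners k) x :=
  sum_map_flatMap_range _ _ _

theorem chain_eq_sum (e : X.Edge) :
    γ.chain e = ∑ k ∈ Finset.range γ.len, iv (X.edge (γ.flag k) = e) := by
  rw [chain, crossings, Finset.card_filter]
  push_cast
  refine Finset.sum_congr rfl fun k _ => ?_
  unfold iv
  congr

theorem iv_edge_eq (x y : F) : iv (X.edge y = X.edge x) =
    (iv (y = x) + iv (y = X.τ₀ x)) + (iv (X.τ₂ y = x) + iv (X.τ₂ y = X.τ₀ x)) := by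
  rw [iv_congr eq_comm, iv_congr edge_eq_iff]
  have h1 : X.τ₂ y = x ↔ y = X.τ₂ x := τ₂_eq_iff
  have h2 : X.τ₂ y = X.τ₀ x ↔ y = X.τ₀ (X.τ₂ x) := by rw [τ₂_eq_iff, X.comm]
  have n1 := X.τ₂_ne x
  have n2 := X.τ₀_ne x
  have n3 := X.τ₀τ₂_ne x
  have n4 : X.τ₂ x ≠ X.τ₀ x := by
    intro h; apply n3; rw [h, X.τ₀_invol]
  have n5 : X.τ₂ x ≠ X.τ₀ (X.τ₂ x) := (X.τ₀_ne _).symm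
  have n6 : X.τ₀ x ≠ X.τ₀ (X.τ₂ x) := fun h => n1 (X.τ₀.injective h).symm
  rw [h1, h2, iv_or, iv_or, iv_or]
  · ring
  · rintro ⟨h, h'⟩; exact n6 (h.symm.trans h')
  · rintro ⟨h, h' | h'⟩
    · exact n4 (h.symm.trans h')
    · exact n5 (h.symm.trans h')
  · rintro ⟨h, h' | h' | h'⟩
    · exact n1 (h'.symm.trans h)
    · exact n2 (h'.symm.trans h)
    · exact n3 (h'.symm.trans h)

theorem flag_len : γ.flag γ.len = γ.flag 0 ∨ γ.flag γ.len = X.τ₀ (γ.flag 0) := by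
  rcases γ.closed with h | h
  · exact Or.inl h.1
  · exact Or.inr h.1

/-- At each crossing the exit flag of one chord and the entry flag of the next are exchanged by
`τ₂`; together they detect all four flags of the crossed edge. At the starting point of a one-sided
curve the flags `x` and `τ₀ x` merely change places. -/
theorem cornerWalk_side (x : F) : X.cornerCount γ.cornerWalk x +
    X.cornerCount γ.cornerWalk (X.τ₀ x) = γ.chain (X.edge x) := by
  rw [cornerCount_cornerWalk, cornerCount_cornerWalk, ← Finset.sum_add_distrib,
    Finset.sum_congr rfl fun k hk => γ.cornerCount_chord_side (Finset.mem_range.1 hk) x,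
    Finset.sum_add_distrib, chain_eq_sum,
    sum_range_shift fun k => iv (X.τ₂ (γ.flag k) = x) + iv (X.τ₂ (γ.flag k) = X.τ₀ x)]
  simp only [iv_edge_eq x]
  have : iv (X.τ₂ (γ.flag γ.len) = x) + iv (X.τ₂ (γ.flag γ.len) = X.τ₀ x) =
      iv (X.τ₂ (γ.flag 0) = x) + iv (X.τ₂ (γ.flag 0) = X.τ₀ x) := by
    rcases γ.flag_len with h | h
    · rw [h]
    · rw [h, ← X.comm, X.τ₀.injective.eq_iff, τ₀_eq_iff, add_comm]
  rw [this]
  simp only [Finset.sum_add_distrib]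
  linear_combination
    zmod2_add_self (iv (X.τ₂ (γ.flag 0) = x) + iv (X.τ₂ (γ.flag 0) = X.τ₀ x))

theorem isCornerSystem_twoSided (h : γ.TwoSided) :
    X.IsCornerSystem γ.cornerWalk γ.sideWalk γ.chain where
  ends φ hφ := by
    rw [γ.sum_walk_ends φ hφ, show γ.flag γ.len = γ.flag 0 from h, zmod2_add_self, add_zero]
  side := γ.cornerWalk_side

/-- The walk leaves uncancelled exactly the two half-edges of the edge at the starting point, and
these are the half-edges of the edge that closes it up. -/
theorem isCornerSystem_oneSided (h : γ.OneSided) :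
    X.IsCornerSystem γ.cornerWalk γ.oneSidedWalk γ.chain where
  ends φ hφ := by
    rw [oneSidedWalk, List.map_append, List.sum_append, γ.sum_walk_ends φ hφ,
      show γ.flag γ.len = X.τ₀ (γ.flag 0) from h]
    simp only [List.map_cons, List.map_nil, List.sum_cons, List.sum_nil, X.τ₀_invol]
    linear_combination zmod2_add_self (φ (γ.flag 0)) + zmod2_add_self (φ (X.τ₀ (γ.flag 0)))
  side := γ.cornerWalk_side

/-! ### Which boundary points are cut off by a chord -/

theorem r_lt {k : ℕ} (hk : k < γ.len) : γ.r k < X.sides (X.τ₁ (γ.flag k)) := by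
  rw [sides_τ₁]
  have h1 := γ.chord_lt k hk
  have h2 := γ.t_pos k hk.le
  have h3 := γ.t_pos (k + 1) hk
  have : (γ.r k : ℝ) < X.sides (γ.flag k) := by linarith
  exact_mod_cast this

/-- The sum over `i` tells whether the tail of the directed side `z` is cut off. There are two
corrections: the side before the first cut-off vertex is cut off near its head, and the last side is
cut off only before the exit point. -/
theorem iv_cutsOff {k : ℕ} (hk : k < γ.len) {z : F} {s : ℝ} (hs0 : 0 < s) (hs1 : s < 1)
    (hex : ¬ (X.τ₂ (γ.flag (k + 1)) = z ∧ γ.t (k + 1) = s)) :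
    iv (γ.CutsOff k z s) =
      ∑ i ∈ Finset.range (γ.r k + 1), iv ((X.next ^ i) (X.τ₁ (γ.flag k)) = z) +
      iv (γ.flag k = X.τ₀ z ∧ 1 - γ.t k < s) +
      iv (X.τ₂ (γ.flag (k + 1)) = z ∧ γ.t (k + 1) < s) := by
  set y := X.τ₁ (γ.flag k) with hy
  have hr := γ.r_lt hk
  rw [← hy] at hr
  have hlt := γ.chord_lt k hk
  rw [← sides_τ₁ (γ.flag k), ← hy] at hlt
  have ht0 := γ.t_pos k hk.le
  have ht1 := γ.t_lt k hk.le
  have ht0' := γ.t_pos (k + 1) hk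
  have ht1' := γ.t_lt (k + 1) hk
  have hback : γ.flag k = X.τ₀ z ↔ (X.next ^ (-1 : ℤ)) y = z := by
    rw [zpow_neg_one, Equiv.Perm.inv_eq_iff_eq, next_apply, hy, X.τ₁.injective.eq_iff]
  have hchord : X.τ₂ (γ.flag (k + 1)) = (X.next ^ (γ.r k : ℤ)) y := by
    rw [zpow_natCast]; exact (γ.chord k hk).symm
  by_cases hz : ∃ i : ℤ, (X.next ^ i) y = z
  · obtain ⟨i', hi'⟩ := hz
    set S := X.sides y with hS
    have hSpos : 0 < S := sides_pos y
    obtain ⟨j, hjS, hj⟩ : ∃ j : ℕ, j < S ∧ (X.next ^ (j : ℤ)) y = z := by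
      refine ⟨(i' % S).toNat, ?_, ?_⟩
      · have := Int.emod_lt_of_pos i' (show (0 : ℤ) < S by exact_mod_cast hSpos)
        have h0 := Int.emod_nonneg i' (show (S : ℤ) ≠ 0 by exact_mod_cast hSpos.ne')
        omega
      · have h0 := Int.emod_nonneg i' (show (S : ℤ) ≠ 0 by exact_mod_cast hSpos.ne')
        rw [← hi', next_zpow_eq_iff, Int.toNat_of_nonneg h0]
        exact ⟨-(i' / S), by have := Int.emod_add_mul_ediv i' S; linarith⟩
    have e1 : ∀ i : ℕ, i < S → ((X.next ^ i) y = z ↔ i = j) := by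
      intro i hi
      rw [← hj, zpow_natCast]
      exact ⟨fun h => next_pow_inj hi hjS h, fun h => by rw [h]⟩
    have e2 : γ.flag k = X.τ₀ z ↔ j + 1 = S := by
      rw [hback, ← hj, next_zpow_eq_iff]
      constructor
      · rintro ⟨c, hc⟩
        rw [← hS] at hc
        have h1 : (S : ℤ) * (-c) = j + 1 := by linarith
        have h2 : -c = 1 := by
          have : 0 < -c := by
            by_contra hneg; push Not at hneg
            nlinarith
          have : -c < 2 := by
            by_contra hneg; push Not at hneg
            nlinarith
          omega
        rw [h2] at h1
        omega
      · intro h; exact ⟨-1, by rw [← hS, ← h]; push_cast; ring⟩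
    have e3 : X.τ₂ (γ.flag (k + 1)) = z ↔ γ.r k = j := by
      rw [hchord, zpow_natCast, e1 _ hr]
    have e4 : γ.CutsOff k z s ↔
        (j < γ.r k ∨ (γ.r k = j ∧ s < γ.t (k + 1))) ∨ (j + 1 = S ∧ 1 - γ.t k < s) := by
      constructor
      · rintro ⟨i, hi, hl, hu⟩
        rw [← hy, ← hj, next_zpow_eq_iff, ← hS] at hi
        obtain ⟨c, hc⟩ := hi
        have b1 : -2 < i := by
          have : (-2 : ℝ) < i := by linarith
          exact_mod_cast this
        have b2 : i < S := by
          have : (i : ℝ) < S := by linarith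
          exact_mod_cast this
        have hc' : c = 0 ∨ c = -1 := by
          have c1 : c < 1 := by
            by_contra hneg; push Not at hneg
            nlinarith
          have c2 : -2 < c := by
            by_contra hneg; push Not at hneg
            nlinarith
          omega
        rcases hc' with rfl | rfl
        · have hij : i = j := by linarith
          subst hij
          left
          rcases lt_or_ge j (γ.r k) with h | h
          · exact Or.inl h
          · right
            have : j = γ.r k := by
              by_contra hne
              have h3 : (γ.r k : ℝ) + 1 ≤ j := by exact_mod_cast (by omega : γ.r k + 1 ≤ j)
              push_cast at hu
              linarith
            subst this
            push_cast at hu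
            exact ⟨rfl, by linarith⟩
        · right
          have hi : i = -1 := by
            have : i = j - S := by linarith
            omega
          have hjS' : j + 1 = S := by
            have : i = j - S := by linarith
            omega
          subst hi
          push_cast at hl
          exact ⟨hjS', by linarith⟩
      · rintro ((h | ⟨h, h'⟩) | ⟨h, h'⟩)
        · refine ⟨j, hj, ?_, ?_⟩
          · push_cast; have : (0 : ℝ) ≤ j := by positivity
            linarith
          · push_cast
            have : (j : ℝ) + 1 ≤ γ.r k := by exact_mod_cast h
            linarith
        · refine ⟨j, hj, ?_, ?_⟩
          · push_cast; have : (0 : ℝ) ≤ j := by positivity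
            linarith
          · push_cast; rw [h]; linarith
        · refine ⟨-1, ?_, ?_, ?_⟩
          · rw [← hback, e2]; exact h
          · push_cast; linarith
          · push_cast; have : (0 : ℝ) ≤ γ.r k := by positivity
            linarith
    have e5 : ∑ i ∈ Finset.range (γ.r k + 1), iv ((X.next ^ i) y = z) = iv (j < γ.r k + 1) := by
      have : ∀ i ∈ Finset.range (γ.r k + 1), iv ((X.next ^ i) y = z) = if i = j then 1 else 0 := by
        intro i hi
        have := Finset.mem_range.1 hi
        rw [iv_congr (e1 i (by omega))]; simp [iv]
      rw [Finset.sum_congr rfl this, Finset.sum_ite_eq' (Finset.range (γ.r k + 1)) j]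
      simp [iv]
    rw [e5, iv_congr e4, e2, e3, iv_or]
    · rw [e3] at hex
      rcases lt_trichotomy j (γ.r k) with h | h | h
      · rw [iv_true (Or.inl h), iv_true (show j < γ.r k + 1 by omega),
          iv_false (p := γ.r k = j ∧ γ.t (k + 1) < s) (fun h' => by omega)]
        ring
      · subst h
        have hne : γ.t (k + 1) ≠ s := fun h => hex ⟨rfl, h⟩
        rw [iv_true (show γ.r k < γ.r k + 1 by omega)]
        rcases lt_or_gt_of_ne hne with h | h
        · rw [iv_false (by rintro (h' | ⟨_, h'⟩); exacts [lt_irrefl _ h', lt_asymm h h']),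
            iv_true (p := γ.r k = γ.r k ∧ _) ⟨rfl, h⟩]
          linear_combination -zmod2_two
        · rw [iv_true (Or.inr ⟨rfl, h⟩),
            iv_false (p := γ.r k = γ.r k ∧ γ.t (k + 1) < s) (fun h' => lt_asymm h h'.2)]
          ring
      · rw [iv_false (by rintro (h' | ⟨h', _⟩) <;> omega), iv_false (show ¬ j < γ.r k + 1 by omega),
          iv_false (p := γ.r k = j ∧ γ.t (k + 1) < s) (fun h' => by omega)]
        ring
    -- If the arc runs around the whole polygon, entry and exit lie on one side; then `chord_lt`
    -- gives `t k + t (k + 1) < 1`, so the two cut-off segments of this side are disjoint.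
    · rintro ⟨h | ⟨h, h'⟩, h'', h'''⟩
      · omega
      · have : (S : ℝ) = γ.r k + 1 := by rw [h]; exact_mod_cast h''.symm
        linarith
  · rw [iv_false (p := γ.CutsOff k z s) (fun ⟨i, hi, _⟩ => hz ⟨i, hi⟩),
      iv_false (p := γ.flag k = X.τ₀ z ∧ _) (fun h => hz ⟨_, hback.1 h.1⟩),
      iv_false (p := X.τ₂ _ = z ∧ _) (fun h => hz ⟨_, hchord.symm.trans h.1⟩), Finset.sum_eq_zero]
    · ring
    · intro i _
      exact iv_false fun h => hz ⟨i, by rw [zpow_natCast]; exact h⟩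

/-- A boundary point is cut off by a chord if its vertex is, unless an end point of the chord lies
between the two. -/
theorem iv_onSide {k : ℕ} (hk : k < γ.len) {x : F} {t : ℝ} (ht0 : 0 < t) (ht1 : t < 1)
    (h1 : X.Apart x t (γ.flag k) (γ.t k)) (h2 : X.Apart x t (X.τ₂ (γ.flag (k + 1))) (γ.t (k + 1))) :
    iv (γ.OnSide k x t) = X.cornerCount (γ.chordCorners k) x +
      (X.nearer x t (γ.flag k) (γ.t k) + X.nearer x t (X.τ₂ (γ.flag (k + 1))) (γ.t (k + 1))) := by
  have hex : ¬ (γ.CutsOff k x t ∧ γ.CutsOff k (X.τ₀ x) (1 - t)) := by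
    rintro ⟨⟨i, hi, _⟩, ⟨j, hj, _⟩⟩
    set y := X.τ₁ (γ.flag k)
    have h3 : (X.next ^ (1 + j - i)) x = X.τ₁ x := by
      rw [← hi, ← Equiv.Perm.mul_apply, ← zpow_add, sub_add_cancel, zpow_add, Equiv.Perm.mul_apply,
        hj, zpow_one, next_apply, X.τ₀_invol, hi]
    obtain ⟨m, hm⟩ := (isOfFinOrder_of_finite X.next).mem_powers_iff_mem_zpowers.2
      ⟨1 + j - i, rfl⟩
    simp only at hm
    rw [← hm] at h3
    exact next_pow_ne_τ₁ m x h3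
  unfold OnSide
  rw [iv_or hex, γ.iv_cutsOff hk ht0 ht1 h2.1,
    γ.iv_cutsOff hk (by linarith) (by linarith) h2.2, cornerCount_chordCorners,
    Finset.sum_add_distrib, γ.sum_chord_shift hk, X.τ₀_invol]
  have e1 : iv (γ.flag k = x ∧ 1 - γ.t k < 1 - t) =
      iv (γ.flag k = x) + iv (γ.flag k = x ∧ γ.t k < t) := by
    by_cases h : γ.flag k = x
    · have hne : γ.t k ≠ t := fun h' => h1.1 ⟨h, h'⟩
      rcases lt_or_gt_of_ne hne with h' | h'
      · rw [iv_false (fun h'' => by linarith [h''.2]), iv_true h, iv_true ⟨h, h'⟩]; rfl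
      · rw [iv_true ⟨h, by linarith⟩, iv_true h, iv_false (fun h'' => by linarith [h''.2])]; rfl
    · simp [iv, h]
  have e2 : iv (X.τ₂ (γ.flag (k + 1)) = X.τ₀ x ∧ γ.t (k + 1) < 1 - t) =
      iv (X.τ₂ (γ.flag (k + 1)) = X.τ₀ x) +
        iv (X.τ₂ (γ.flag (k + 1)) = X.τ₀ x ∧ 1 - γ.t (k + 1) < t) := by
    by_cases h : X.τ₂ (γ.flag (k + 1)) = X.τ₀ x
    · have hne : γ.t (k + 1) ≠ 1 - t := fun h' => h2.2 ⟨h, h'⟩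
      rcases lt_or_gt_of_ne hne with h' | h'
      · rw [iv_true ⟨h, h'⟩, iv_true h, iv_false (fun h'' => by linarith [h''.2])]; rfl
      · rw [iv_false (fun h'' => by linarith [h''.2]), iv_true h, iv_true ⟨h, by linarith⟩]; rfl
    · simp [iv, h]
  rw [e1, e2]
  unfold nearer
  ring

end Curve

end CellSurface

/-! ### Intersection numbers of two curves read off from a walk, and contacts. -/

namespace CellSurface

variable {F : Type*} [Fintype F] {X : CellSurface F}

/-- Contacts of two corners of sign `0`. -/
noncomputable def cornerContact (X : CellSurface F) (y z : F) : ZMod 2 :=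
  iv (z = y) + iv (z = X.τ₁ (X.τ₂ y))

/-- Contacts of two sides of sign `0`. -/
noncomputable def sideContact (X : CellSurface F) (y z : F) : ZMod 2 :=
  iv (z = y) + iv (z = X.τ₀ (X.τ₂ y))

theorem next_eq_iff (y z : F) : X.τ₁ (X.τ₀ z) = X.τ₁ (X.τ₂ y) ↔ z = X.τ₀ (X.τ₂ y) := by
  rw [X.τ₁.injective.eq_iff, τ₀_eq_iff]

namespace Curve

theorem TwoSided.t_len {γ : X.Curve} (h : γ.TwoSided) : γ.t γ.len = γ.t 0 := by
  rcases γ.closed with h' | h'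
  · exact h'.2
  · exact absurd (h'.1.symm.trans h) (X.τ₀_ne _)

theorem OneSided.t_len {γ : X.Curve} (h : γ.OneSided) : γ.t γ.len = 1 - γ.t 0 := by
  rcases γ.closed with h' | h'
  · exact absurd (h.symm.trans h'.1) (X.τ₀_ne _)
  · exact h'.2

theorem samePoint_len_left (γ : X.Curve) (y : F) (u : ℝ) :
    X.SamePoint (γ.flag γ.len) (γ.t γ.len) y u ↔ X.SamePoint (γ.flag 0) (γ.t 0) y u := by
  rcases γ.closed with h | h
  · rw [h.1, h.2]
  · rw [h.1, h.2, samePoint_τ₀_left]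

theorem samePoint_len_right (γ : X.Curve) (y : F) (u : ℝ) :
    X.SamePoint y u (γ.flag γ.len) (γ.t γ.len) ↔ X.SamePoint y u (γ.flag 0) (γ.t 0) := by
  rcases γ.closed with h | h
  · rw [h.1, h.2]
  · rw [h.1, h.2, samePoint_τ₀_right]

theorem Generic.not_samePoint {γ δ : X.Curve} (h : γ.Generic δ) {k l : ℕ} (hk : k ≤ γ.len)
    (hl : l ≤ δ.len) : ¬ X.SamePoint (γ.flag k) (γ.t k) (δ.flag l) (δ.t l) := by
  have h1 : ∀ l, l < δ.len → ∀ k, k ≤ γ.len →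
      ¬ X.SamePoint (γ.flag k) (γ.t k) (δ.flag l) (δ.t l) := by
    intro l hl k hk
    rcases hk.lt_or_eq with hk | rfl
    · exact h k l hk hl
    · rw [samePoint_len_left]; exact h 0 l γ.len_pos hl
  rcases hl.lt_or_eq with hl | rfl
  · exact h1 l hl k hk
  · rw [samePoint_len_right]; exact h1 0 δ.len_pos k hk

/-- The number of intersections of a curve with the walk along another curve is the intersection
number of the two curves. -/
theorem inter_eq {γ δ : X.Curve} (hγ : γ.TwoSided) (hδ : δ.TwoSided) (hg : γ.Generic δ) :
    γ.inter δ = (γ.sideWalk.map fun x => δ.chain (X.edge x)).sum := by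
  have hon : ∀ k, k < γ.len → ∀ l, l ≤ δ.len →
      iv (γ.OnSide k (δ.flag l) (δ.t l)) + iv (γ.OnSide k (X.τ₂ (δ.flag l)) (δ.t l)) =
      X.cornerCount (γ.chordCorners k) (δ.flag l) +
      X.cornerCount (γ.chordCorners k) (X.τ₂ (δ.flag l)) +
      (X.nearer (δ.flag l) (δ.t l) (γ.flag k) (γ.t k) +
        X.nearer (δ.flag l) (δ.t l) (X.τ₂ (γ.flag k)) (γ.t k)) +
      (X.nearer (δ.flag l) (δ.t l) (γ.flag (k + 1)) (γ.t (k + 1)) +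
        X.nearer (δ.flag l) (δ.t l) (X.τ₂ (γ.flag (k + 1))) (γ.t (k + 1))) := by
    intro k hk l hl
    have g1 := hg.not_samePoint hk.le hl
    have g2 := hg.not_samePoint (show k + 1 ≤ γ.len from hk) hl
    have h0 := δ.t_pos l hl
    have h1 := δ.t_lt l hl
    rw [γ.iv_onSide hk h0 h1 (apart_symm (apart_of_not_samePoint g1))
        (apart_symm (apart_of_not_samePoint (by rwa [samePoint_τ₂_left]))),
      γ.iv_onSide hk h0 h1 (apart_symm (apart_of_not_samePoint (by rwa [samePoint_τ₂_right])))
        (apart_symm (apart_of_not_samePoint (by rwa [samePoint_τ₂_right, samePoint_τ₂_left]))),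
      nearer_τ₂_τ₂, nearer_τ₂_left]
    ring
  have h1 : γ.inter δ = ∑ k ∈ Finset.range γ.len, ∑ l ∈ Finset.range δ.len,
      (iv (γ.OnSide k (δ.flag l) (δ.t l)) +
        iv (γ.OnSide k (X.τ₂ (δ.flag (l + 1))) (δ.t (l + 1)))) := by
    unfold inter
    refine Finset.sum_congr rfl fun k _ => Finset.sum_congr rfl fun l _ => ?_
    rw [← iv_xor, iv, ChordsCross]
  -- Shifting the exit points by one index, each crossing point of `δ` with an edge is tested from
  -- both faces at this edge.
  have h2 : ∀ k, ∑ l ∈ Finset.range δ.len, (iv (γ.OnSide k (δ.flag l) (δ.t l)) +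
      iv (γ.OnSide k (X.τ₂ (δ.flag (l + 1))) (δ.t (l + 1)))) =
      ∑ l ∈ Finset.range δ.len, (iv (γ.OnSide k (δ.flag l) (δ.t l)) +
        iv (γ.OnSide k (X.τ₂ (δ.flag l)) (δ.t l))) := by
    intro k
    rw [Finset.sum_add_distrib, Finset.sum_add_distrib,
      sum_range_shift fun l => iv (γ.OnSide k (X.τ₂ (δ.flag l)) (δ.t l)),
      show δ.flag δ.len = δ.flag 0 from hδ, hδ.t_len]
    linear_combination zmod2_add_self (iv (γ.OnSide k (X.τ₂ (δ.flag 0)) (δ.t 0)))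
  rw [h1, Finset.sum_congr rfl fun k _ => h2 k, Finset.sum_comm]
  -- The comparisons of positions on the edge occur at both ends of every chord of `γ` and cancel
  -- around `γ`. What is left are the cut-off corners on both sides of the half-edge, and by
  -- `cornerCount_add` these count how often the walk uses the edge.
  have h3 : ∀ l ∈ Finset.range δ.len, ∑ k ∈ Finset.range γ.len,
      (iv (γ.OnSide k (δ.flag l) (δ.t l)) + iv (γ.OnSide k (X.τ₂ (δ.flag l)) (δ.t l))) =
      (γ.sideWalk.map fun y => iv (X.edge y = X.edge (δ.flag l))).sum := by
    intro l hl
    have hl := (Finset.mem_range.1 hl).le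
    rw [Finset.sum_congr rfl fun k hk => hon k (Finset.mem_range.1 hk) l hl,
      ← (γ.isCornerSystem_twoSided hγ).cornerCount_add, cornerCount_cornerWalk,
      cornerCount_cornerWalk, Finset.sum_add_distrib,
      sum_range_shift fun k => X.nearer (δ.flag l) (δ.t l) (γ.flag k) (γ.t k) +
        X.nearer (δ.flag l) (δ.t l) (X.τ₂ (γ.flag k)) (γ.t k),
      show γ.flag γ.len = γ.flag 0 from hγ, hγ.t_len, Finset.sum_add_distrib,
      Finset.sum_add_distrib]
    linear_combination zmod2_add_self (∑ k ∈ Finset.range γ.len,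
      (X.nearer (δ.flag l) (δ.t l) (γ.flag k) (γ.t k) +
        X.nearer (δ.flag l) (δ.t l) (X.τ₂ (γ.flag k)) (γ.t k))) +
      zmod2_add_self (X.nearer (δ.flag l) (δ.t l) (γ.flag 0) (γ.t 0) +
        X.nearer (δ.flag l) (δ.t l) (X.τ₂ (γ.flag 0)) (γ.t 0))
  rw [Finset.sum_congr rfl h3]
  simp only [chain_eq_sum]
  generalize γ.sideWalk = W
  induction W with
  | nil => simp
  | cons y W ih =>
    simp only [List.map_cons, List.sum_cons, Finset.sum_add_distrib, ih]
    congr 1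
    exact Finset.sum_congr rfl fun l _ => iv_congr eq_comm

/-! ### The walk along a simple curve -/

section Value

variable {ω : X.Edge → ZMod 2} {o : X.LocalOrientation ω} {γ : X.Curve}

/-- The number of times that the flag `x` of sign `0` occurs among the corners cut off by the `k`-th
chord. -/
noncomputable def chordCount (γ : X.Curve) (k : ℕ) (x : F) : ZMod 2 :=
  ∑ i ∈ Finset.range (γ.r k + 1), iv ((X.next ^ i) (X.τ₁ (γ.flag k)) = x)

/-- All corners between the curve and its walk have sign `0`. -/
theorem sign_corners (h0 : o.sign (X.τ₁ (γ.flag 0)) = 0)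
    (hω : ∀ y ∈ γ.sideWalk, ω (X.edge y) = 0) {k : ℕ} (hk : k < γ.len) :
    ∀ i, i ≤ γ.r k → o.sign ((X.next ^ i) (X.τ₁ (γ.flag k))) = 0 := by
  have harc : ∀ k, k < γ.len → o.sign (X.τ₁ (γ.flag k)) = 0 →
      ∀ i, i ≤ γ.r k → o.sign ((X.next ^ i) (X.τ₁ (γ.flag k))) = 0 := by
    intro k hk hs i
    induction i with
    | zero => intro _; exact hs
    | succ i ih =>
      intro hi
      rw [o.sign_next_pow_succ, ih (by omega), hω, add_zero]
      simp only [sideWalk, List.mem_flatMap, List.mem_range, List.mem_map]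
      exact ⟨k, hk, i, by omega, rfl⟩
  have hst : ∀ k, k < γ.len → o.sign (X.τ₁ (γ.flag k)) = 0 := by
    intro k
    induction k with
    | zero => intro _; exact h0
    | succ k ih =>
      intro hk
      have h1 := harc k (by omega) (ih (by omega)) (γ.r k) le_rfl
      rw [γ.chord k (by omega), o.sign_τ₂] at h1
      rw [o.sign_τ₁, h1]
  exact harc k hk (hst k hk)

theorem sign_flag (h0 : o.sign (X.τ₁ (γ.flag 0)) = 0)
    (hω : ∀ y ∈ γ.sideWalk, ω (X.edge y) = 0) {k : ℕ} (hk : k ≤ γ.len) :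
    o.sign (γ.flag k) = 1 := by
  rcases Nat.eq_zero_or_pos k with rfl | hk0
  · rw [o.sign_τ₁] at h0
    linear_combination h0 - zmod2_two
  · obtain ⟨j, rfl⟩ : ∃ j, k = j + 1 := ⟨k - 1, by omega⟩
    have h1 := sign_corners h0 hω (show j < γ.len by omega) (γ.r j) le_rfl
    rw [γ.chord j (by omega), o.sign_τ₂] at h1
    linear_combination h1 - zmod2_two

theorem sign_chordCorners (h0 : o.sign (X.τ₁ (γ.flag 0)) = 0)
    (hω : ∀ y ∈ γ.sideWalk, ω (X.edge y) = 0) {y : F} (hy : y ∈ γ.cornerWalk) :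
    o.sign y = 0 := by
  simp only [cornerWalk, chordCorners, arcWalk, List.mem_flatMap, List.mem_range,
    List.mem_map] at hy
  obtain ⟨k, hk, i, hi, rfl⟩ := hy
  exact sign_corners h0 hω hk i (by omega)

theorem sign_sideWalk (h0 : o.sign (X.τ₁ (γ.flag 0)) = 0)
    (hω : ∀ y ∈ γ.sideWalk, ω (X.edge y) = 0) {y : F} (hy : y ∈ γ.sideWalk) :
    o.sign y = 0 := by
  simp only [sideWalk, List.mem_flatMap, List.mem_range, List.mem_map] at hy
  obtain ⟨k, hk, i, hi, rfl⟩ := hy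
  exact sign_corners h0 hω hk i (by omega)

theorem ne_of_sign {x y : F} (hx : o.sign x = 0) (hy : o.sign y = 1) : x ≠ y := by
  rintro rfl
  rw [hx] at hy
  exact absurd hy (by decide)

theorem cornerCount_eq_chordCount (h0 : o.sign (X.τ₁ (γ.flag 0)) = 0)
    (hω : ∀ y ∈ γ.sideWalk, ω (X.edge y) = 0) {k : ℕ} (hk : k < γ.len) {x : F}
    (hx : o.sign x = 0) : X.cornerCount (γ.chordCorners k) x = γ.chordCount k x := by
  rw [cornerCount_chordCorners, chordCount]
  refine Finset.sum_congr rfl fun i hi => ?_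
  have := sign_corners h0 hω hk i (by have := Finset.mem_range.1 hi; omega)
  rw [iv_false (p := _ = X.τ₁ x) (ne_of_sign this (by rw [o.sign_τ₁, hx]; rfl)), add_zero]

theorem cornerCount_τ₁ (Y : List F) (x : F) : X.cornerCount Y (X.τ₁ x) = X.cornerCount Y x := by
  unfold cornerCount
  congr 1
  refine List.map_congr_left fun y _ => iv_congr ?_
  rw [X.τ₁_invol]; tauto

theorem chordCount_eq_one {k : ℕ} (hk : k < γ.len) {i : ℕ} (hi : i ≤ γ.r k) :
    γ.chordCount k ((X.next ^ i) (X.τ₁ (γ.flag k))) = 1 := by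
  have hr := γ.r_lt hk
  rw [chordCount, Finset.sum_eq_single i]
  · exact iv_true rfl
  · intro j hj hne
    have := Finset.mem_range.1 hj
    exact iv_false fun h => hne (next_pow_inj (by omega) (by omega) h)
  · intro h
    exact absurd (Finset.mem_range.2 (by omega)) h

theorem chordCount_first {k : ℕ} (hk : k < γ.len) : γ.chordCount k (X.τ₁ (γ.flag k)) = 1 :=
  chordCount_eq_one hk (Nat.zero_le _)

theorem chordCount_last {k : ℕ} (hk : k < γ.len) :
    γ.chordCount k (X.τ₂ (γ.flag (k + 1))) = 1 := by
  rw [← γ.chord k hk]; exact chordCount_eq_one hk le_rfl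

/-- The contacts of the corners and sides cut off by two different chords. -/
theorem crossSum_contacts {k l : ℕ} (hk : k < γ.len) (hl : l < γ.len) :
    crossSum X.cornerContact (γ.chordCorners k) (γ.chordCorners l) +
      crossSum X.sideContact (γ.chordSides k) (γ.chordSides l) =
    (γ.chordCount l (X.τ₁ (γ.flag (k + 1))) + γ.chordCount l (X.τ₂ (γ.flag (k + 1)))) +
    ((γ.chordCount k (X.τ₂ (γ.flag l)) + iv (γ.flag (k + 1) = γ.flag l)) +
     (γ.chordCount k (X.τ₂ (γ.flag (l + 1))) + iv (γ.flag (k + 1) = γ.flag (l + 1)))) := by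
  simp only [chordCorners, chordSides, arcWalk]
  rw [crossSum_map_range, crossSum_map_range]
  set y : ℕ → F := fun i => (X.next ^ i) (X.τ₁ (γ.flag k)) with hy
  set z : ℕ → F := fun i => (X.next ^ i) (X.τ₁ (γ.flag l)) with hz
  have hyr : y (γ.r k) = X.τ₂ (γ.flag (k + 1)) := γ.chord k hk
  have hzr : z (γ.r l) = X.τ₂ (γ.flag (l + 1)) := γ.chord l hl
  change ∑ i ∈ Finset.range (γ.r k + 1), ∑ j ∈ Finset.range (γ.r l + 1),
      (iv (z j = y i) + iv (z j = X.τ₁ (X.τ₂ (y i)))) +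
    ∑ i ∈ Finset.range (γ.r k), ∑ j ∈ Finset.range (γ.r l),
      (iv (z j = y i) + iv (z j = X.τ₀ (X.τ₂ (y i)))) = _
  -- When the second arc runs back along the other side of an edge of the first, the contact of the
  -- corners at the head of `z j` is the same event as the contact of the sides. Hence contacts in
  -- the interior of the arcs cancel.
  have hstep : ∀ i j, iv (z (j + 1) = X.τ₁ (X.τ₂ (y i))) = iv (z j = X.τ₀ (X.τ₂ (y i))) := by
    intro i j
    simp only [hz]
    rw [next_pow_succ, iv_congr (next_eq_iff _ _)]
  have hz0 : ∀ i, iv (z 0 = X.τ₁ (X.τ₂ (y i))) = iv (y i = X.τ₂ (γ.flag l)) := by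
    intro i
    apply iv_congr
    change X.τ₁ (γ.flag l) = X.τ₁ (X.τ₂ (y i)) ↔ _
    rw [X.τ₁.injective.eq_iff, eq_comm, τ₂_eq_iff]
  have cl : ∀ x, γ.chordCount l x = ∑ j ∈ Finset.range (γ.r l), iv (z j = x) +
      iv (X.τ₂ (γ.flag (l + 1)) = x) := by
    intro x; rw [chordCount, Finset.sum_range_succ, ← hzr]
  have cl' : ∀ x, γ.chordCount l x = ∑ j ∈ Finset.range (γ.r l), iv (z (j + 1) = x) +
      iv (z 0 = x) := by
    intro x; rw [chordCount, Finset.sum_range_succ']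
  have ck : ∀ x, γ.chordCount k x = ∑ i ∈ Finset.range (γ.r k), iv (y i = x) +
      iv (X.τ₂ (γ.flag (k + 1)) = x) := by
    intro x; rw [chordCount, Finset.sum_range_succ, ← hyr]
  have hin : ∀ i, ∑ j ∈ Finset.range (γ.r l + 1),
      (iv (z j = y i) + iv (z j = X.τ₁ (X.τ₂ (y i)))) =
      γ.chordCount l (y i) + γ.chordCount l (X.τ₁ (X.τ₂ (y i))) := by
    intro i; rw [Finset.sum_add_distrib]; rfl
  rw [Finset.sum_congr rfl fun i _ => hin i, Finset.sum_range_succ, hyr, X.τ₂_invol]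
  have hA : ∑ i ∈ Finset.range (γ.r k),
      (γ.chordCount l (y i) + γ.chordCount l (X.τ₁ (X.τ₂ (y i)))) +
      ∑ i ∈ Finset.range (γ.r k), ∑ j ∈ Finset.range (γ.r l),
        (iv (z j = y i) + iv (z j = X.τ₀ (X.τ₂ (y i)))) =
      ∑ i ∈ Finset.range (γ.r k), iv (y i = X.τ₂ (γ.flag (l + 1))) +
      ∑ i ∈ Finset.range (γ.r k), iv (y i = X.τ₂ (γ.flag l)) := by
    rw [← Finset.sum_add_distrib, ← Finset.sum_add_distrib]
    refine Finset.sum_congr rfl fun i _ => ?_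
    rw [cl (y i), cl' (X.τ₁ (X.τ₂ (y i))), hz0, Finset.sum_add_distrib,
      iv_congr (eq_comm (b := y i) (a := X.τ₂ (γ.flag (l + 1))))]
    simp only [hstep]
    linear_combination zmod2_add_self (∑ j ∈ Finset.range (γ.r l), iv (z j = y i)) +
      zmod2_add_self (∑ j ∈ Finset.range (γ.r l), iv (z j = X.τ₀ (X.τ₂ (y i))))
  rw [ck, ck (X.τ₂ (γ.flag (l + 1))), X.τ₂.injective.eq_iff, X.τ₂.injective.eq_iff]
  linear_combination hA - zmod2_add_self (iv (γ.flag (k + 1) = γ.flag l)) -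
    zmod2_add_self (iv (γ.flag (k + 1) = γ.flag (l + 1)))

/-- The contacts of the corners and sides cut off by one chord. -/
theorem pairSum_contacts {k : ℕ} (hk : k < γ.len) :
    pairSum X.cornerContact (γ.chordCorners k) + pairSum X.sideContact (γ.chordSides k) = 0 := by
  have hr := γ.r_lt hk
  simp only [chordCorners, chordSides, arcWalk]
  rw [pairSum_map_range, pairSum_map_range]
  set y : ℕ → F := fun i => (X.next ^ i) (X.τ₁ (γ.flag k)) with hy
  change ∑ j ∈ Finset.range (γ.r k + 1), ∑ i ∈ Finset.range j,
      (iv (y j = y i) + iv (y j = X.τ₁ (X.τ₂ (y i)))) +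
    ∑ j ∈ Finset.range (γ.r k), ∑ i ∈ Finset.range j,
      (iv (y j = y i) + iv (y j = X.τ₀ (X.τ₂ (y i)))) = 0
  have hne : ∀ i j, i < j → j ≤ γ.r k → iv (y j = y i) = 0 := by
    intro i j hij hj
    refine iv_false fun h => ?_
    have := next_pow_inj (X := X) (x := X.τ₁ (γ.flag k)) (by omega) (by omega) h
    omega
  have h1 : ∑ j ∈ Finset.range (γ.r k + 1), ∑ i ∈ Finset.range j,
      (iv (y j = y i) + iv (y j = X.τ₁ (X.τ₂ (y i)))) =
      ∑ j ∈ Finset.range (γ.r k), ∑ i ∈ Finset.range j, iv (y j = X.τ₀ (X.τ₂ (y i))) := by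
    have : ∀ j ∈ Finset.range (γ.r k + 1), ∑ i ∈ Finset.range j,
        (iv (y j = y i) + iv (y j = X.τ₁ (X.τ₂ (y i)))) =
        ∑ i ∈ Finset.range j, iv (y j = X.τ₁ (X.τ₂ (y i))) := by
      intro j hj
      refine Finset.sum_congr rfl fun i hi => ?_
      have hj := Finset.mem_range.1 hj
      rw [hne i j (Finset.mem_range.1 hi) (by omega), zero_add]
    rw [Finset.sum_congr rfl this, Finset.sum_range_succ']
    simp only [Finset.range_zero, Finset.sum_empty, add_zero]
    refine Finset.sum_congr rfl fun j _ => ?_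
    have hstep : ∀ i, iv (y (j + 1) = X.τ₁ (X.τ₂ (y i))) = iv (y j = X.τ₀ (X.τ₂ (y i))) := by
      intro i
      simp only [hy]
      rw [next_pow_succ, iv_congr (next_eq_iff _ _)]
    simp only [hstep]
    rw [Finset.sum_range_succ, iv_false fun h => X.τ₀τ₂_ne (y j) h.symm, add_zero]
  have h2 : ∑ j ∈ Finset.range (γ.r k), ∑ i ∈ Finset.range j,
      (iv (y j = y i) + iv (y j = X.τ₀ (X.τ₂ (y i)))) =
      ∑ j ∈ Finset.range (γ.r k), ∑ i ∈ Finset.range j, iv (y j = X.τ₀ (X.τ₂ (y i))) := by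
    refine Finset.sum_congr rfl fun j hj => Finset.sum_congr rfl fun i hi => ?_
    have hj := Finset.mem_range.1 hj
    rw [hne i j (Finset.mem_range.1 hi) (by omega), zero_add]
  rw [h1, h2, zmod2_add_self]

/-- The total number of contacts, in terms of ends of chords. -/
theorem contacts_eq : pairSum X.cornerContact γ.cornerWalk + pairSum X.sideContact γ.sideWalk =
    ∑ k ∈ Finset.range γ.len,
      (γ.chordCount k (X.τ₂ (γ.flag γ.len)) + iv (γ.flag (k + 1) = γ.flag γ.len)) + γ.len +
    ∑ l ∈ Finset.range γ.len, γ.chordCount l (X.τ₁ (γ.flag 0)) +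
    ∑ l ∈ Finset.range γ.len, ∑ k ∈ Finset.range l,
      (γ.chordCount l (X.τ₁ (γ.flag k)) + γ.chordCount l (X.τ₂ (γ.flag (k + 1)))) := by
  -- The terms telescope in the second index. The new diagonal term is the last corner of a chord,
  -- counted once, plus a true indicator, so it is `1 + 1`.
  have hA : ∀ m, m ≤ γ.len → ∑ l ∈ Finset.range m, ∑ k ∈ Finset.range l,
      ((γ.chordCount k (X.τ₂ (γ.flag l)) + iv (γ.flag (k + 1) = γ.flag l)) +
       (γ.chordCount k (X.τ₂ (γ.flag (l + 1))) + iv (γ.flag (k + 1) = γ.flag (l + 1)))) =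
      ∑ k ∈ Finset.range m,
        (γ.chordCount k (X.τ₂ (γ.flag m)) + iv (γ.flag (k + 1) = γ.flag m)) := by
    intro m
    induction m with
    | zero => intro _; simp
    | succ m ih =>
      intro hm
      rw [Finset.sum_range_succ, ih (by omega), Finset.sum_range_succ _ m,
        chordCount_last (by omega), iv_true rfl, Finset.sum_add_distrib (s := Finset.range m)
          (f := fun k => γ.chordCount k (X.τ₂ (γ.flag m)) + iv (γ.flag (k + 1) = γ.flag m))]
      linear_combination zmod2_add_self (∑ k ∈ Finset.range m,
        (γ.chordCount k (X.τ₂ (γ.flag m)) + iv (γ.flag (k + 1) = γ.flag m))) - zmod2_two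
  have hB : ∀ l ∈ Finset.range γ.len, ∑ k ∈ Finset.range l,
      (γ.chordCount l (X.τ₁ (γ.flag (k + 1))) + γ.chordCount l (X.τ₂ (γ.flag (k + 1)))) =
      ∑ k ∈ Finset.range l,
        (γ.chordCount l (X.τ₁ (γ.flag k)) + γ.chordCount l (X.τ₂ (γ.flag (k + 1)))) +
      γ.chordCount l (X.τ₁ (γ.flag 0)) + 1 := by
    intro l hl
    rw [Finset.sum_add_distrib, sum_range_shift fun k => γ.chordCount l (X.τ₁ (γ.flag k)),
      chordCount_first (Finset.mem_range.1 hl), Finset.sum_add_distrib]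
    ring
  rw [sideWalk_eq, cornerWalk, pairSum_flatMap_range, pairSum_flatMap_range]
  have h1 : ∑ k ∈ Finset.range γ.len, pairSum X.cornerContact (γ.chordCorners k) +
      ∑ k ∈ Finset.range γ.len, pairSum X.sideContact (γ.chordSides k) = 0 := by
    rw [← Finset.sum_add_distrib]
    exact Finset.sum_eq_zero fun k hk => pairSum_contacts (Finset.mem_range.1 hk)
  have h2 : ∑ l ∈ Finset.range γ.len, ∑ k ∈ Finset.range l,
        crossSum X.cornerContact (γ.chordCorners k) (γ.chordCorners l) +
      ∑ l ∈ Finset.range γ.len, ∑ k ∈ Finset.range l,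
        crossSum X.sideContact (γ.chordSides k) (γ.chordSides l) =
      ∑ l ∈ Finset.range γ.len, ∑ k ∈ Finset.range l,
        (γ.chordCount l (X.τ₁ (γ.flag (k + 1))) + γ.chordCount l (X.τ₂ (γ.flag (k + 1)))) +
      ∑ l ∈ Finset.range γ.len, ∑ k ∈ Finset.range l,
      ((γ.chordCount k (X.τ₂ (γ.flag l)) + iv (γ.flag (k + 1) = γ.flag l)) +
       (γ.chordCount k (X.τ₂ (γ.flag (l + 1))) + iv (γ.flag (k + 1) = γ.flag (l + 1)))) := by
    rw [← Finset.sum_add_distrib, ← Finset.sum_add_distrib]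
    refine Finset.sum_congr rfl fun l hl => ?_
    rw [← Finset.sum_add_distrib, ← Finset.sum_add_distrib]
    refine Finset.sum_congr rfl fun k hk => ?_
    have hl := Finset.mem_range.1 hl
    have hk := Finset.mem_range.1 hk
    exact crossSum_contacts (by omega) hl
  have h3 : ∑ l ∈ Finset.range γ.len, (1 : ZMod 2) = γ.len := by simp
  rw [hA γ.len le_rfl, Finset.sum_congr rfl hB, Finset.sum_add_distrib, Finset.sum_add_distrib,
    h3] at h2
  linear_combination h1 + h2

end Value

end Curve

end CellSurface

/-- Terms telescope along the diagonals of the triangle `k < l`, leaving its border. For `A`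
comparing the positions of crossings `k` and `l`, this reduces all comparisons to those with the
starting point and the end point. -/
theorem sum_pairs_diagonal_shift (A : ℕ → ℕ → ZMod 2) (h0 : A 0 0 = 0) (m : ℕ) :
    ∑ l ∈ Finset.range m, ∑ k ∈ Finset.range l, (A k l + A (k + 1) (l + 1)) =
      ∑ l ∈ Finset.range m, A 0 l + ∑ k ∈ Finset.range m, A k m + A 0 m := by
  induction m with
  | zero => simp [h0]
  | succ m ih =>
    rw [Finset.sum_range_succ, ih, Finset.sum_add_distrib,
      sum_range_shift (fun k => A k (m + 1)), Finset.sum_range_succ _ m, Finset.sum_range_succ _ m]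
    linear_combination zmod2_add_self (∑ k ∈ Finset.range m, A k m)

theorem sum_pairs_antidiagonal_shift (B : ℕ → ℕ → ZMod 2) {n : ℕ} (h0 : ∀ k, B k k = 0)
    (h1 : ∀ k, k < n → B k (k + 1) = 0) (m : ℕ) (hm : m ≤ n) :
    ∑ l ∈ Finset.range m, ∑ k ∈ Finset.range l, (B k (l + 1) + B (k + 1) l) =
      ∑ l ∈ Finset.range m, B 0 l + ∑ k ∈ Finset.range m, B k m := by
  induction m with
  | zero => simp
  | succ m ih =>
    rw [Finset.sum_range_succ, ih (by omega), Finset.sum_add_distrib,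
      sum_range_shift (fun k => B k m), Finset.sum_range_succ _ m, Finset.sum_range_succ _ m, h0,
      h1 m (by omega)]
    linear_combination zmod2_add_self (∑ k ∈ Finset.range m, B k m)

/-! ### Contacts of the walk along a simple curve, using that its chords do not cross. -/

namespace CellSurface

variable {F : Type*} [Fintype F] {X : CellSurface F}

theorem nearer_self_τ₂ (x : F) (t u : ℝ) : X.nearer x t (X.τ₂ x) u = 0 := by
  rw [nearer, iv_false fun h => X.τ₂_ne x h.1, iv_false, add_zero]
  rintro ⟨h, -⟩
  exact X.τ₀τ₂_ne x (by rw [h, X.τ₀_invol])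

theorem nearer_of_edge_ne {x y : F} (h : X.edge x ≠ X.edge y) (t u : ℝ) : X.nearer x t y u = 0 := by
  rw [nearer, iv_false, iv_false, add_zero]
  · rintro ⟨rfl, -⟩
    exact h (edge_τ₀ X x).symm
  · rintro ⟨rfl, -⟩
    exact h rfl

theorem nearer_self (x : F) (t : ℝ) : X.nearer x t x t = 0 := by
  rw [nearer, iv_false fun h => lt_irrefl _ h.2, iv_false fun h => X.τ₀_ne x h.1.symm, add_zero]

/-- For equal flags with different positions exactly one of the two points is nearer to the vertex.
For opposite flags the condition is symmetric in the two points and cancels. -/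
theorem nearer_add_comm {x y : F} {t u : ℝ} (h : y = x → u ≠ t) :
    X.nearer x t y u + X.nearer y u x t = iv (y = x) := by
  have h1 : iv (y = X.τ₀ x ∧ 1 - u < t) = iv (x = X.τ₀ y ∧ 1 - t < u) := by
    apply iv_congr
    rw [eq_comm (a := y), τ₀_eq_iff]
    exact and_congr_right fun _ => ⟨fun h => by linarith, fun h => by linarith⟩
  have h2 : iv (y = x) = iv (y = x ∧ u < t) + iv (x = y ∧ t < u) := by
    rw [← iv_or]
    · apply iv_congr
      constructor
      · intro e
        rcases (h e).lt_or_gt with h' | h'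
        · exact Or.inl ⟨e, h'⟩
        · exact Or.inr ⟨e.symm, h'⟩
      · rintro (h | h)
        · exact h.1
        · exact h.1.symm
    · rintro ⟨h, h'⟩
      exact lt_asymm h.2 h'.2
  rw [nearer, nearer, h1, h2]
  linear_combination zmod2_add_self (iv (x = X.τ₀ y ∧ 1 - t < u))

namespace Curve

variable {γ : X.Curve}

theorem IsSimple.not_samePoint (hs : γ.IsSimple) {i j : ℕ} (hij : i < j) (hj : j ≤ γ.len)
    (h0 : i ≠ 0 ∨ j ≠ γ.len) : ¬ X.SamePoint (γ.flag i) (γ.t i) (γ.flag j) (γ.t j) := by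
  rcases hj.lt_or_eq with hj | rfl
  · exact hs.1 i j hij hj
  · have hi : 0 < i := Nat.pos_of_ne_zero (h0.resolve_right (by simp))
    rw [samePoint_len_right]
    intro h
    refine hs.1 0 i hi hij ?_
    rcases h with ⟨h | h, h'⟩ | ⟨h | h, h'⟩
    · exact Or.inl ⟨Or.inl h.symm, h'.symm⟩
    · exact Or.inl ⟨Or.inr (by rw [h, X.τ₂_invol]), h'.symm⟩
    · exact Or.inr ⟨Or.inl (by rw [h, X.τ₀_invol]), by rw [h']; ring⟩
    · exact Or.inr ⟨Or.inr (by rw [h, ← X.comm, X.τ₀_invol, X.τ₂_invol]), by rw [h']; ring⟩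

theorem apart_τ₂ (x : F) (t u : ℝ) : X.Apart x t (X.τ₂ x) u := by
  refine ⟨fun h => X.τ₂_ne x h.1, fun h => X.τ₀τ₂_ne x ?_⟩
  rw [h.1, X.τ₀_invol]

theorem apart_flag_τ₂_len (t u : ℝ) : X.Apart (γ.flag 0) t (X.τ₂ (γ.flag γ.len)) u := by
  rcases γ.flag_len with h | h
  · rw [h]; exact apart_τ₂ _ _ _
  · rw [h]
    refine ⟨fun h => X.τ₀τ₂_ne (γ.flag 0) ?_, fun h => X.τ₂_ne _ h.1⟩
    rw [X.comm, h.1]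

section Value

variable {ω : X.Edge → ZMod 2} {o : X.LocalOrientation ω}

/-- Two chords of a simple curve do not cross. -/
theorem chordCount_add (h0 : o.sign (X.τ₁ (γ.flag 0)) = 0)
    (hω : ∀ y ∈ γ.sideWalk, ω (X.edge y) = 0) (hs : γ.IsSimple) {k l : ℕ} (hkl : k < l)
    (hl : l < γ.len) :
    γ.chordCount l (X.τ₁ (γ.flag k)) + γ.chordCount l (X.τ₂ (γ.flag (k + 1))) =
      (X.nearer (γ.flag k) (γ.t k) (γ.flag l) (γ.t l) +
        X.nearer (γ.flag (k + 1)) (γ.t (k + 1)) (γ.flag (l + 1)) (γ.t (l + 1))) +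
      (X.nearer (γ.flag k) (γ.t k) (X.τ₂ (γ.flag (l + 1))) (γ.t (l + 1)) +
        X.nearer (γ.flag (k + 1)) (γ.t (k + 1)) (X.τ₂ (γ.flag l)) (γ.t l)) := by
  have hc := hs.2 l k hl (by omega)
  have hx := iv_false hc
  rw [ChordsCross, iv_xor] at hx
  have a1 : X.Apart (γ.flag k) (γ.t k) (γ.flag l) (γ.t l) :=
    apart_of_not_samePoint (hs.not_samePoint hkl hl.le (Or.inr (by omega)))
  have a2 : X.Apart (γ.flag k) (γ.t k) (X.τ₂ (γ.flag (l + 1))) (γ.t (l + 1)) := by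
    by_cases h : k ≠ 0 ∨ l + 1 ≠ γ.len
    · apply apart_of_not_samePoint
      rw [samePoint_τ₂_right]
      exact hs.not_samePoint (by omega) (by omega) h
    · push Not at h
      rw [h.1, h.2]; exact apart_flag_τ₂_len _ _
  have a3 : X.Apart (X.τ₂ (γ.flag (k + 1))) (γ.t (k + 1)) (γ.flag l) (γ.t l) := by
    by_cases h : k + 1 < l
    · apply apart_of_not_samePoint
      rw [samePoint_τ₂_left]
      exact hs.not_samePoint h (by omega) (Or.inl (by omega))
    · obtain rfl : k + 1 = l := by omega
      exact apart_symm (apart_τ₂ _ _ _)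
  have a4 : X.Apart (X.τ₂ (γ.flag (k + 1))) (γ.t (k + 1)) (X.τ₂ (γ.flag (l + 1)))
      (γ.t (l + 1)) := by
    apply apart_of_not_samePoint
    rw [samePoint_τ₂_left, samePoint_τ₂_right]
    exact hs.not_samePoint (by omega) (by omega) (Or.inl (by omega))
  rw [γ.iv_onSide hl (γ.t_pos k (by omega)) (γ.t_lt k (by omega)) a1 a2,
    γ.iv_onSide hl (γ.t_pos (k + 1) (by omega)) (γ.t_lt (k + 1) (by omega)) a3 a4,
    ← cornerCount_τ₁, cornerCount_eq_chordCount h0 hω hl (by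
      rw [o.sign_τ₁, sign_flag h0 hω (by omega)]; rfl),
    cornerCount_eq_chordCount h0 hω hl (by
      rw [o.sign_τ₂, sign_flag h0 hω (by omega)]; rfl), nearer_τ₂_τ₂, nearer_τ₂_left] at hx
  rw [← zmod2_add_eq_zero]
  linear_combination hx

/-- Within one polygon the exit can share the side of the entry only with the opposite direction,
when the arc runs all the way around. Then `chord_lt` says that the exit is not nearer. -/
theorem nearer_succ {k : ℕ} (hk : k < γ.len) :
    X.nearer (γ.flag k) (γ.t k) (X.τ₂ (γ.flag (k + 1))) (γ.t (k + 1)) = 0 := by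
  rw [nearer, iv_false, iv_false, add_zero]
  · rintro ⟨h, ht⟩
    rw [← γ.chord k hk] at h
    have h1 : (X.next ^ (γ.r k + 1)) (X.τ₁ (γ.flag k)) = X.τ₁ (γ.flag k) := by
      rw [next_pow_succ, h, X.τ₀_invol]
    have h2 : X.sides (X.τ₁ (γ.flag k)) ∣ γ.r k + 1 :=
      Function.IsPeriodicPt.minimalPeriod_dvd (by
        rw [Function.IsPeriodicPt, Function.IsFixedPt, ← Equiv.Perm.coe_pow]; exact h1)
    have h3 := γ.r_lt hk
    have h4 : γ.r k + 1 = X.sides (X.τ₁ (γ.flag k)) :=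
      le_antisymm h3 (Nat.le_of_dvd (by omega) h2)
    have h5 := γ.chord_lt k hk
    rw [← sides_τ₁, ← h4] at h5
    push_cast at h5
    linarith
  · rintro ⟨h, -⟩
    rw [← γ.chord k hk] at h
    apply next_pow_ne_τ₁ (γ.r k) (X.τ₁ (γ.flag k))
    rw [h, X.τ₁_invol]

/-- The sum of all chord counts reduces to the starting point of the curve. -/
theorem sum_chordCount (h0 : o.sign (X.τ₁ (γ.flag 0)) = 0)
    (hω : ∀ y ∈ γ.sideWalk, ω (X.edge y) = 0) (hs : γ.IsSimple) :
    ∑ l ∈ Finset.range γ.len, ∑ k ∈ Finset.range l,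
      (γ.chordCount l (X.τ₁ (γ.flag k)) + γ.chordCount l (X.τ₂ (γ.flag (k + 1)))) =
    (∑ l ∈ Finset.range γ.len, X.nearer (γ.flag 0) (γ.t 0) (γ.flag l) (γ.t l) +
      ∑ k ∈ Finset.range γ.len,
        X.nearer (γ.flag k) (γ.t k) (γ.flag γ.len) (γ.t γ.len) +
      X.nearer (γ.flag 0) (γ.t 0) (γ.flag γ.len) (γ.t γ.len)) +
    (∑ l ∈ Finset.range γ.len, X.nearer (γ.flag 0) (γ.t 0) (X.τ₂ (γ.flag l)) (γ.t l) +
      ∑ k ∈ Finset.range γ.len,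
        X.nearer (γ.flag k) (γ.t k) (X.τ₂ (γ.flag γ.len)) (γ.t γ.len)) := by
  rw [← sum_pairs_diagonal_shift
      (fun k l => X.nearer (γ.flag k) (γ.t k) (γ.flag l) (γ.t l)) (nearer_self _ _),
    ← sum_pairs_antidiagonal_shift
      (fun k l => X.nearer (γ.flag k) (γ.t k) (X.τ₂ (γ.flag l)) (γ.t l)) (n := γ.len)
      (fun k => nearer_self_τ₂ _ _ _) (fun k hk => nearer_succ hk) _ le_rfl,
    ← Finset.sum_add_distrib]
  refine Finset.sum_congr rfl fun l hl => ?_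
  rw [← Finset.sum_add_distrib]
  refine Finset.sum_congr rfl fun k hk => ?_
  exact chordCount_add h0 hω hs (Finset.mem_range.1 hk) (Finset.mem_range.1 hl)

theorem sum_chordCount_first (h0 : o.sign (X.τ₁ (γ.flag 0)) = 0)
    (hω : ∀ y ∈ γ.sideWalk, ω (X.edge y) = 0) :
    ∑ l ∈ Finset.range γ.len, γ.chordCount l (X.τ₁ (γ.flag 0)) =
      X.cornerCount γ.cornerWalk (γ.flag 0) := by
  rw [cornerCount_cornerWalk]
  refine Finset.sum_congr rfl fun l hl => ?_
  rw [← cornerCount_τ₁, cornerCount_eq_chordCount h0 hω (Finset.mem_range.1 hl) h0]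

theorem sum_chordCount_last (h0 : o.sign (X.τ₁ (γ.flag 0)) = 0)
    (hω : ∀ y ∈ γ.sideWalk, ω (X.edge y) = 0) :
    ∑ l ∈ Finset.range γ.len, γ.chordCount l (X.τ₂ (γ.flag γ.len)) =
      X.cornerCount γ.cornerWalk (X.τ₂ (γ.flag γ.len)) := by
  rw [cornerCount_cornerWalk]
  refine Finset.sum_congr rfl fun l hl => ?_
  rw [cornerCount_eq_chordCount h0 hω (Finset.mem_range.1 hl)]
  rw [o.sign_τ₂, sign_flag h0 hω le_rfl]; rfl

/-- Comparisons of the starting point with the later crossings occur in both directions. They add up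
to the indicator that the flags coincide, which `contacts_eq` contains as well. The surviving
passages along the starting edge match the cost of rotating the list of half-edges in
`quadratic_twoSided`. -/
theorem contacts_twoSided (h0 : o.sign (X.τ₁ (γ.flag 0)) = 0)
    (hω : ∀ y ∈ γ.sideWalk, ω (X.edge y) = 0) (hs : γ.IsSimple) (h2 : γ.TwoSided) :
    pairSum X.cornerContact γ.cornerWalk + pairSum X.sideContact γ.sideWalk =
      (γ.sideWalk.map fun y => iv (X.edge y = X.edge (γ.flag 0))).sum + γ.len + 1 := by
  have hf : γ.flag γ.len = γ.flag 0 := h2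
  rw [contacts_eq, sum_chordCount_first h0 hω, sum_chordCount h0 hω hs, Finset.sum_add_distrib,
    sum_chordCount_last h0 hω, ← (γ.isCornerSystem_twoSided h2).cornerCount_add, hf, h2.t_len,
    sum_range_shift (fun k => iv (γ.flag k = γ.flag 0)), nearer_self, hf]
  obtain ⟨m, hm⟩ : ∃ m, γ.len = m + 1 := ⟨γ.len - 1, by have := γ.len_pos; omega⟩
  have hA : ∀ l ∈ Finset.range m, X.nearer (γ.flag 0) (γ.t 0) (γ.flag (l + 1)) (γ.t (l + 1)) +
      X.nearer (γ.flag (l + 1)) (γ.t (l + 1)) (γ.flag 0) (γ.t 0) =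
      iv (γ.flag (l + 1) = γ.flag 0) := by
    intro l hl
    have hl := Finset.mem_range.1 hl
    apply nearer_add_comm
    intro he ht
    exact hs.1 0 (l + 1) (by omega) (by omega) (Or.inl ⟨Or.inl he, ht⟩)
  -- All flags of the curve have sign 1, so `τ₂` of one of them is never another one.
  have hB : ∀ l ∈ Finset.range γ.len,
      X.nearer (γ.flag 0) (γ.t 0) (X.τ₂ (γ.flag l)) (γ.t l) +
      X.nearer (γ.flag l) (γ.t l) (X.τ₂ (γ.flag 0)) (γ.t 0) = 0 := by
    intro l hl
    have hl := Finset.mem_range.1 hl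
    have hne : X.τ₂ (γ.flag l) ≠ γ.flag 0 :=
      ne_of_sign (o := o) (by rw [o.sign_τ₂, sign_flag h0 hω hl.le]; rfl)
        (sign_flag h0 hω (Nat.zero_le _))
    rw [← nearer_τ₂_left (X := X) (γ.flag l), nearer_add_comm fun h => absurd h hne,
      iv_false hne]
  have hAs := Finset.sum_congr rfl hA
  have hBs := Finset.sum_eq_zero hB
  rw [Finset.sum_add_distrib] at hAs hBs
  have e : ∀ f : ℕ → ZMod 2, ∑ l ∈ Finset.range γ.len, f l =
      ∑ l ∈ Finset.range m, f (l + 1) + f 0 := by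
    intro f; rw [hm, Finset.sum_range_succ']
  rw [e fun l => X.nearer (γ.flag 0) (γ.t 0) (γ.flag l) (γ.t l),
    e fun l => X.nearer (γ.flag l) (γ.t l) (γ.flag 0) (γ.t 0), e fun l => iv (γ.flag l = γ.flag 0),
    nearer_self, iv_true rfl]
  linear_combination hAs + hBs + zmod2_two +
    zmod2_add_self (∑ l ∈ Finset.range m, iv (γ.flag (l + 1) = γ.flag 0))

theorem edge_flag_ne (h : γ.crossings (X.edge (γ.flag 0)) = 1) {k : ℕ} (h0 : 0 < k)
    (hk : k < γ.len) : X.edge (γ.flag 0) ≠ X.edge (γ.flag k) := by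
  intro he
  obtain ⟨a, ha⟩ := Finset.card_eq_one.1 h
  have m0 : 0 ∈ ({a} : Finset ℕ) := by
    rw [← ha]; simp [γ.len_pos]
  have mk : k ∈ ({a} : Finset ℕ) := by
    rw [← ha]; simp [hk, he]
  rw [Finset.mem_singleton] at m0 mk
  omega

/-- The starting edge is crossed only once and is not used by `sideWalk`. So every comparison of
positions involves different edges, except at index 0, where it vanishes by inspection. -/
theorem contacts_oneSided (h0 : o.sign (X.τ₁ (γ.flag 0)) = 0)
    (hω : ∀ y ∈ γ.sideWalk, ω (X.edge y) = 0) (hs : γ.IsSimple) (h1 : γ.OneSided)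
    (ho : γ.crossings (X.edge (γ.flag 0)) = 1)
    (he : ∀ y ∈ γ.sideWalk, X.edge y ≠ X.edge (γ.flag 0)) :
    pairSum X.cornerContact γ.cornerWalk + pairSum X.sideContact γ.sideWalk = γ.len + 1 := by
  have hf : γ.flag γ.len = X.τ₀ (γ.flag 0) := h1
  have hne : ∀ k, 0 < k → k < γ.len → X.edge (γ.flag 0) ≠ X.edge (γ.flag k) :=
    fun k h0 hk => edge_flag_ne ho h0 hk
  have hs1 := (γ.isCornerSystem_oneSided h1).cornerCount_add (γ.flag 0)
  have hs2 := (γ.isCornerSystem_oneSided h1).side (X.τ₂ (γ.flag 0))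
  have hz : (γ.sideWalk.map fun y => iv (X.edge y = X.edge (γ.flag 0))).sum = 0 := by
    refine List.sum_eq_zero fun a ha => ?_
    obtain ⟨y, hy, rfl⟩ := List.mem_map.1 ha
    exact iv_false (he y hy)
  rw [oneSidedWalk, List.map_append, List.sum_append, hz, List.map_singleton, List.sum_singleton,
    edge_τ₀, iv_true rfl] at hs1
  rw [edge_τ₂, chain, ho, X.comm, Nat.cast_one] at hs2
  rw [contacts_eq, sum_chordCount_first h0 hω, sum_chordCount h0 hω hs, Finset.sum_add_distrib,
    sum_chordCount_last h0 hω, hf, h1.t_len]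
  have z1 : ∑ l ∈ Finset.range γ.len, X.nearer (γ.flag 0) (γ.t 0) (γ.flag l) (γ.t l) = 0 := by
    refine Finset.sum_eq_zero fun l hl => ?_
    rcases Nat.eq_zero_or_pos l with rfl | h
    · exact nearer_self _ _
    · exact nearer_of_edge_ne (hne l h (Finset.mem_range.1 hl)) _ _
  have z2 : X.nearer (γ.flag 0) (γ.t 0) (X.τ₀ (γ.flag 0)) (1 - γ.t 0) = 0 := by
    rw [nearer, iv_false fun h => X.τ₀_ne _ h.1, iv_false, add_zero]
    rintro ⟨-, h⟩; linarith
  have z3 : ∑ k ∈ Finset.range γ.len,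
      X.nearer (γ.flag k) (γ.t k) (X.τ₀ (γ.flag 0)) (1 - γ.t 0) = 0 := by
    refine Finset.sum_eq_zero fun l hl => ?_
    rcases Nat.eq_zero_or_pos l with rfl | h
    · exact z2
    · exact nearer_of_edge_ne
        (by rw [edge_τ₀]; exact (hne l h (Finset.mem_range.1 hl)).symm) _ _
  have z4 : ∑ l ∈ Finset.range γ.len,
      X.nearer (γ.flag 0) (γ.t 0) (X.τ₂ (γ.flag l)) (γ.t l) = 0 := by
    refine Finset.sum_eq_zero fun l hl => ?_
    rcases Nat.eq_zero_or_pos l with rfl | h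
    · exact nearer_self_τ₂ _ _ _
    · exact nearer_of_edge_ne (by rw [edge_τ₂]; exact hne l h (Finset.mem_range.1 hl)) _ _
  have z5 : ∑ k ∈ Finset.range γ.len,
      X.nearer (γ.flag k) (γ.t k) (X.τ₂ (X.τ₀ (γ.flag 0))) (1 - γ.t 0) = 0 := by
    refine Finset.sum_eq_zero fun l hl => ?_
    rcases Nat.eq_zero_or_pos l with rfl | h
    · rw [nearer, iv_false fun h => X.τ₀τ₂_ne (γ.flag 0) (by rw [X.comm, h.1]),
        iv_false fun h => X.τ₂_ne _ h.1, add_zero]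
    · exact nearer_of_edge_ne
        (by rw [edge_τ₂, edge_τ₀]; exact (hne l h (Finset.mem_range.1 hl)).symm) _ _
  have z6 : ∑ k ∈ Finset.range γ.len, iv (γ.flag (k + 1) = X.τ₀ (γ.flag 0)) = 1 := by
    obtain ⟨m, hm⟩ : ∃ m, γ.len = m + 1 := ⟨γ.len - 1, by have := γ.len_pos; omega⟩
    rw [hm, Finset.sum_range_succ, ← hm, iv_true hf, Finset.sum_eq_zero, zero_add]
    intro k hk
    have hk := Finset.mem_range.1 hk
    refine iv_false fun h => hne (k + 1) (by omega) (by omega) ?_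
    rw [h, edge_τ₀]
  rw [z1, z2, z3, z4, z5, z6]
  linear_combination hs1 + hs2 - zmod2_add_self (X.cornerCount γ.cornerWalk (X.τ₂ (γ.flag 0))) +
    zmod2_two

/-! ### The quadratic function on the walks along simple curves. -/

variable {n : ℕ} {num : X.Vertex ≃ Fin n} (H : HalfEdgeOrder X o num)

/-- The passes at the corners between a curve and its walk, compared with the half-edges of the
walk. -/
theorem pairSum_passes_cornerWalk : pairSum H.lt (HalfEdgeOrder.passes X γ.cornerWalk) =
    pairSum H.lt ([γ.flag 0] ++ HalfEdgeOrder.halves X γ.sideWalk ++ [γ.flag γ.len]) := by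
  -- Induction on the number of chords: the half-edge of a crossing ends one chord and begins the
  -- next, and its two copies cancel. The second statement, on sums of `τ₂`-invariant functions,
  -- allows the lists to be exchanged in the cross terms with a new chord.
  have key : ∀ m, m ≤ γ.len →
      pairSum H.lt (HalfEdgeOrder.passes X ((List.range m).flatMap γ.chordCorners)) =
        pairSum H.lt ([γ.flag 0] ++
          HalfEdgeOrder.halves X ((List.range m).flatMap γ.chordSides) ++ [γ.flag m]) ∧
      ∀ φ : F → ZMod 2, (∀ x, φ (X.τ₂ x) = φ x) →
        ((HalfEdgeOrder.passes X ((List.range m).flatMap γ.chordCorners)).map φ).sum =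
        (([γ.flag 0] ++
          HalfEdgeOrder.halves X ((List.range m).flatMap γ.chordSides) ++ [γ.flag m]).map φ).sum := by
    intro m
    induction m with
    | zero =>
      intro _
      simp [HalfEdgeOrder.passes, HalfEdgeOrder.halves, pairSum, H.lt_self, zmod2_add_self]
    | succ m ih =>
      intro hm
      obtain ⟨ih1, ih2⟩ := ih (by omega)
      have hp : HalfEdgeOrder.passes X ((List.range (m + 1)).flatMap γ.chordCorners) =
          HalfEdgeOrder.passes X ((List.range m).flatMap γ.chordCorners) ++
          HalfEdgeOrder.passes X (γ.chordCorners m) := by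
        simp [HalfEdgeOrder.passes, List.range_succ, List.flatMap_append]
      have hh : HalfEdgeOrder.halves X ((List.range (m + 1)).flatMap γ.chordSides) =
          HalfEdgeOrder.halves X ((List.range m).flatMap γ.chordSides) ++
          HalfEdgeOrder.halves X (γ.chordSides m) := by
        simp [HalfEdgeOrder.halves, List.range_succ, List.flatMap_append]
      rw [hp, hh, passes_chordCorners γ (by omega)]
      generalize HalfEdgeOrder.passes X ((List.range m).flatMap γ.chordCorners) = P at ih1 ih2 ⊢
      generalize HalfEdgeOrder.halves X ((List.range m).flatMap γ.chordSides) = A at ih1 ih2 ⊢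
      generalize HalfEdgeOrder.halves X (γ.chordSides m) = B
      generalize γ.flag m = f at ih1 ih2 ⊢
      generalize γ.flag (m + 1) = f'
      have hcr : ∀ R, crossSum H.lt P R = crossSum H.lt ([γ.flag 0] ++ A ++ [f]) R := by
        intro R
        apply ih2 fun a => (R.map (H.lt a)).sum
        intro x
        simp only [show H.lt (X.τ₂ x) = H.lt x from funext (H.lt_τ₂_left x)]
      constructor
      · rw [pairSum_append, ih1, hcr]
        simp only [pairSum_append, crossSum_append_left, crossSum_append_right,
          crossSum_singleton_left, crossSum_singleton_right, List.map_singleton,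
          List.sum_singleton, H.lt_self, pairSum_singleton, H.lt_τ₂_right, List.map_append,
          List.sum_append]
        linear_combination zmod2_add_self (H.lt (γ.flag 0) f) +
          zmod2_add_self (A.map fun b => H.lt b f).sum + zmod2_add_self (B.map (H.lt f)).sum +
          zmod2_add_self (H.lt f f')
      · intro φ hφ
        have := ih2 φ hφ
        simp only [List.map_append, List.sum_append, List.map_singleton, List.sum_singleton,
          hφ] at this ⊢
        rw [this]
        linear_combination zmod2_add_self (φ f)
  rw [sideWalk_eq, cornerWalk]
  exact (key γ.len le_rfl).1

/-- Two corners of sign 0 can share a half-edge only by being equal or by lying next to each other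
across it, which is what `cornerContact` records. -/
theorem pairSum_passes_sign_zero {Y : List F} (hY : ∀ y ∈ Y, o.sign y = 0) :
    pairSum H.lt (HalfEdgeOrder.passes X Y) =
      ∑ v, H.baseCount Y v + Y.length + pairSum X.cornerContact Y := by
  rw [H.pairSum_passes, H.sum_baseCount]
  congr 1
  · congr 1
    have : Y.map (fun y => (1 + o.sign y) + o.sign y * iv (X.SameHalf (X.τ₁ y) y)) =
        Y.map fun _ => (1 : ZMod 2) := by
      refine List.map_congr_left fun y hy => ?_
      rw [hY y hy]; ring
    rw [this]; simp
  · refine pairSum_congr fun y hy z hz => ?_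
    have sy := hY y hy
    have sz := hY z hz
    rw [sz, cornerContact]
    have e1 : X.SameHalf (X.τ₁ y) (X.τ₁ z) ↔ z = y := by
      refine ⟨?_, fun h => Or.inl (by rw [h])⟩
      rintro (h | h)
      · exact X.τ₁.injective h
      · have := congrArg o.sign h
        rw [o.sign_τ₁, o.sign_τ₂, o.sign_τ₁, sy, sz] at this
        exact absurd this (by decide)
    have e2 : X.SameHalf y (X.τ₁ z) ↔ z = X.τ₁ (X.τ₂ y) := by
      rw [← τ₁_eq_iff]
      refine ⟨?_, fun h => Or.inr h⟩
      rintro (h | h)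
      · have := congrArg o.sign h
        rw [o.sign_τ₁, sy, sz] at this
        exact absurd this (by decide)
      · exact h
    rw [iv_congr e1, iv_congr e2]; ring

theorem pairSum_coincidences {E : List F} (hE : ∀ y ∈ E, o.sign y = 0)
    (hω : ∀ y ∈ E, ω (X.edge y) = 0) :
    pairSum (fun x y => iv (X.edge x = X.edge y) * (1 + ω (X.edge x))) E =
      pairSum X.sideContact E := by
  refine pairSum_congr fun y hy z hz => ?_
  have sy := hE y hy
  have sz := hE z hz
  rw [hω y hy, sideContact, add_zero, mul_one, ← iv_or fun h => X.τ₀τ₂_ne y (h.2.symm.trans h.1)]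
  apply iv_congr
  rw [edge_eq_iff]
  constructor
  · rintro (h | h | h | h)
    · exact Or.inl h
    · have := congrArg o.sign h
      rw [o.sign_τ₂, sy, sz] at this
      exact absurd this (by decide)
    · have := congrArg o.sign h
      rw [o.sign_τ₀, sy, sz, hω y hy] at this
      exact absurd this (by decide)
    · exact Or.inr h
  · rintro (h | h)
    · exact Or.inl h
    · exact Or.inr (Or.inr (Or.inr h))

theorem length_cornerWalk : (γ.cornerWalk.length : ZMod 2) = γ.sideWalk.length + γ.len := by
  have : ∀ m, ((List.range m).flatMap γ.chordCorners).length =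
      ((List.range m).flatMap γ.chordSides).length + m := by
    intro m
    induction m with
    | zero => simp
    | succ m ih =>
      rw [List.range_succ, List.flatMap_append, List.flatMap_append, List.length_append, ih,
        List.length_append]
      simp only [List.flatMap_singleton, chordCorners, chordSides, arcWalk_length]
      ring
  rw [cornerWalk, this, ← sideWalk_eq]
  push_cast; ring

theorem pairSum_omega {E : List F} (hω : ∀ y ∈ E, ω (X.edge y) = 0) :
    pairSum (fun x y => ω (X.edge x) * ω (X.edge y)) E = 0 := by
  rw [pairSum_congr (g := fun _ _ => 0) fun a ha b _ => by rw [hω a ha, zero_mul]]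
  induction E with
  | nil => rfl
  | cons a E ih => rw [pairSum, ih fun y hy => hω y (List.mem_cons_of_mem _ hy)]; simp

/-- The quadratic function on the walk along a two-sided simple curve. -/
theorem quadratic_twoSided {K : X.EdgeOrientation} {q : (X.Edge → ZMod 2) → ZMod 2} (hq0 : q 0 = 0)
    (hq1 : ∀ e, q (Pi.single e 1) = H.edgeSign K e)
    (hq : ∀ c d, q (c + d) = q c + q d + bilin H.signMatrix c d)
    (h0 : o.sign (X.τ₁ (γ.flag 0)) = 0)
    (hω : ∀ y ∈ γ.sideWalk, ω (X.edge y) = 0) (hs : γ.IsSimple) (h2 : γ.TwoSided)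
    (hK : K.disagree γ.sideWalk = 1) :
    q (chainOf X.edge γ.sideWalk) = ∑ v, H.baseCount γ.cornerWalk v := by
  have hf : γ.flag γ.len = γ.flag 0 := h2
  have hp := pairSum_passes_cornerWalk (γ := γ) H
  rw [pairSum_passes_sign_zero H fun y hy => sign_chordCorners h0 hω hy, hf,
    List.append_assoc, pairSum_append, pairSum_append, crossSum_append_right,
    crossSum_singleton_left, crossSum_singleton_left, crossSum_singleton_right,
    pairSum_singleton, List.map_singleton, List.sum_singleton, H.lt_self] at hp
  -- `flag 0` stands at both ends of the list in `hp`. The list in between has even length, so its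
  -- two comparisons with `flag 0` differ only by the number of passages along the starting edge.
  have hr := H.pairSum_rotate (γ.flag 0) (HalfEdgeOrder.halves X γ.sideWalk)
  rw [pairSum_append, pairSum_append, pairSum_singleton, crossSum_singleton_left,
    crossSum_singleton_right, HalfEdgeOrder.sum_halves fun b => iv (X.SameHalf (γ.flag 0) b),
    HalfEdgeOrder.length_halves] at hr
  simp only [iv_sameHalf_add] at hr
  push_cast at hr
  rw [H.quadratic_walk K hq0 hq1 hq, hK, pairSum_omega hω,
    pairSum_coincidences (fun y hy => sign_sideWalk h0 hω hy) hω]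
  have hc := contacts_twoSided h0 hω hs h2
  have hl := length_cornerWalk (γ := γ)
  linear_combination -hp + hc - hr + hl + (1 + (γ.len : ZMod 2) -
    ((HalfEdgeOrder.halves X γ.sideWalk).map (H.lt (γ.flag 0))).sum) * zmod2_two

/-- The quadratic function on the walk along a one-sided simple curve. -/
theorem quadratic_oneSided {K : X.EdgeOrientation} {q : (X.Edge → ZMod 2) → ZMod 2} (hq0 : q 0 = 0)
    (hq1 : ∀ e, q (Pi.single e 1) = H.edgeSign K e)
    (hq : ∀ c d, q (c + d) = q c + q d + bilin H.signMatrix c d)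
    (h0 : o.sign (X.τ₁ (γ.flag 0)) = 0)
    (hω : ∀ y ∈ γ.sideWalk, ω (X.edge y) = 0) (hs : γ.IsSimple) (h1 : γ.OneSided)
    (ho : γ.crossings (X.edge (γ.flag 0)) = 1)
    (he : ∀ y ∈ γ.sideWalk, X.edge y ≠ X.edge (γ.flag 0))
    (hK : K.disagree γ.oneSidedWalk = 1) :
    q (chainOf X.edge γ.oneSidedWalk) = ∑ v, H.baseCount γ.cornerWalk v := by
  have hf : γ.flag γ.len = X.τ₀ (γ.flag 0) := h1
  have hp := pairSum_passes_cornerWalk (γ := γ) H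
  rw [pairSum_passes_sign_zero H fun y hy => sign_chordCorners h0 hω hy, hf,
    List.append_assoc] at hp
  have hr := H.pairSum_rotate (γ.flag 0)
    (HalfEdgeOrder.halves X γ.sideWalk ++ [X.τ₀ (γ.flag 0)])
  have hz : (γ.sideWalk.map fun y => iv (X.edge y = X.edge (γ.flag 0))).sum = 0 := by
    refine List.sum_eq_zero fun a ha => ?_
    obtain ⟨y, hy, rfl⟩ := List.mem_map.1 ha
    exact iv_false (he y hy)
  rw [← hp, List.map_append, List.sum_append, HalfEdgeOrder.sum_halves, List.length_append,
    HalfEdgeOrder.length_halves, List.map_singleton, List.sum_singleton,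
    iv_false (not_sameHalf_τ₀ _)] at hr
  simp only [iv_sameHalf_add] at hr
  rw [hz] at hr
  push_cast at hr
  -- The closing edge contributes its half-edges in the order `τ₀ (flag 0)`, `flag 0`. Up to moving
  -- `flag 0` to the front, this is the list of passes at the corners.
  have hh : HalfEdgeOrder.halves X γ.oneSidedWalk =
      (HalfEdgeOrder.halves X γ.sideWalk ++ [X.τ₀ (γ.flag 0)]) ++ [γ.flag 0] := by
    simp [HalfEdgeOrder.halves, oneSidedWalk, List.flatMap_append, X.τ₀_invol]
  have hco : pairSum (fun x y => iv (X.edge x = X.edge y) * (1 + ω (X.edge x))) γ.oneSidedWalk =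
      pairSum X.sideContact γ.sideWalk := by
    rw [oneSidedWalk, pairSum_append, crossSum_singleton_right, pairSum_singleton,
      pairSum_coincidences (fun y hy => sign_sideWalk h0 hω hy) hω, add_zero, List.sum_eq_zero,
      add_zero]
    intro a ha
    obtain ⟨y, hy, rfl⟩ := List.mem_map.1 ha
    rw [edge_τ₀, iv_false (he y hy), zero_mul]
  have hom : pairSum (fun x y => ω (X.edge x) * ω (X.edge y)) γ.oneSidedWalk = 0 := by
    rw [oneSidedWalk, pairSum_append, crossSum_singleton_right, pairSum_singleton,
      pairSum_omega hω, add_zero, List.sum_eq_zero, add_zero]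
    intro a ha
    obtain ⟨y, hy, rfl⟩ := List.mem_map.1 ha
    rw [hω y hy, zero_mul]
  rw [H.quadratic_walk K hq0 hq1 hq, hK, hom, hco, hh, hr, oneSidedWalk, List.length_append]
  have hc := contacts_oneSided h0 hω hs h1 ho he
  have hl := length_cornerWalk (γ := γ)
  simp only [List.length_singleton]
  push_cast
  linear_combination hc + hl + (2 + 2 * (γ.sideWalk.length : ZMod 2) + (γ.len : ZMod 2)) * zmod2_two

end Value

end Curve

end CellSurface

/-! ### Duality -/

/-- A vector that is annihilated by all functionals annihilating a set belongs to its span. -/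
theorem mem_span_of_dot {ι : Type*} [Fintype ι] {S : Set (ι → ZMod 2)} {z : ι → ZMod 2}
    (h : ∀ c : ι → ZMod 2, (∀ s ∈ S, dot c s = 0) → dot c z = 0) :
    z ∈ Submodule.span (ZMod 2) S := by
  by_contra hz
  obtain ⟨f, hfz, hf⟩ := Submodule.exists_le_ker_of_notMem hz
  have hd : ∀ s, f s = dot (fun i => f (Pi.single i 1)) s := by
    intro s
    conv_lhs => rw [← Finset.univ_sum_single s]
    rw [map_sum, dot]
    refine Finset.sum_congr rfl fun i _ => ?_
    rw [mul_comm, ← smul_eq_mul, ← map_smul, ← Pi.single_smul, smul_eq_mul, mul_one]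
  apply hfz
  rw [hd]
  apply h
  intro s hs
  rw [← hd]
  exact hf (Submodule.subset_span hs)

theorem dot_sum_smul_left {ι κ : Type*} [Fintype ι] [Fintype κ] (a : κ → ZMod 2)
    (v : κ → ι → ZMod 2) (d : ι → ZMod 2) : dot (∑ k, a k • v k) d = ∑ k, a k * dot (v k) d := by
  rw [← dot_sum_left]
  congr 1
  ext i
  simp

/-- Off-diagonal terms occur twice, and `a² = a` makes the diagonal linear. -/
theorem bilin_self_eq {ι : Type*} [Fintype ι] {M : ι → ι → ZMod 2} (hM : ∀ i j, M i j = M j i)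
    (z : ι → ZMod 2) : bilin M z z = dot (fun i => M i i) z := by
  have h : ∀ s : Finset ι, ∑ i ∈ s, ∑ j ∈ s, z i * z j * M i j = ∑ i ∈ s, M i i * z i := by
    intro s
    induction s using Finset.induction_on with
    | empty => simp
    | insert a s ha ih =>
      simp only [Finset.sum_insert ha, Finset.sum_add_distrib, ih]
      have : ∑ i ∈ s, z i * z a * M i a = ∑ i ∈ s, z a * z i * M a i :=
        Finset.sum_congr rfl fun i _ => by rw [hM]; ring
      rw [this, zmod2_mul_self]
      linear_combination zmod2_add_self (∑ i ∈ s, z a * z i * M a i)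
  exact h Finset.univ

namespace CellSurface

variable {F : Type*} [Fintype F] {X : CellSurface F}

namespace IsHomologyBasis

variable {ι : Type*} {v : ι → X.Edge → ZMod 2}

theorem mem_cycles (h : X.IsHomologyBasis v) (i : ι) : v i ∈ X.cycles := by
  obtain ⟨b, hb⟩ := h
  obtain ⟨z, hz, -⟩ := hb i
  rw [← hz]; exact z.2

theorem exists_eq_sum [Fintype ι] (h : X.IsHomologyBasis v) {c : X.Edge → ZMod 2}
    (hc : c ∈ X.cycles) : ∃ a : ι → ZMod 2, ∃ d ∈ X.boundaries, c = ∑ i, a i • v i + d := by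
  obtain ⟨b, hb⟩ := h
  choose z hz hbz using hb
  let C : X.cycles := ⟨c, hc⟩
  refine ⟨fun i => b.repr (Submodule.Quotient.mk C) i, c - ∑ i, b.repr (Submodule.Quotient.mk C) i • v i,
    ?_, by simp⟩
  have h1 : (Submodule.Quotient.mk C : X.H₁) =
      Submodule.Quotient.mk (∑ i, b.repr (Submodule.Quotient.mk C) i • z i) := by
    conv_lhs => rw [← b.sum_repr (Submodule.Quotient.mk C)]
    simp only [hbz]
    exact (map_sum (Submodule.mkQ _) (fun i => b.repr (Submodule.Quotient.mk C) i • z i) _).symm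
  rw [Submodule.Quotient.eq] at h1
  simpa [hz, C] using h1

theorem eq_zero_of_mem [Fintype ι] (h : X.IsHomologyBasis v) {a : ι → ZMod 2}
    (ha : ∑ i, a i • v i ∈ X.boundaries) : a = 0 := by
  obtain ⟨b, hb⟩ := h
  choose z hz hbz using hb
  have h1 : ∑ i, a i • b i = 0 := by
    simp only [hbz]
    have : (Submodule.Quotient.mk (∑ i, a i • z i) : X.H₁) = 0 := by
      rw [Submodule.Quotient.mk_eq_zero]
      simpa [hz] using ha
    rw [← this]
    exact (map_sum (Submodule.mkQ _) (fun i => a i • z i) _).symm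
  ext i
  exact Fintype.linearIndependent_iff.1 b.linearIndependent a h1 i

end IsHomologyBasis

/-- The boundaries of the faces, as chains. -/
def faceChains (X : CellSurface F) : Set (X.Edge → ZMod 2) :=
  Set.range fun x => chainOf X.edge (X.faceWalk x)

theorem dot_faceWalk (c : X.Edge → ZMod 2) (x : F) : dot c (chainOf X.edge (X.faceWalk x)) =
    ∑ i ∈ Finset.range (X.sides x), c (X.edge ((X.next ^ i) x)) := by
  rw [dot_chainOf, faceWalk, sum_arcWalk]

theorem mem_cycles_iff {c : X.Edge → ZMod 2} :
    c ∈ X.cycles ↔ ∀ s ∈ X.faceChains, dot c s = 0 := by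
  simp only [faceChains, Set.forall_mem_range, dot_faceWalk]
  rfl

/-- The chain `z` is a cycle of the graph. -/
def IsClosedChain (X : CellSurface F) (z : X.Edge → ZMod 2) : Prop :=
  ∀ d ∈ X.boundaries, dot d z = 0

theorem IsCornerSystem.isClosedChain {Y E : List F} {c : X.Edge → ZMod 2}
    (S : X.IsCornerSystem Y E c) : X.IsClosedChain (chainOf X.edge E) := by
  rintro d ⟨h, hd⟩
  rw [dot_chainOf]
  simp only [hd]
  exact S.closed h

theorem isClosedChain_of_mem_span {S : Set (X.Edge → ZMod 2)} (hS : ∀ s ∈ S, X.IsClosedChain s)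
    {z : X.Edge → ZMod 2} (hz : z ∈ Submodule.span (ZMod 2) S) : X.IsClosedChain z := by
  intro d hd
  induction hz using Submodule.span_induction with
  | mem s hs => exact hS s hs d hd
  | zero => simp [dot]
  | add x y _ _ hx hy => rw [dot_add_right, hx, hy, add_zero]
  | smul a x _ hx => rw [dot_smul_right, hx, mul_zero]

namespace HalfEdgeOrder

variable {ω : X.Edge → ZMod 2} {o : X.LocalOrientation ω} {n : ℕ} {num : X.Vertex ≃ Fin n}
  (H : HalfEdgeOrder X o num)

/-- The coboundary of a function on the vertices. -/
noncomputable def coboundary (X : CellSurface F) (h : X.Vertex → ZMod 2) (e : X.Edge) : ZMod 2 :=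
  h (X.vert (Quotient.out e)) + h (X.head (Quotient.out e))

theorem coboundary_edge (h : X.Vertex → ZMod 2) (x : F) :
    coboundary X h (X.edge x) = h (X.vert x) + h (X.head x) := by
  unfold coboundary
  have := edge_eq_iff.1 (edge_out (X.edge x)).symm
  rcases this with h' | h' | h' | h' <;> rw [h']
  · rw [vert_τ₂, head_τ₂]
  · rw [head_τ₀, ← head, add_comm]
  · rw [head_τ₀, vert_τ₂, ← head, head_τ₂, add_comm]

theorem coboundary_mem (h : X.Vertex → ZMod 2) : coboundary X h ∈ X.boundaries :=
  ⟨h, coboundary_edge h⟩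

theorem interMatrix_chain {Y E : List F} {c : X.Edge → ZMod 2} (S : X.IsCornerSystem Y E c)
    (z : X.Edge → ZMod 2) : bilin H.interMatrix z (chainOf X.edge E) =
      dot c z + dot (coboundary X (H.baseCount Y)) z := by
  rw [bilin_eq_dot, dot_comm, ← dot_add_left]
  congr 1
  ext e
  obtain ⟨x, rfl⟩ := exists_flag e
  rw [sum_chainOf_mul, H.sum_interMatrix S, Pi.add_apply, coboundary_edge]

/-- Intersection numbers of closed walks. -/
theorem interMatrix_closed {Y E : List F} {c : X.Edge → ZMod 2} (S : X.IsCornerSystem Y E c)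
    {z : X.Edge → ZMod 2} (hz : X.IsClosedChain z) :
    bilin H.interMatrix z (chainOf X.edge E) = dot c z := by
  rw [H.interMatrix_chain S, hz _ (coboundary_mem _), add_zero]

/-- Both sides are the value of the symmetric form `interMatrix` on the two walks. -/
theorem dot_symm (H : HalfEdgeOrder X o num) {Y E Y' E' : List F} {c c' : X.Edge → ZMod 2}
    (S : X.IsCornerSystem Y E c)
    (S' : X.IsCornerSystem Y' E' c') :
    dot c (chainOf X.edge E') = dot c' (chainOf X.edge E) := by
  rw [← H.interMatrix_closed S S'.isClosedChain, bilin_symm H.interMatrix_symm,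
    H.interMatrix_closed S' S.isClosedChain]

/-- The diagonal of `interMatrix` is `ω`, so the self-intersection of a closed walk is its value
under `ω`. -/
theorem dot_self (H : HalfEdgeOrder X o num) {Y E : List F} {c : X.Edge → ZMod 2}
    (S : X.IsCornerSystem Y E c) :
    dot c (chainOf X.edge E) = dot ω (chainOf X.edge E) := by
  rw [← H.interMatrix_closed S S.isClosedChain, bilin_self_eq H.interMatrix_symm]
  congr 1
  ext e
  rw [interMatrix, link_self, iv_true rfl]
  linear_combination zmod2_two

end HalfEdgeOrder

/-! ### Intersection numbers of the curve system and the cycles of the graph. -/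

namespace CurveSystem

variable {g b : ℕ} (S : X.CurveSystem g b)

/-- The walk along `α j`, as a chain. -/
noncomputable def αChain (j : Fin (2 * g)) : X.Edge → ZMod 2 := chainOf X.edge (S.α j).sideWalk

/-- The closed walk along `β l`, as a chain. -/
noncomputable def βChain (l : Fin b) : X.Edge → ZMod 2 := chainOf X.edge (S.β l).oneSidedWalk

theorem α_cornerSystem (j : Fin (2 * g)) :
    X.IsCornerSystem (S.α j).cornerWalk (S.α j).sideWalk (S.α j).chain :=
  (S.α j).isCornerSystem_twoSided (S.α_twoSided j)

theorem β_cornerSystem (l : Fin b) :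
    X.IsCornerSystem (S.β l).cornerWalk (S.β l).oneSidedWalk (S.β l).chain :=
  (S.β l).isCornerSystem_oneSided (S.β_oneSided l)

/-- The intersection numbers of the `α`'s. -/
noncomputable def form (j k : Fin (2 * g)) : ZMod 2 := dot (S.α j).chain (S.αChain k)

theorem α_mem_cycles (j : Fin (2 * g)) : (S.α j).chain ∈ X.cycles := S.basis.mem_cycles (Sum.inl j)

theorem β_mem_cycles (l : Fin b) : (S.β l).chain ∈ X.cycles := S.basis.mem_cycles (Sum.inr l)

theorem exists_eq_sum {c : X.Edge → ZMod 2} (hc : c ∈ X.cycles) :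
    ∃ (a : Fin (2 * g) → ZMod 2) (a' : Fin b → ZMod 2), ∃ d ∈ X.boundaries,
      c = ∑ j, a j • (S.α j).chain + ∑ l, a' l • (S.β l).chain + d := by
  obtain ⟨a, d, hd, h⟩ := S.basis.exists_eq_sum hc
  refine ⟨fun j => a (Sum.inl j), fun l => a (Sum.inr l), d, hd, ?_⟩
  rw [h, Fintype.sum_sum_type]
  rfl

theorem ω_eq_sum : S.ω = ∑ l, (1 : ZMod 2) • (S.β l).chain := by
  ext e; simp [ω]

variable {S} {o : X.LocalOrientation S.ω}

/-- The generators of the cycles of the graph: the boundaries of the faces and the walks along the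
curves. -/
def generators (S : X.CurveSystem g b) : Set (X.Edge → ZMod 2) :=
  X.faceChains ∪ Set.range S.αChain ∪ Set.range S.βChain

theorem isClosedChain_face {s : X.Edge → ZMod 2} (hs : s ∈ X.faceChains) : X.IsClosedChain s := by
  obtain ⟨x, rfl⟩ := hs
  exact (isCornerSystem_face x).isClosedChain

theorem ω_eq_zero {e : X.Edge} (h : S.AvoidsEdge e) : S.ω e = 0 :=
  Finset.sum_eq_zero fun l _ => by rw [Curve.chain, h l, Nat.cast_zero]

namespace IsAdapted

theorem ω_α (hS : S.IsAdapted o) (j : Fin (2 * g)) :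
    ∀ y ∈ (S.α j).sideWalk, S.ω (X.edge y) = 0 :=
  fun y hy => ω_eq_zero (hS.α_avoids j y hy)

theorem ω_β (hS : S.IsAdapted o) (l : Fin b) : ∀ y ∈ (S.β l).sideWalk, S.ω (X.edge y) = 0 :=
  fun y hy => ω_eq_zero (hS.β_avoids l y hy)

theorem edge_ne (hS : S.IsAdapted o) (l : Fin b) :
    ∀ y ∈ (S.β l).sideWalk, X.edge y ≠ X.edge ((S.β l).flag 0) := by
  intro y hy h
  have h1 := hS.β_avoids l y hy l
  rw [h, hS.β_once] at h1
  exact one_ne_zero h1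

theorem dot_β_α (hS : S.IsAdapted o) (l : Fin b) (j : Fin (2 * g)) :
    dot (S.β l).chain (S.αChain j) = 0 := by
  rw [αChain, dot_chainOf]
  refine List.sum_eq_zero fun a ha => ?_
  obtain ⟨y, hy, rfl⟩ := List.mem_map.1 ha
  rw [Curve.chain, hS.α_avoids j y hy l, Nat.cast_zero]

theorem dot_β_β (hS : S.IsAdapted o) (m l : Fin b) :
    dot (S.β m).chain (S.βChain l) = if m = l then 1 else 0 := by
  rw [βChain, dot_chainOf, Curve.oneSidedWalk, List.map_append, List.sum_append, List.sum_eq_zero,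
    zero_add, List.map_singleton, List.sum_singleton, edge_τ₀, Curve.chain]
  · split_ifs with h
    · rw [h, hS.β_once, Nat.cast_one]
    · rw [hS.β_other l m h, Nat.cast_zero]
  · intro a ha
    obtain ⟨y, hy, rfl⟩ := List.mem_map.1 ha
    rw [Curve.chain, hS.β_avoids l y hy m, Nat.cast_zero]

theorem dot_ω_α (hS : S.IsAdapted o) (j : Fin (2 * g)) : dot S.ω (S.αChain j) = 0 := by
  rw [ω_eq_sum, dot_sum_smul_left]
  exact Finset.sum_eq_zero fun l _ => by rw [hS.dot_β_α, mul_zero]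

theorem dot_ω_β (hS : S.IsAdapted o) (l : Fin b) : dot S.ω (S.βChain l) = 1 := by
  rw [ω_eq_sum, dot_sum_smul_left]
  simp [hS.dot_β_β]

variable {n : ℕ} {num : X.Vertex ≃ Fin n}

/-- The walk along `β_l` may well meet `α_j`; the parity follows by symmetry from the walk along
`α_j`, which avoids `β_l`. -/
theorem dot_α_β (hS : S.IsAdapted o) (H : HalfEdgeOrder X o num) (j : Fin (2 * g)) (l : Fin b) :
    dot (S.α j).chain (S.βChain l) = 0 := by
  rw [βChain, H.dot_symm (S.α_cornerSystem j) (S.β_cornerSystem l)]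
  exact hS.dot_β_α l j

theorem form_symm (H : HalfEdgeOrder X o num) (j k : Fin (2 * g)) : S.form j k = S.form k j :=
  H.dot_symm (S.α_cornerSystem j) (S.α_cornerSystem k)

theorem form_self (hS : S.IsAdapted o) (H : HalfEdgeOrder X o num) (j : Fin (2 * g)) :
    S.form j j = 0 := by
  rw [form, αChain, H.dot_self (S.α_cornerSystem j)]
  exact hS.dot_ω_α j

theorem form_eq_inter (H : HalfEdgeOrder X o num) {j k : Fin (2 * g)} (hjk : j ≠ k) :
    S.form j k = (S.α j).inter (S.α k) := by
  rw [form_symm H, form, αChain, dot_chainOf,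
    Curve.inter_eq (S.α_twoSided j) (S.α_twoSided k) (S.α_generic j k hjk)]

/-- The intersection form is nondegenerate. -/
theorem form_nondegenerate (hS : S.IsAdapted o) (H : HalfEdgeOrder X o num)
    {a : Fin (2 * g) → ZMod 2} (ha : ∀ k, ∑ j, S.form k j * a j = 0) : a = 0 := by
  set z : X.Edge → ZMod 2 := ∑ j, a j • S.αChain j with hz
  have hzα : ∀ c : X.Edge → ZMod 2, dot c z = ∑ j, a j * dot c (S.αChain j) := by
    intro c
    rw [dot_comm, hz, dot_sum_smul_left]
    exact Finset.sum_congr rfl fun j _ => by rw [dot_comm]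
  have hclosed : X.IsClosedChain z := by
    intro d hd
    rw [hzα]
    exact Finset.sum_eq_zero fun j _ => by
      rw [αChain, (S.α_cornerSystem j).isClosedChain d hd, mul_zero]
  -- `z` is orthogonal to the `α`'s by the choice of `a`, to the `β`'s because the walks avoid them,
  -- and to boundaries because it is closed; hence to all dual cycles, which are the annihilator of
  -- the face boundaries.
  have hspan : z ∈ Submodule.span (ZMod 2) X.faceChains := by
    apply mem_span_of_dot
    intro c hc
    obtain ⟨p, p', d, hd, rfl⟩ := S.exists_eq_sum (mem_cycles_iff.2 hc)
    rw [dot_add_left, dot_add_left, hclosed d hd, dot_sum_smul_left, dot_sum_smul_left, add_zero]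
    have h1 : ∀ j, dot (S.α j).chain z = 0 := by
      intro j
      rw [hzα, ← ha j]
      exact Finset.sum_congr rfl fun k _ => mul_comm _ _
    have h2 : ∀ l, dot (S.β l).chain z = 0 := by
      intro l
      rw [hzα]
      exact Finset.sum_eq_zero fun j _ => by rw [hS.dot_β_α, mul_zero]
    simp [h1, h2]
  -- Under `interMatrix` a face boundary becomes a coboundary, since its dual curve is empty.
  have hb1 : ∀ y ∈ Submodule.span (ZMod 2) X.faceChains,
      (fun e => ∑ f, y f * H.interMatrix e f) ∈ X.boundaries := by
    intro y hy
    induction hy using Submodule.span_induction with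
    | mem s hs =>
      obtain ⟨x, rfl⟩ := hs
      refine ⟨H.baseCount (X.faceWalk x), fun y => ?_⟩
      simp only [sum_chainOf_mul]
      rw [H.sum_interMatrix (isCornerSystem_face x), Pi.zero_apply, zero_add]
    | zero => convert X.boundaries.zero_mem; simp
    | add x y _ _ hx hy =>
      convert X.boundaries.add_mem hx hy using 1
      ext e; simp [add_mul, Finset.sum_add_distrib]
    | smul r x _ hx =>
      convert X.boundaries.smul_mem r hx using 1
      ext e; simp [Finset.mul_sum, mul_assoc]
  -- Under `interMatrix` the walk along `α_j` becomes the chain of `α_j` up to a coboundary.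
  -- Comparing with `hb1` shows that the combination of the `α`'s bounds, and independence in
  -- homology applies.
  have hb2 : ∑ j, a j • (S.α j).chain ∈ X.boundaries := by
    have h1 := hb1 z hspan
    have h2 : (fun e => ∑ f, z f * H.interMatrix e f) = ∑ j, a j • (S.α j).chain +
        ∑ j, a j • HalfEdgeOrder.coboundary X (H.baseCount (S.α j).cornerWalk) := by
      ext e
      obtain ⟨x, rfl⟩ := exists_flag e
      have : ∑ f, z f * H.interMatrix (X.edge x) f =
          ∑ j, a j * ∑ f, S.αChain j f * H.interMatrix (X.edge x) f := by
        have := dot_sum_smul_left a S.αChain (H.interMatrix (X.edge x))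
        exact this
      rw [this]
      simp only [αChain, sum_chainOf_mul, Pi.add_apply, Finset.sum_apply, Pi.smul_apply,
        smul_eq_mul, HalfEdgeOrder.coboundary_edge, ← Finset.sum_add_distrib, ← mul_add]
      exact Finset.sum_congr rfl fun j _ => by rw [H.sum_interMatrix (S.α_cornerSystem j)]
    have h3 : ∑ j, a j • HalfEdgeOrder.coboundary X (H.baseCount (S.α j).cornerWalk) ∈
        X.boundaries :=
      Submodule.sum_mem _ fun j _ => Submodule.smul_mem _ _ (HalfEdgeOrder.coboundary_mem _)
    rw [h2] at h1
    exact (Submodule.add_mem_iff_left _ h3).1 h1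
  have hv := S.basis.eq_zero_of_mem (a := Sum.elim a 0) (by
    rw [Fintype.sum_sum_type]
    simpa using hb2)
  ext j
  exact congrFun hv (Sum.inl j)

/-- The generators span the cycles of the graph. -/
theorem mem_span_generators (hS : S.IsAdapted o) (H : HalfEdgeOrder X o num)
    {z : X.Edge → ZMod 2} (hz : X.IsClosedChain z) :
    z ∈ Submodule.span (ZMod 2) S.generators := by
  apply mem_span_of_dot
  intro c hc
  obtain ⟨p, p', d, hd, rfl⟩ := S.exists_eq_sum (mem_cycles_iff.2 fun s hs => hc s (by
    simp [generators, hs]))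
  -- The walks along the `β`'s are dual to the `β`'s and orthogonal to the `α`'s, so they read off
  -- the `β`-coordinates; the `α`-coordinates then vanish by nondegeneracy.
  have hβ : p' = 0 := by
    ext l
    have h1 := hc (S.βChain l) (by simp [generators])
    rw [dot_add_left, dot_add_left, dot_sum_smul_left, dot_sum_smul_left,
      show dot d (S.βChain l) = 0 from (S.β_cornerSystem l).isClosedChain d hd, add_zero] at h1
    simp only [hS.dot_α_β H, hS.dot_β_β] at h1
    simpa using h1
  have hα : p = 0 := by
    apply hS.form_nondegenerate H
    intro k
    have h1 := hc (S.αChain k) (by simp [generators])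
    rw [dot_add_left, dot_add_left, dot_sum_smul_left, dot_sum_smul_left, hβ, αChain,
      (S.α_cornerSystem k).isClosedChain d hd, add_zero] at h1
    simp only [Pi.zero_apply, zero_mul, Finset.sum_const_zero, add_zero] at h1
    rw [← h1]
    refine Finset.sum_congr rfl fun j _ => ?_
    rw [form_symm H, mul_comm]; rfl
  rw [hα, hβ]
  simp [hz d hd]

end IsAdapted

end CurveSystem

end CellSurface

/-! ### The sign of an odd chain -/

/-- The quadratic function `∑_{j<k} a_j a_k B_{jk}`. -/
def quad {m : ℕ} (B : Fin m → Fin m → ZMod 2) (a : Fin m → ZMod 2) : ZMod 2 :=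
  ∑ j, ∑ k, if j < k then a j * a k * B j k else 0

theorem quad_add {m : ℕ} {B : Fin m → Fin m → ZMod 2} (hB : ∀ j k, B j k = B k j)
    (h0 : ∀ j, B j j = 0) (a b : Fin m → ZMod 2) :
    quad B (a + b) = quad B a + quad B b + bilin B a b := by
  have h1 : bilin B a b = (∑ j, ∑ k, if j < k then a j * b k * B j k else 0) +
      ∑ j, ∑ k, if j < k then b j * a k * B j k else 0 := by
    rw [Finset.sum_comm (f := fun j k => if j < k then b j * a k * B j k else 0), bilin,
      ← Finset.sum_add_distrib]
    refine Finset.sum_congr rfl fun j _ => ?_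
    rw [← Finset.sum_add_distrib]
    refine Finset.sum_congr rfl fun k _ => ?_
    rcases lt_trichotomy j k with h | rfl | h
    · simp [h, h.not_gt]
    · simp [h0]
    · simp only [h, h.not_gt, if_true, if_false, hB j k]; ring
  rw [h1]
  simp only [quad, ← Finset.sum_add_distrib]
  refine Finset.sum_congr rfl fun j _ => Finset.sum_congr rfl fun k _ => ?_
  split_ifs
  · simp only [Pi.add_apply]; ring
  · ring

theorem quad_single {m : ℕ} (B : Fin m → Fin m → ZMod 2) (i : Fin m) :
    quad B (Pi.single i 1) = 0 := by
  refine Finset.sum_eq_zero fun j _ => Finset.sum_eq_zero fun k _ => ?_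
  split_ifs with h
  · rcases eq_or_ne j i with rfl | hj
    · rw [Pi.single_eq_of_ne h.ne', mul_zero, zero_mul]
    · rw [Pi.single_eq_of_ne hj, zero_mul, zero_mul]
  · rfl

theorem bilin_single_right {ι : Type*} [Fintype ι] [DecidableEq ι] (B : ι → ι → ZMod 2)
    (a : ι → ZMod 2) (i : ι) : bilin B a (Pi.single i 1) = ∑ j, a j * B j i := by
  unfold bilin
  refine Finset.sum_congr rfl fun j _ => ?_
  rw [Finset.sum_eq_single i]
  · simp
  · intro k _ hk; simp [hk]
  · simp

/-- The matrix with zeros on the diagonal and ones elsewhere. -/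
def offDiag {b : ℕ} (l m : Fin b) : ZMod 2 := if l = m then 0 else 1

namespace CellSurface

variable {F : Type*} [Fintype F] {X : CellSurface F}

/-- Every vertex is incident to an odd number of edges of the chain. -/
def IsOddChain (X : CellSurface F) (c : X.Edge → ZMod 2) : Prop :=
  ∀ h : X.Vertex → ZMod 2, dot (HalfEdgeOrder.coboundary X h) c = ∑ v, h v

theorem IsOddChain.add {c z : X.Edge → ZMod 2} (hc : X.IsOddChain c) (hz : X.IsClosedChain z) :
    X.IsOddChain (c + z) := by
  intro h
  rw [dot_add_right, hc, hz _ (HalfEdgeOrder.coboundary_mem h), add_zero]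

theorem IsOddChain.isClosedChain_add {c c' : X.Edge → ZMod 2} (hc : X.IsOddChain c)
    (hc' : X.IsOddChain c') : X.IsClosedChain (c + c') := by
  rintro d ⟨h, hd⟩
  have : d = HalfEdgeOrder.coboundary X h := by
    ext e
    obtain ⟨x, rfl⟩ := exists_flag e
    rw [hd, HalfEdgeOrder.coboundary_edge]
  rw [this, dot_add_right, hc, hc', zmod2_add_self]

namespace HalfEdgeOrder

variable {ω : X.Edge → ZMod 2} {o : X.LocalOrientation ω} {n : ℕ} {num : X.Vertex ≃ Fin n}

/-- Adding the walk of a corner system to an odd chain. -/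
theorem quadratic_add (H : HalfEdgeOrder X o num) {q : (X.Edge → ZMod 2) → ZMod 2}
    (hq : ∀ c d, q (c + d) = q c + q d + bilin H.signMatrix c d) {Y E : List F}
    {c z : X.Edge → ZMod 2} (S : X.IsCornerSystem Y E c)
    (hE : q (chainOf X.edge E) = ∑ v, H.baseCount Y v) (hz : X.IsOddChain z) :
    q (z + chainOf X.edge E) = q z + dot c z + dot ω z * dot ω (chainOf X.edge E) := by
  have h1 : bilin H.signMatrix z (chainOf X.edge E) =
      bilin H.interMatrix z (chainOf X.edge E) + dot ω z * dot ω (chainOf X.edge E) := by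
    simp only [bilin, dot, signMatrix, mul_add, Finset.sum_add_distrib, Finset.sum_mul_sum]
    congr 1
    exact Finset.sum_congr rfl fun i _ => Finset.sum_congr rfl fun j _ => by ring
  rw [hq, h1, H.interMatrix_chain S, hz, hE]
  linear_combination zmod2_add_self (∑ v, H.baseCount Y v)

end HalfEdgeOrder

namespace CurveSystem

variable {g b : ℕ} {S : X.CurveSystem g b} {o : X.LocalOrientation S.ω} {n : ℕ}
  {num : X.Vertex ≃ Fin n}

/-- A nondegenerate form on a finite-dimensional space takes every family of intersection numbers.
The vector `p c` is the combination of the `α`'s that meets each `α_k` as `c` does. -/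
theorem IsAdapted.exists_coordinates (hS : S.IsAdapted o) (H : HalfEdgeOrder X o num) :
    ∃ p : (X.Edge → ZMod 2) → Fin (2 * g) → ZMod 2,
      ∀ c k, ∑ j, S.form k j * p c j = dot (S.α k).chain c := by
  let T : (Fin (2 * g) → ZMod 2) →ₗ[ZMod 2] (Fin (2 * g) → ZMod 2) :=
    Matrix.mulVecLin (Matrix.of S.form)
  have hT : ∀ a k, T a k = ∑ j, S.form k j * a j := fun a k => rfl
  have hinj : Function.Injective T := by
    rw [injective_iff_map_eq_zero]
    intro a ha
    apply hS.form_nondegenerate H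
    intro k
    rw [← hT, ha]; rfl
  have hsurj : Function.Surjective T := LinearMap.injective_iff_surjective.1 hinj
  choose r hr using hsurj
  refine ⟨fun c => r fun k => dot (S.α k).chain c, fun c k => ?_⟩
  rw [← hT, hr]

/-- The total sign of an odd chain does not depend on the chain. -/
theorem IsAdapted.sign_eq (hS : S.IsAdapted o) (H : HalfEdgeOrder X o num)
    {K : X.EdgeOrientation} (hK : K.IsKasteleyn o) (hN : S.IsNormalized K)
    {q : (X.Edge → ZMod 2) → ZMod 2} (h0 : q 0 = 0)
    (h1 : ∀ e, q (Pi.single e 1) = H.edgeSign K e)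
    (hq : ∀ c d, q (c + d) = q c + q d + bilin H.signMatrix c d)
    {p : (X.Edge → ZMod 2) → Fin (2 * g) → ZMod 2}
    (hp : ∀ c k, ∑ j, S.form k j * p c j = dot (S.α k).chain c)
    {c c' : X.Edge → ZMod 2} (hc : X.IsOddChain c) (hc' : X.IsOddChain c') :
    q c + quad S.form (p c) + quad offDiag (fun l => dot (S.β l).chain c) =
      q c' + quad S.form (p c') + quad offDiag (fun l => dot (S.β l).chain c') := by
  set Θ : (X.Edge → ZMod 2) → ZMod 2 := fun c =>
    q c + quad S.form (p c) + quad offDiag (fun l => dot (S.β l).chain c) with hΘ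
  have hpu : ∀ c (a : Fin (2 * g) → ZMod 2),
      (∀ k, ∑ j, S.form k j * a j = dot (S.α k).chain c) → p c = a := by
    intro c a ha
    have : p c + a = 0 := by
      apply hS.form_nondegenerate H
      intro k
      simp only [Pi.add_apply, mul_add, Finset.sum_add_distrib, hp, ha, zmod2_add_self]
    ext j
    exact zmod2_add_eq_zero.1 (congrFun this j)
  have hpc : ∀ c z, (∀ k, dot (S.α k).chain z = 0) → p (c + z) = p c := by
    intro c z hz
    apply hpu
    intro k
    rw [hp, dot_add_right, hz, add_zero]
  -- A face changes nothing. The walk along `α_k` changes `q` by `α_k·c` and shifts `p` by a basis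
  -- vector, which changes `quad S.form` by the same amount. The walk along `β_l` changes `q` by
  -- `β_l·c + ω(c)` and flips the `l`-th intersection number, and `offDiag` compensates.
  have hgen : ∀ z ∈ S.generators, ∀ c, X.IsOddChain c → Θ (c + z) = Θ c := by
    rintro z ((⟨x, rfl⟩ | ⟨k, rfl⟩) | ⟨l, rfl⟩) c hc
    · have hα : ∀ k, dot (S.α k).chain (chainOf X.edge (X.faceWalk x)) = 0 := fun k =>
        mem_cycles_iff.1 (S.α_mem_cycles k) _ ⟨x, rfl⟩
      have hβ : ∀ l, dot (S.β l).chain (chainOf X.edge (X.faceWalk x)) = 0 := fun l =>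
        mem_cycles_iff.1 (S.β_mem_cycles l) _ ⟨x, rfl⟩
      have hω : dot S.ω (chainOf X.edge (X.faceWalk x)) = 0 := by
        rw [ω_eq_sum, dot_sum_smul_left]
        exact Finset.sum_eq_zero fun l _ => by rw [hβ, mul_zero]
      have h := H.quadratic_add hq (isCornerSystem_face x) (quadratic_face H hK h0 h1 hq x) hc
      simp only [hΘ]
      rw [h, hω, hpc c _ hα]
      simp only [dot_add_right, hβ, add_zero, mul_zero]
      simp [dot]
    · have h := H.quadratic_add hq (S.α_cornerSystem k)
        (Curve.quadratic_twoSided H h0 h1 hq (hS.α_left k) (hS.ω_α k) (S.α_simple k)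
          (S.α_twoSided k) (hN.1 k)) hc
      have hcoord : p (c + S.αChain k) = p c + Pi.single k 1 := by
        apply hpu
        intro i
        simp only [Pi.add_apply, mul_add, Finset.sum_add_distrib, hp, dot_add_right]
        congr 1
        rw [Finset.sum_eq_single k]
        · simp [form]
        · intro j _ hj; simp [hj]
        · simp
      simp only [hΘ]
      rw [hcoord, quad_add (IsAdapted.form_symm H) (hS.form_self H), quad_single,
        bilin_single_right]
      have e1 : ∑ j, p c j * S.form j k = dot (S.α k).chain c := by
        rw [← hp]
        exact Finset.sum_congr rfl fun j _ => by rw [IsAdapted.form_symm H, mul_comm]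
      have e2 : q (c + S.αChain k) = q c + dot (S.α k).chain c := by
        rw [αChain, h, ← αChain, hS.dot_ω_α, mul_zero, add_zero]
      rw [e1, e2]
      simp only [dot_add_right, hS.dot_β_α, add_zero]
      linear_combination zmod2_add_self (dot (S.α k).chain c)
    · have h := H.quadratic_add hq (S.β_cornerSystem l)
        (Curve.quadratic_oneSided H h0 h1 hq (hS.β_left l) (hS.ω_β l) (S.β_simple l)
          (S.β_oneSided l) (hS.β_once l) (hS.edge_ne l) (hN.2 l)) hc
      have e2 : q (c + S.βChain l) = q c + dot (S.β l).chain c + dot S.ω c := by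
        rw [βChain, h, ← βChain, hS.dot_ω_β, mul_one]
      have e3 : (fun m => dot (S.β m).chain (c + S.βChain l)) =
          (fun m => dot (S.β m).chain c) + Pi.single l 1 := by
        ext m
        rw [dot_add_right, hS.dot_β_β, Pi.add_apply, Pi.single_apply]
      simp only [hΘ]
      rw [e2, e3, hpc c _ (fun k => hS.dot_α_β H k l),
        quad_add (fun j k => by simp [offDiag, eq_comm]) (fun j => by simp [offDiag]),
        quad_single, bilin_single_right]
      -- The sum of `β_j·c` over `j ≠ l`, because `ω` is the sum of all the `β`'s.
      have e4 : ∑ j, dot (S.β j).chain c * offDiag j l = dot S.ω c + dot (S.β l).chain c := by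
        rw [ω_eq_sum, dot_sum_smul_left]
        simp only [one_mul]
        rw [← Finset.add_sum_erase _ _ (Finset.mem_univ l),
          ← Finset.add_sum_erase (a := l) (f := fun k => dot (S.β k).chain c) _
            (Finset.mem_univ l)]
        have : ∑ j ∈ Finset.univ.erase l, dot (S.β j).chain c * offDiag j l =
            ∑ j ∈ Finset.univ.erase l, dot (S.β j).chain c := by
          refine Finset.sum_congr rfl fun j hj => ?_
          rw [offDiag, if_neg (Finset.ne_of_mem_erase hj), mul_one]
        rw [this, offDiag, if_pos rfl]
        linear_combination -zmod2_add_self (dot (S.β l).chain c)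
      rw [e4]
      linear_combination zmod2_add_self (dot (S.β l).chain c) + zmod2_add_self (dot S.ω c)
  have hclosed : ∀ s ∈ S.generators, X.IsClosedChain s := by
    rintro z ((hz | ⟨k, rfl⟩) | ⟨l, rfl⟩)
    · exact isClosedChain_face hz
    · exact (S.α_cornerSystem k).isClosedChain
    · exact (S.β_cornerSystem l).isClosedChain
  have hspan : ∀ z ∈ Submodule.span (ZMod 2) S.generators, ∀ c, X.IsOddChain c →
      Θ (c + z) = Θ c := by
    intro z hz
    induction hz using Submodule.span_induction with
    | mem s hs => exact hgen s hs
    | zero => intro c _; rw [add_zero]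
    | add x y hx _ ihx ihy =>
      intro c hc
      rw [← add_assoc, ihy _ (hc.add (isClosedChain_of_mem_span hclosed hx)), ihx c hc]
    | smul a x _ ih =>
      intro c hc
      rcases zmod2_cases a with rfl | rfl
      · rw [zero_smul, add_zero]
      · rw [one_smul, ih c hc]
  have hmain := hspan (c + c') (hS.mem_span_generators H (hc.isClosedChain_add hc')) c hc
  have hcc : c + (c + c') = c' := by
    ext e; simp only [Pi.add_apply]; linear_combination zmod2_add_self (c e)
  rw [hcc] at hmain
  exact hmain.symm

end CurveSystem

end CellSurface

/-! ### Pfaffians and dimer configurations -/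

/-- The sign `(-1) ^ a`. -/
def zsign {R : Type*} [Ring R] (a : ZMod 2) : R := (-1) ^ a.val

section ZSign

variable {R : Type*} [CommRing R]

@[simp] theorem zsign_zero : (zsign 0 : R) = 1 := by simp [zsign]

@[simp] theorem zsign_one : (zsign 1 : R) = -1 := by
  rw [zsign, show (1 : ZMod 2).val = 1 from rfl, pow_one]

theorem zsign_add (a b : ZMod 2) : (zsign (a + b) : R) = zsign a * zsign b := by
  rcases zmod2_cases a with rfl | rfl <;> rcases zmod2_cases b with rfl | rfl <;>
    simp [zmod2_add_self]

theorem zsign_sum {ι : Type*} (s : Finset ι) (f : ι → ZMod 2) :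
    (zsign (∑ i ∈ s, f i) : R) = ∏ i ∈ s, zsign (f i) := by
  induction s using Finset.induction_on with
  | empty => simp
  | insert a s ha ih => rw [Finset.sum_insert ha, Finset.prod_insert ha, zsign_add, ih]

theorem zsign_mul_self (a : ZMod 2) : (zsign a : R) * zsign a = 1 := by
  rw [← zsign_add, zmod2_add_self, zsign_zero]

end ZSign

theorem pairSum_ofFn {A : Type*} (f : A → A → ZMod 2) {m : ℕ} (y : Fin m → A) :
    pairSum f (List.ofFn y) = ∑ i, ∑ j, if i < j then f (y i) (y j) else 0 := by
  induction m with
  | zero => simp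
  | succ m ih =>
    rw [List.ofFn_succ, pairSum, ih, Fin.sum_univ_succ, List.map_ofFn, List.sum_ofFn]
    congr 1
    · rw [Fin.sum_univ_succ]; simp
    · refine Finset.sum_congr rfl fun i _ => ?_
      rw [Fin.sum_univ_succ]; simp

theorem pairSum_one {A : Type*} (l : List A) :
    pairSum (fun _ _ => 1) l = (l.length.choose 2 : ZMod 2) := by
  induction l with
  | nil => simp
  | cons a l ih =>
    rw [pairSum, ih, List.length_cons, Nat.choose_succ_succ' l.length 1]
    simp

/-- The number of inversions of a permutation. -/
noncomputable def inversions {m : ℕ} (σ : Equiv.Perm (Fin m)) : ZMod 2 :=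
  ∑ i, ∑ j, if i < j then iv (¬ σ i < σ j) else 0

theorem sign_eq_zsign_inversions {R : Type*} [CommRing R] {m : ℕ} (σ : Equiv.Perm (Fin m)) :
    ((Equiv.Perm.sign σ : ℤ) : R) = zsign (inversions σ) := by
  rw [Equiv.Perm.sign_eq_prod_prod_Ioi, inversions, zsign_sum]
  push_cast
  refine Finset.prod_congr rfl fun i _ => ?_
  rw [← Finset.sum_filter, zsign_sum]
  have : Finset.univ.filter (fun j => i < j) = Finset.Ioi i := by ext; simp
  rw [this]
  refine Finset.prod_congr rfl fun j _ => ?_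
  split_ifs with h
  · rw [iv_false (not_not.2 h)]; simp
  · rw [iv_true h]; simp

theorem choose_two_even (n : ℕ) : ((2 * n).choose 2 : ZMod 2) = n := by
  rw [Nat.choose_two_right, mul_assoc, Nat.mul_div_cancel_left _ two_pos]
  rcases n with _ | n
  · simp
  · rw [show 2 * (n + 1) - 1 = 2 * n + 1 by omega]
    push_cast
    linear_combination ((n : ZMod 2) + 1) * n * zmod2_two

/-- The even positions. -/
def evenIdx {n : ℕ} (k : Fin n) : Fin (2 * n) := ⟨2 * k, by omega⟩

/-- The odd positions. -/
def oddIdx {n : ℕ} (k : Fin n) : Fin (2 * n) := ⟨2 * k + 1, by omega⟩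

theorem evenIdx_or_oddIdx {n : ℕ} (i : Fin (2 * n)) : ∃ k : Fin n, i = evenIdx k ∨ i = oddIdx k := by
  have hi := i.2
  refine ⟨⟨i / 2, by omega⟩, ?_⟩
  rcases Nat.mod_two_eq_zero_or_one i with h | h
  · left; apply Fin.ext; simp only [evenIdx]; omega
  · right; apply Fin.ext; simp only [oddIdx]; omega

theorem evenIdx_injective {n : ℕ} : Function.Injective (evenIdx (n := n)) := by
  intro k l h
  have := congrArg Fin.val h
  simp only [evenIdx] at this
  apply Fin.ext; omega

theorem oddIdx_injective {n : ℕ} : Function.Injective (oddIdx (n := n)) := by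
  intro k l h
  have := congrArg Fin.val h
  simp only [oddIdx] at this
  apply Fin.ext; omega

theorem evenIdx_ne_oddIdx {n : ℕ} (k l : Fin n) : evenIdx k ≠ oddIdx l := by
  intro h
  have := congrArg Fin.val h
  simp only [evenIdx, oddIdx] at this
  omega

/-- A function on `2n` positions given by its values on even and on odd ones. -/
def interleave {A : Type*} {n : ℕ} (u v : Fin n → A) (i : Fin (2 * n)) : A :=
  if i.1 % 2 = 0 then u ⟨i / 2, by omega⟩ else v ⟨i / 2, by omega⟩

theorem interleave_even {A : Type*} {n : ℕ} (u v : Fin n → A) (k : Fin n) :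
    interleave u v (evenIdx k) = u k := by
  simp [interleave, evenIdx]

theorem interleave_odd {A : Type*} {n : ℕ} (u v : Fin n → A) (k : Fin n) :
    interleave u v (oddIdx k) = v k := by
  have h1 : (2 * (k : ℕ) + 1) % 2 = 1 := by omega
  have h2 : (2 * (k : ℕ) + 1) / 2 = k := by omega
  simp [interleave, oddIdx, h1, h2]

theorem ofFn_interleave {A : Type*} {n : ℕ} (u v : Fin n → A) :
    List.ofFn (interleave u v) = (List.ofFn fun k => [u k, v k]).flatten := by
  rw [List.ofFn_mul']
  congr 2
  ext k : 1
  rw [List.ofFn_succ, List.ofFn_succ, List.ofFn_zero]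
  congr 1
  · exact interleave_even u v k
  · congr 1
    exact interleave_odd u v k

/-! ### Matchings of the indices and dimer configurations. -/

namespace CellSurface

variable {F : Type*} [Fintype F] {X : CellSurface F} {n : ℕ} {num : X.Vertex ≃ Fin (2 * n)}

theorem halves_ofFn (x : Fin n → F) : HalfEdgeOrder.halves X (List.ofFn x) =
    List.ofFn (interleave x fun k => X.τ₀ (x k)) := by
  rw [ofFn_interleave, HalfEdgeOrder.halves, List.flatMap_def, List.map_ofFn]
  rfl

/-- The directed edges `x k` join the vertices with numbers `σ (2k)` and `σ (2k+1)`. -/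
structure Matches (X : CellSurface F) {n : ℕ} (num : X.Vertex ≃ Fin (2 * n))
    (σ : Equiv.Perm (Fin (2 * n))) (x : Fin n → F) : Prop where
  vert_eq : ∀ k, num (X.vert (x k)) = σ (evenIdx k)
  head_eq : ∀ k, num (X.head (x k)) = σ (oddIdx k)

namespace Matches

variable {σ : Equiv.Perm (Fin (2 * n))} {x : Fin n → F}

theorem num_vert (h : X.Matches num σ x) (i : Fin (2 * n)) :
    num (X.vert (interleave x (fun k => X.τ₀ (x k)) i)) = σ i := by
  obtain ⟨k, rfl | rfl⟩ := evenIdx_or_oddIdx i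
  · rw [interleave_even, h.vert_eq]
  · rw [interleave_odd, ← h.head_eq]; rfl

theorem edge_injective (h : X.Matches num σ x) {k l : Fin n} (he : X.edge (x k) = X.edge (x l)) :
    k = l := by
  have h1 : X.vert (x l) = X.vert (x k) ∨ X.vert (x l) = X.head (x k) := by
    rcases edge_eq_iff.1 he with h' | h' | h' | h' <;> rw [h']
    · exact Or.inl rfl
    · exact Or.inl (vert_τ₂ X _)
    · exact Or.inr rfl
    · right; rw [X.comm, vert_τ₂]; rfl
  rcases h1 with h1 | h1
  · have := congrArg num h1
    rw [h.vert_eq, h.vert_eq] at this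
    exact (evenIdx_injective (σ.injective this)).symm
  · have := congrArg num h1
    rw [h.vert_eq, h.head_eq] at this
    exact absurd (σ.injective this) (evenIdx_ne_oddIdx _ _)

theorem sum_vert (hm : X.Matches num σ x) (h : X.Vertex → ZMod 2) :
    ∑ k, (h (X.vert (x k)) + h (X.head (x k))) = ∑ v, h v := by
  have h1 : ∑ v, h v = ∑ i, h (X.vert (interleave x (fun k => X.τ₀ (x k)) i)) := by
    rw [← Equiv.sum_comp (σ.trans num.symm) h]
    refine Finset.sum_congr rfl fun i _ => ?_
    rw [← num.symm_apply_apply (X.vert _), hm.num_vert]; rfl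
  rw [h1, ← List.sum_ofFn, ← List.sum_ofFn]
  have h2 := HalfEdgeOrder.sum_halves (X := X) (fun y => h (X.vert y)) (List.ofFn x)
  rw [halves_ofFn, List.map_ofFn, List.map_ofFn] at h2
  exact h2.symm

theorem vert_ne (h : X.Matches num σ x) {i j : Fin (2 * n)} (hij : i ≠ j) :
    X.vert (interleave x (fun k => X.τ₀ (x k)) i) ≠
      X.vert (interleave x (fun k => X.τ₀ (x k)) j) := by
  intro he
  apply hij
  apply σ.injective
  rw [← h.num_vert, ← h.num_vert, he]

variable {ω : X.Edge → ZMod 2} {o : X.LocalOrientation ω}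

/-- The quadratic function on a matching. -/
theorem quadratic_eq (h : X.Matches num σ x) (H : HalfEdgeOrder X o num) (K : X.EdgeOrientation)
    {q : (X.Edge → ZMod 2) → ZMod 2} (h0 : q 0 = 0)
    (h1 : ∀ e, q (Pi.single e 1) = H.edgeSign K e)
    (hq : ∀ c d, q (c + d) = q c + q d + bilin H.signMatrix c d) :
    q (chainOf X.edge (List.ofFn x)) = ∑ k, K.dir (x k) + inversions σ +
      pairSum (fun x y => ω (X.edge x) * ω (X.edge y)) (List.ofFn x) := by
  -- The half-edges of a matching lie at distinct vertices, so the order compares the values of `σ`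
  -- and counts the pairs that are not inverted. The number of all pairs of the `2n` positions is
  -- `n` mod 2.
  have hlt : pairSum H.lt (HalfEdgeOrder.halves X (List.ofFn x)) = n + inversions σ := by
    rw [halves_ofFn, pairSum_ofFn]
    have e1 : (n : ZMod 2) = ∑ i : Fin (2 * n), ∑ j, if i < j then (1 : ZMod 2) else 0 := by
      rw [← choose_two_even, ← pairSum_ofFn (fun _ _ => 1) fun i : Fin (2 * n) => i, pairSum_one,
        List.length_ofFn]
    rw [e1, inversions, ← Finset.sum_add_distrib]
    refine Finset.sum_congr rfl fun i _ => ?_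
    rw [← Finset.sum_add_distrib]
    refine Finset.sum_congr rfl fun j _ => ?_
    split_ifs with hij
    · rw [H.lt_of_vert_ne _ _ (h.vert_ne hij.ne), h.num_vert, h.num_vert, iv_not]
      linear_combination -zmod2_two
    · rw [add_zero]
  have hco : pairSum (fun x y => iv (X.edge x = X.edge y) * (1 + ω (X.edge x))) (List.ofFn x) = 0 := by
    rw [pairSum_ofFn]
    refine Finset.sum_eq_zero fun i _ => Finset.sum_eq_zero fun j _ => ?_
    split_ifs with hij
    · rw [iv_false fun he => hij.ne (h.edge_injective he), zero_mul]
    · rfl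
  rw [H.quadratic_walk K h0 h1 hq, hlt, hco, EdgeOrientation.disagree, List.map_ofFn,
    List.sum_ofFn, List.length_ofFn]
  simp only [Function.comp_apply]
  linear_combination zmod2_add_self (n : ZMod 2)

/-- The dimer configuration of a matching. -/
theorem isDimer (h : X.Matches num σ x) :
    X.IsDimer (Finset.univ.image fun k => X.edge (x k)) := by
  have hflag : ∀ k y, X.edge y = X.edge (x k) →
      (num (X.vert y) = σ (evenIdx k) ∧ num (X.head y) = σ (oddIdx k)) ∨
      (num (X.vert y) = σ (oddIdx k) ∧ num (X.head y) = σ (evenIdx k)) := by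
    intro k y hy
    rcases edge_eq_iff.1 hy.symm with h' | h' | h' | h' <;> rw [h']
    · exact Or.inl ⟨h.vert_eq k, h.head_eq k⟩
    · rw [vert_τ₂, head_τ₂]; exact Or.inl ⟨h.vert_eq k, h.head_eq k⟩
    · rw [head_τ₀]; exact Or.inr ⟨h.head_eq k, h.vert_eq k⟩
    · rw [head_τ₀, X.comm, vert_τ₂, vert_τ₂]; exact Or.inr ⟨h.head_eq k, h.vert_eq k⟩
  constructor
  · intro y hy he
    obtain ⟨k, -, hk⟩ := Finset.mem_image.1 hy
    rcases hflag k y hk.symm with h' | h' <;>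
    · have := h'.1.symm.trans ((congrArg num he).trans h'.2)
      first
      | exact evenIdx_ne_oddIdx _ _ (σ.injective this)
      | exact evenIdx_ne_oddIdx _ _ (σ.injective this).symm
  · intro v
    obtain ⟨k, hk⟩ := evenIdx_or_oddIdx (σ.symm (num v))
    refine ⟨X.edge (x k), ⟨Finset.mem_image.2 ⟨k, Finset.mem_univ _, rfl⟩, ?_⟩, ?_⟩
    · rcases hk with hk | hk
      · refine ⟨x k, num.injective ?_, rfl⟩
        rw [h.vert_eq, ← hk, σ.apply_symm_apply]
      · refine ⟨X.τ₀ (x k), num.injective ?_, edge_τ₀ X _⟩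
        rw [← head, h.head_eq, ← hk, σ.apply_symm_apply]
    · rintro e ⟨he, y, hy, rfl⟩
      obtain ⟨l, -, hl⟩ := Finset.mem_image.1 he
      have hl' : σ.symm (num v) = evenIdx l ∨ σ.symm (num v) = oddIdx l := by
        rw [← hy]
        rcases hflag l y hl.symm with h' | h'
        · left; rw [h'.1, σ.symm_apply_apply]
        · right; rw [h'.1, σ.symm_apply_apply]
      have : k = l := by
        rcases hk with hk | hk <;> rcases hl' with hl' | hl'
        · exact evenIdx_injective (hk.symm.trans hl')
        · exact absurd (hk.symm.trans hl') (evenIdx_ne_oddIdx _ _)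
        · exact absurd (hl'.symm.trans hk) (evenIdx_ne_oddIdx _ _)
        · exact oddIdx_injective (hk.symm.trans hl')
      rw [← hl, this]

end Matches

/-- The permutations that represent the matchings of the indices. -/
def IsPfaffianPerm {n : ℕ} (σ : Equiv.Perm (Fin (2 * n))) : Prop :=
  (∀ k, σ (evenIdx k) < σ (oddIdx k)) ∧ ∀ k l : Fin n, k < l → σ (evenIdx k) < σ (evenIdx l)

theorem Matches.eq_of_image_eq {σ σ' : Equiv.Perm (Fin (2 * n))} {x x' : Fin n → F}
    (h : X.Matches num σ x) (h' : X.Matches num σ' x') (hσ : IsPfaffianPerm σ)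
    (hσ' : IsPfaffianPerm σ')
    (he : (Finset.univ.image fun k => X.edge (x k)) = Finset.univ.image fun k => X.edge (x' k)) :
    σ = σ' ∧ ∀ k, X.edge (x k) = X.edge (x' k) := by
  have key : ∀ {σ σ' : Equiv.Perm (Fin (2 * n))} {x x' : Fin n → F},
      X.Matches num σ x → X.Matches num σ' x' → IsPfaffianPerm σ → IsPfaffianPerm σ' →
      (Finset.univ.image fun k => X.edge (x k)) = (Finset.univ.image fun k => X.edge (x' k)) →
      ∀ k, ∃ l, σ' (evenIdx l) = σ (evenIdx k) ∧ σ' (oddIdx l) = σ (oddIdx k) ∧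
        X.edge (x k) = X.edge (x' l) := by
    intro σ σ' x x' h h' hσ hσ' he k
    have : X.edge (x k) ∈ Finset.univ.image fun k => X.edge (x' k) := by
      rw [← he]; exact Finset.mem_image.2 ⟨k, Finset.mem_univ _, rfl⟩
    obtain ⟨l, -, hl⟩ := Finset.mem_image.1 this
    refine ⟨l, ?_⟩
    rw [← h'.vert_eq, ← h'.head_eq, ← h.vert_eq, ← h.head_eq]
    have hlt := hσ.1 k
    have hlt' := hσ'.1 l
    rw [← h.vert_eq, ← h.head_eq] at hlt
    rw [← h'.vert_eq, ← h'.head_eq] at hlt'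
    rcases edge_eq_iff.1 hl.symm with e | e | e | e
    · rw [e]; exact ⟨rfl, rfl, rfl⟩
    · rw [e, vert_τ₂, head_τ₂, edge_τ₂]; exact ⟨rfl, rfl, rfl⟩
    · rw [e, head_τ₀, ← head] at hlt'
      exact absurd hlt hlt'.asymm
    · rw [e, head_τ₀, vert_τ₂, ← head, head_τ₂] at hlt'
      exact absurd hlt hlt'.asymm
  have hmono : ∀ {σ : Equiv.Perm (Fin (2 * n))}, IsPfaffianPerm σ →
      StrictMono fun k : Fin n => σ (evenIdx k) := fun hσ k l hkl => hσ.2 k l hkl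
  have hrange : (fun k : Fin n => σ (evenIdx k)) = fun k => σ' (evenIdx k) := by
    apply ((hmono hσ).range_inj (hmono hσ')).1
    apply Set.Subset.antisymm
    · rintro _ ⟨k, rfl⟩
      obtain ⟨l, hl, -⟩ := key h h' hσ hσ' he k
      exact ⟨l, hl⟩
    · rintro _ ⟨k, rfl⟩
      obtain ⟨l, hl, -⟩ := key h' h hσ' hσ he.symm k
      exact ⟨l, hl⟩
  have hk : ∀ k, σ' (oddIdx k) = σ (oddIdx k) ∧ X.edge (x k) = X.edge (x' k) := by
    intro k
    obtain ⟨l, hl, hl1, hl2⟩ := key h h' hσ hσ' he k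
    have : l = k := by
      have h3 : σ (evenIdx k) = σ' (evenIdx k) := congrFun hrange k
      rw [h3] at hl
      exact evenIdx_injective (σ'.injective hl)
    rw [← this]
    rw [this] at hl1 hl2
    rw [this]
    exact ⟨hl1, hl2⟩
  refine ⟨?_, fun k => (hk k).2⟩
  ext i : 1
  obtain ⟨k, rfl | rfl⟩ := evenIdx_or_oddIdx i
  · exact congrFun hrange k
  · exact (hk k).1.symm

/-- Every dimer configuration comes from a matching of the indices. -/
theorem IsDimer.exists_matches {D : Finset X.Edge} (hD : X.IsDimer D)
    (num : X.Vertex ≃ Fin (2 * n)) :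
    ∃ (σ : Equiv.Perm (Fin (2 * n))) (x : Fin n → F), IsPfaffianPerm σ ∧ X.Matches num σ x ∧
      (Finset.univ.image fun k => X.edge (x k)) = D := by
  have hex : ∀ i, ∃ y, num (X.vert y) = i ∧ X.edge y ∈ D := by
    intro i
    obtain ⟨e, ⟨he, y, hy, rfl⟩, -⟩ := hD.2 (num.symm i)
    exact ⟨y, by rw [hy, num.apply_symm_apply], he⟩
  choose y hy hyD using hex
  have huniq : ∀ z, X.edge z ∈ D → X.edge (y (num (X.vert z))) = X.edge z := by
    intro z hz
    exact (hD.2 (X.vert z)).unique ⟨hyD _, y (num (X.vert z)), num.injective (hy _), rfl⟩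
      ⟨hz, z, rfl, rfl⟩
  set mate : Fin (2 * n) → Fin (2 * n) := fun i => num (X.head (y i)) with hmate
  have hne : ∀ i, mate i ≠ i := by
    intro i h
    have := hD.1 (y i) (hyD i)
    apply this
    apply num.injective
    rw [hy]; exact h.symm
  have hedge : ∀ i, X.edge (y (mate i)) = X.edge (y i) := by
    intro i
    have := huniq (X.τ₀ (y i)) (by rw [edge_τ₀]; exact hyD i)
    rw [edge_τ₀] at this
    exact this
  have hinv : ∀ i, mate (mate i) = i := by
    intro i
    have hv : num (X.vert (y (mate i))) = mate i := hy _
    rcases edge_eq_iff.1 (hedge i).symm with h | h | h | h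
    · rw [h, hy] at hv
      exact absurd hv.symm (hne i)
    · rw [h, vert_τ₂, hy] at hv
      exact absurd hv.symm (hne i)
    · change num (X.head (y (mate i))) = i
      rw [h, head_τ₀, hy]
    · change num (X.head (y (mate i))) = i
      rw [h, head_τ₀, vert_τ₂, hy]
  -- The smaller ends of the matched pairs. The involution `mate` exchanges them with the larger
  -- ends, so there are `n` of them, and listing them in increasing order gives the normalized
  -- permutation.
  set M := Finset.univ.filter fun i => i < mate i with hM
  have hcard : M.card = n := by
    have h1 : M.card = (Finset.univ.filter fun i => ¬ i < mate i).card := by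
      apply Finset.card_bij' (fun i _ => mate i) (fun i _ => mate i)
      · intro i hi
        simp only [hM, Finset.mem_filter, Finset.mem_univ, true_and] at hi ⊢
        rw [hinv]; exact hi.asymm
      · intro i hi
        simp only [hM, Finset.mem_filter, Finset.mem_univ, true_and] at hi ⊢
        rw [hinv]
        exact lt_of_le_of_ne (not_lt.1 hi) (hne i)
      · intro i _; exact hinv i
      · intro i _; exact hinv i
    have h2 := Finset.card_filter_add_card_filter_not (s := Finset.univ) fun i => i < mate i
    rw [← h1, Finset.card_univ, Fintype.card_fin] at h2
    change M.card + M.card = 2 * n at h2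
    omega
  set m := M.orderEmbOfFin hcard with hm
  have hmM : ∀ k, m k < mate (m k) := by
    intro k
    have := M.orderEmbOfFin_mem hcard k
    simp only [hM, Finset.mem_filter, Finset.mem_univ, true_and] at this
    exact this
  have hsurj : ∀ i, i < mate i → ∃ k, m k = i := by
    intro i hi
    have : i ∈ Set.range m := by
      rw [Finset.range_orderEmbOfFin]
      simp [hM, hi]
    exact this
  have hmate_inj : Function.Injective mate := fun i j h => by rw [← hinv i, h, hinv]
  have hcross : ∀ k l, m k ≠ mate (m l) := by
    intro k l h
    have h1 := hmM k
    rw [h, hinv] at h1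
    exact h1.asymm (hmM l)
  have hinj : Function.Injective (interleave m fun k => mate (m k)) := by
    intro i j h
    obtain ⟨k, rfl | rfl⟩ := evenIdx_or_oddIdx i <;> obtain ⟨l, rfl | rfl⟩ := evenIdx_or_oddIdx j <;>
      simp only [interleave_even, interleave_odd] at h
    · rw [m.injective h]
    · exact absurd h (hcross _ _)
    · exact absurd h.symm (hcross _ _)
    · rw [m.injective (hmate_inj h)]
  refine ⟨Equiv.ofBijective _ (Finite.injective_iff_bijective.1 hinj), fun k => y (m k),
    ⟨?_, ?_⟩, ⟨?_, ?_⟩, ?_⟩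
  · intro k
    simp only [Equiv.ofBijective_apply, interleave_even, interleave_odd]
    exact hmM k
  · intro k l hkl
    simp only [Equiv.ofBijective_apply, interleave_even]
    exact m.strictMono hkl
  · intro k
    simp only [Equiv.ofBijective_apply, interleave_even]
    exact hy _
  · intro k
    simp only [Equiv.ofBijective_apply, interleave_odd, hmate]
  · ext e
    simp only [Finset.mem_image, Finset.mem_univ, true_and]
    constructor
    · rintro ⟨k, rfl⟩; exact hyD _
    · intro he
      obtain ⟨z, rfl⟩ := exists_flag e
      have h1 := huniq z he
      set i := num (X.vert z)
      by_cases hi : i < mate i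
      · obtain ⟨k, hk⟩ := hsurj i hi
        exact ⟨k, by rw [hk, h1]⟩
      · obtain ⟨k, hk⟩ := hsurj (mate i) (by
          rw [hinv]; exact lt_of_le_of_ne (not_lt.1 hi) (hne i))
        exact ⟨k, by rw [hk, hedge, h1]⟩

end CellSurface

/-- Adding exponents of `i` modulo 2 costs a sign for every pair of ones. This is the origin of the
term `ω e * ω f` in `signMatrix`. -/
theorem zsign_pairSum_mul {A : Type*} (u : A → ZMod 2) (l : List A) :
    (zsign (pairSum (fun a b => u a * u b) l) : ℂ) *
      (l.map fun a => Complex.I ^ (u a).val).prod = Complex.I ^ ((l.map u).sum).val := by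
  induction l with
  | nil => simp
  | cons a l ih =>
    rw [pairSum, zsign_add, List.map_cons, List.prod_cons, List.map_cons, List.sum_cons,
      List.sum_map_mul_left]
    have key : ∀ s t : ZMod 2, (zsign (s * t) : ℂ) * Complex.I ^ s.val * Complex.I ^ t.val =
        Complex.I ^ (s + t).val := by
      intro s t
      rcases zmod2_cases s with rfl | rfl <;> rcases zmod2_cases t with rfl | rfl <;>
        simp [zmod2_add_self, show (1 : ZMod 2).val = 1 from rfl]
    rw [← key, ← ih]
    ring

/-! ### Character sums and Gauss sums over `ℤ/2`. -/

theorem sum_zsign_dot {m : ℕ} (u : Fin m → ZMod 2) :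
    ∑ a : Fin m → ZMod 2, (zsign (dot a u) : ℝ) = if u = 0 then 2 ^ m else 0 := by
  have h1 : ∀ t : ZMod 2, ∑ s : ZMod 2, (zsign (s * t) : ℝ) = if t = 0 then 2 else 0 := by
    intro t
    rw [show (Finset.univ : Finset (ZMod 2)) = {0, 1} from rfl,
      Finset.sum_pair (by decide)]
    rcases zmod2_cases t with rfl | rfl <;> norm_num
  have h2 : ∑ a : Fin m → ZMod 2, (zsign (dot a u) : ℝ) =
      ∏ j, ∑ s : ZMod 2, (zsign (s * u j) : ℝ) := by
    rw [Finset.prod_univ_sum]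
    simp only [Fintype.piFinset_univ]
    refine Finset.sum_congr rfl fun a _ => ?_
    rw [dot, zsign_sum]
  rw [h2]
  simp only [h1]
  split_ifs with h
  · simp [h]
  · obtain ⟨j, hj⟩ := Function.ne_iff.1 h
    exact Finset.prod_eq_zero (Finset.mem_univ j) (if_neg hj)

/-- The Gauss sum of a nondegenerate quadratic function. -/
theorem gauss_sum_sq {m : ℕ} {B : Fin m → Fin m → ZMod 2} (hB : ∀ j k, B j k = B k j)
    (h0 : ∀ j, B j j = 0) (hnd : ∀ a : Fin m → ZMod 2, (∀ k, ∑ j, B k j * a j = 0) → a = 0) :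
    (∑ a, (zsign (quad B a) : ℝ)) ^ 2 = 2 ^ m := by
  have hb : ∀ a d, bilin B a d = dot a fun k => ∑ j, B k j * d j := by
    intro a d
    rw [bilin_eq_dot]
    congr 1
    ext k
    exact Finset.sum_congr rfl fun j _ => mul_comm _ _
  rw [sq, Finset.sum_mul_sum]
  -- Substitute `c = a + d` in the product of the two sums. The values at `a` cancel and leave a
  -- character of `a`, so summing over `a` forces `d = 0`.
  have h1 : ∀ a : Fin m → ZMod 2, ∑ c, (zsign (quad B a) : ℝ) * zsign (quad B c) =
      ∑ d, zsign (quad B d) * zsign (bilin B a d) := by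
    intro a
    rw [← Equiv.sum_comp (Equiv.addLeft a)]
    refine Finset.sum_congr rfl fun d _ => ?_
    rw [Equiv.coe_addLeft, quad_add hB h0, zsign_add, zsign_add, ← mul_assoc, ← mul_assoc,
      zsign_mul_self, one_mul]
  rw [Finset.sum_congr rfl fun a _ => h1 a, Finset.sum_comm]
  simp only [← Finset.mul_sum, hb, sum_zsign_dot]
  rw [Finset.sum_eq_single 0]
  · rw [if_pos]
    · simp [quad]
    · ext k; simp
  · intro d _ hd
    rw [if_neg, mul_zero]
    intro h
    exact hd (hnd d fun k => congrFun h k)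
  · simp

/-- Completing the square in a Gauss sum. -/
theorem sum_zsign_quad_add {m : ℕ} {B : Fin m → Fin m → ZMod 2} (hB : ∀ j k, B j k = B k j)
    (h0 : ∀ j, B j j = 0) (p : Fin m → ZMod 2) :
    ∑ a, (zsign (quad B a) : ℝ) * zsign (bilin B a p) =
      zsign (quad B p) * ∑ a, (zsign (quad B a) : ℝ) := by
  rw [← Equiv.sum_comp (Equiv.addRight p) fun a => (zsign (quad B a) : ℝ), Finset.mul_sum]
  refine Finset.sum_congr rfl fun a _ => ?_
  rw [Equiv.coe_addRight, quad_add hB h0, zsign_add, zsign_add]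
  linear_combination -(zsign (quad B a) * zsign (bilin B a p)) * zsign_mul_self (R := ℝ) (quad B p)

/-! ### Expansion of the Pfaffian over dimer configurations. -/

namespace CellSurface

variable {F : Type*} [Fintype F] {X : CellSurface F} {n : ℕ} {num : X.Vertex ≃ Fin (2 * n)}

/-- The chain of a set of edges. -/
noncomputable def edgeChain (D : Finset X.Edge) (e : X.Edge) : ZMod 2 := iv (e ∈ D)

theorem Matches.chainOf_eq {σ : Equiv.Perm (Fin (2 * n))} {x : Fin n → F}
    (h : X.Matches num σ x) : chainOf X.edge (List.ofFn x) =
      edgeChain (Finset.univ.image fun k => X.edge (x k)) := by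
  ext e
  rw [chainOf_apply, List.map_ofFn, List.sum_ofFn, edgeChain]
  simp only [Function.comp_apply]
  by_cases he : ∃ k, X.edge (x k) = e
  · obtain ⟨k, rfl⟩ := he
    rw [Finset.sum_eq_single k, iv_true rfl, iv_true (by simp)]
    · intro l _ hl
      exact iv_false fun h' => hl (h.edge_injective h')
    · simp
  · rw [iv_false (by simpa using he)]
    exact Finset.sum_eq_zero fun k _ => iv_false fun h' => he ⟨k, h'⟩

theorem IsDimer.isOddChain {D : Finset X.Edge} (hD : X.IsDimer D)
    (num : X.Vertex ≃ Fin (2 * n)) : X.IsOddChain (edgeChain D) := by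
  obtain ⟨σ, x, -, hm, rfl⟩ := hD.exists_matches num
  intro h
  rw [← hm.chainOf_eq, dot_chainOf, List.map_ofFn, List.sum_ofFn, ← hm.sum_vert h]
  simp only [Function.comp_apply, HalfEdgeOrder.coboundary_edge]

namespace EdgeOrientation

theorem twist_twist (K : X.EdgeOrientation) (c d : X.Edge → ZMod 2) :
    (K.twist c).twist d = K.twist (c + d) := by
  simp only [twist, EdgeOrientation.mk.injEq]
  ext x
  simp only [Pi.add_apply]; ring

theorem ε_eq (L : X.EdgeOrientation) {x : F} (hx : X.vert x ≠ X.head x) :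
    L.ε (X.edge x) (X.vert x) (X.head x) = zsign (L.dir x) := by
  have h1 : L.Directs (X.edge x) (X.vert x) (X.head x) ↔ L.dir x = 0 := by
    constructor
    · rintro ⟨y, he, hv, -, hd⟩
      rcases edge_eq_iff.1 he.symm with rfl | rfl | rfl | rfl
      · exact hd
      · rwa [L.dir_τ₂] at hd
      · exact absurd hv.symm hx
      · rw [X.comm, vert_τ₂] at hv; exact absurd hv.symm hx
    · intro h; exact ⟨x, rfl, rfl, rfl, h⟩
  have h2 : L.Directs (X.edge x) (X.head x) (X.vert x) ↔ L.dir x = 1 := by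
    constructor
    · rintro ⟨y, he, hv, -, hd⟩
      rcases edge_eq_iff.1 he.symm with rfl | rfl | rfl | rfl
      · exact absurd hv hx
      · rw [vert_τ₂] at hv; exact absurd hv hx
      · rw [L.dir_τ₀] at hd; linear_combination hd - zmod2_two
      · rw [L.dir_τ₀, L.dir_τ₂] at hd; linear_combination hd - zmod2_two
    · intro h
      exact ⟨X.τ₀ x, edge_τ₀ X x, rfl, head_τ₀ X x, by rw [L.dir_τ₀, h]; rfl⟩
  rw [ε, if_congr h1 rfl rfl, if_congr h2 rfl rfl]
  rcases zmod2_cases (L.dir x) with h | h <;> rw [h] <;> simp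

theorem ε_eq_zero (L : X.EdgeOrientation) {e : X.Edge} {u v : X.Vertex}
    (h : ¬ ∃ x, X.edge x = e ∧ X.vert x = u ∧ X.head x = v) : L.ε e u v = 0 := by
  rw [ε, if_neg, if_neg, sub_zero]
  · rintro ⟨x, he, hv, hh, -⟩
    exact h ⟨X.τ₀ x, by rw [edge_τ₀, he], hh, by rw [head_τ₀, hv]⟩
  · rintro ⟨x, he, hv, hh, -⟩
    exact h ⟨x, he, hv, hh⟩

end EdgeOrientation

variable {ω : X.Edge → ZMod 2} {o : X.LocalOrientation ω}

/-- The Pfaffian of a twisted adjacency matrix, as a sum over dimer configurations. -/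
theorem pfaffian_adjMatrix (H : HalfEdgeOrder X o num) (K : X.EdgeOrientation)
    {q : (X.Edge → ZMod 2) → ZMod 2} (h0 : q 0 = 0)
    (h1 : ∀ e, q (Pi.single e 1) = H.edgeSign K e)
    (hq : ∀ c d, q (c + d) = q c + q d + bilin H.signMatrix c d) (c : X.Edge → ZMod 2)
    (w : X.Edge → ℝ) : pfaffian ((K.twist c).adjMatrix ω w num) =
      ∑ D ∈ (Finset.univ : Finset (Finset X.Edge)).filter X.IsDimer,
        zsign (q (edgeChain D) + dot c (edgeChain D)) *
          Complex.I ^ (dot ω (edgeChain D)).val * ((∏ e ∈ D, w e : ℝ) : ℂ) := by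
  set L := K.twist c with hL
  set f : Equiv.Perm (Fin (2 * n)) → (Fin n → X.Edge) → ℂ := fun σ p =>
    ((Equiv.Perm.sign σ : ℤ) : ℂ) * ∏ k, (L.ε (p k) (num.symm (σ (evenIdx k)))
      (num.symm (σ (oddIdx k))) * Complex.I ^ (ω (p k)).val * (w (p k) : ℂ)) with hf
  -- After multiplying out the sums over parallel edges, a term is nonzero only if the chosen edges
  -- join the vertices paired by `σ`; such terms correspond to dimer configurations.
  set J : Equiv.Perm (Fin (2 * n)) × (Fin n → X.Edge) → Prop := fun s =>
    IsPfaffianPerm s.1 ∧ ∃ x : Fin n → F, X.Matches num s.1 x ∧ s.2 = fun k => X.edge (x k) with hJ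
  have hsum : pfaffian (L.adjMatrix ω w num) = ∑ s ∈ Finset.univ.filter J, f s.1 s.2 := by
    have e1 : pfaffian (L.adjMatrix ω w num) =
        ∑ σ ∈ Finset.univ.filter IsPfaffianPerm, ∑ p : Fin n → X.Edge, f σ p := by
      unfold pfaffian
      refine Finset.sum_congr (by ext σ; simp only [Finset.mem_filter]; exact Iff.rfl) fun σ _ => ?_
      simp only [hf, ← Finset.mul_sum]
      congr 1
      unfold EdgeOrientation.adjMatrix
      rw [Finset.prod_univ_sum, Fintype.piFinset_univ]
      rfl
    rw [e1, ← Finset.sum_product']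
    symm
    apply Finset.sum_subset
    · intro s hs
      rw [Finset.mem_filter] at hs
      simp [hs.2.1]
    · intro s hs hs'
      rw [Finset.mem_product, Finset.mem_filter] at hs
      have hno : ¬ ∃ x : Fin n → F, X.Matches num s.1 x ∧ s.2 = fun k => X.edge (x k) := by
        intro hx
        exact hs' (Finset.mem_filter.2 ⟨Finset.mem_univ _, hs.1.2, hx⟩)
      have : ∃ k, ¬ ∃ x, X.edge x = s.2 k ∧ X.vert x = num.symm (s.1 (evenIdx k)) ∧
          X.head x = num.symm (s.1 (oddIdx k)) := by
        by_contra hcon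
        push Not at hcon
        choose x hx1 hx2 hx3 using hcon
        refine hno ⟨x, ⟨fun k => ?_, fun k => ?_⟩, funext fun k => (hx1 k).symm⟩
        · rw [hx2, num.apply_symm_apply]
        · rw [hx3, num.apply_symm_apply]
      obtain ⟨k, hk⟩ := this
      simp only [hf]
      rw [Finset.prod_eq_zero (Finset.mem_univ k), mul_zero]
      rw [L.ε_eq_zero hk, zero_mul, zero_mul]
  rw [hsum]
  refine Finset.sum_bij (fun s _ => Finset.univ.image s.2) ?_ ?_ ?_ ?_
  · rintro ⟨σ, p⟩ hs
    obtain ⟨-, -, x, hx, rfl⟩ := Finset.mem_filter.1 hs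
    exact Finset.mem_filter.2 ⟨Finset.mem_univ _, hx.isDimer⟩
  · rintro ⟨σ, p⟩ hs ⟨σ', p'⟩ hs' he
    obtain ⟨-, hσ, x, hx, hp⟩ := Finset.mem_filter.1 hs
    obtain ⟨-, hσ', x', hx', hp'⟩ := Finset.mem_filter.1 hs'
    simp only at hp hp' hσ hσ' he hx hx'
    subst hp hp'
    obtain ⟨h1, h2⟩ := hx.eq_of_image_eq hx' hσ hσ' he
    rw [h1, funext h2]
  · intro D hD
    obtain ⟨σ, x, hσ, hx, rfl⟩ := (Finset.mem_filter.1 hD).2.exists_matches num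
    exact ⟨(σ, fun k => X.edge (x k)), Finset.mem_filter.2 ⟨Finset.mem_univ _, hσ, x, hx, rfl⟩, rfl⟩
  · rintro ⟨σ, p⟩ hs
    obtain ⟨-, hσ, x, hx, hp⟩ := Finset.mem_filter.1 hs
    simp only at hp hx
    subst hp
    simp only [hf]
    have hε : ∀ k, L.ε (X.edge (x k)) (num.symm (σ (evenIdx k))) (num.symm (σ (oddIdx k))) =
        zsign (K.dir (x k) + c (X.edge (x k))) := by
      intro k
      rw [← hx.vert_eq, ← hx.head_eq, num.symm_apply_apply, num.symm_apply_apply, L.ε_eq]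
      · rfl
      · intro h
        have := congrArg num h
        rw [hx.vert_eq, hx.head_eq] at this
        exact evenIdx_ne_oddIdx _ _ (σ.injective this)
    have hw : ∏ e ∈ Finset.univ.image (fun k => X.edge (x k)), w e = ∏ k, w (X.edge (x k)) :=
      Finset.prod_image fun k _ l _ h => hx.edge_injective h
    have hc : ∑ k, c (X.edge (x k)) =
        dot c (edgeChain (Finset.univ.image fun k => X.edge (x k))) := by
      rw [← hx.chainOf_eq, dot_chainOf, List.map_ofFn, List.sum_ofFn]; rfl
    have hω : ((List.ofFn x).map fun a => ω (X.edge a)).sum =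
        dot ω (edgeChain (Finset.univ.image fun k => X.edge (x k))) := by
      rw [← hx.chainOf_eq, dot_chainOf]
    have hI := zsign_pairSum_mul (fun a => ω (X.edge a)) (List.ofFn x)
    rw [hω, List.map_ofFn, List.prod_ofFn] at hI
    simp only [Function.comp_apply] at hI
    simp only [hε]
    rw [Finset.prod_mul_distrib, Finset.prod_mul_distrib, ← zsign_sum, Finset.sum_add_distrib, hc,
      sign_eq_zsign_inversions, ← hI, hw, ← hx.chainOf_eq, hx.quadratic_eq H K h0 h1 hq]
    push_cast
    simp only [zsign_add]
    -- The pair sum of `ω` occurs once in `q` and once in the product of the powers of `i`, and its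
    -- sign squares to 1.
    linear_combination -(zsign (inversions σ) * zsign (∑ k, K.dir (x k)) *
      zsign (dot c (chainOf X.edge (List.ofFn x))) * (∏ k, Complex.I ^ (ω (X.edge (x k))).val) *
      (∏ k, (w (X.edge (x k)) : ℂ))) * zsign_mul_self (R := ℂ)
        (pairSum (fun x y => ω (X.edge x) * ω (X.edge y)) (List.ofFn x))

end CellSurface

/-! ### The signed sum over twists as a Gauss sum. -/

namespace CellSurface

variable {F : Type*} [Fintype F] {X : CellSurface F} {n : ℕ} {num : X.Vertex ≃ Fin (2 * n)}

namespace CurveSystem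

variable {g b : ℕ} {S : X.CurveSystem g b} {o : X.LocalOrientation S.ω}

theorem coeff_eq (H : HalfEdgeOrder X o num) (ε : Fin (2 * g) → ZMod 2) :
    S.coeff ε = zsign (quad S.form ε) := by
  unfold coeff zsign quad
  congr 2
  refine Finset.sum_congr rfl fun j _ => Finset.sum_congr rfl fun k _ => ?_
  split_ifs with h
  · rw [IsAdapted.form_eq_inter H h.ne]
  · rfl

/-- If the contributions of a dimer configuration to the Pfaffians are its weight with the sign
given by the quadratic functions, the signed sum is the partition function. -/
theorem IsAdapted.partitionFunction_eq (hS : S.IsAdapted o) (H : HalfEdgeOrder X o num)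
    {K : X.EdgeOrientation} (hK : K.IsKasteleyn o) (hN : S.IsNormalized K)
    {q : (X.Edge → ZMod 2) → ZMod 2} (h0 : q 0 = 0)
    (h1 : ∀ e, q (Pi.single e 1) = H.edgeSign K e)
    (hq : ∀ c d, q (c + d) = q c + q d + bilin H.signMatrix c d)
    (w : X.Edge → ℝ) (hw : ∀ e, 0 < w e) {P : (Fin (2 * g) → ZMod 2) → ℝ}
    (hP : ∀ ε, P ε = ∑ D ∈ (Finset.univ : Finset (Finset X.Edge)).filter X.IsDimer,
      zsign (q (edgeChain D) + dot (fun e => ∑ j, ε j * (S.α j).chain e) (edgeChain D) +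
        quad offDiag fun l => dot (S.β l).chain (edgeChain D)) * ∏ e ∈ D, w e) :
    X.partitionFunction w = 1 / 2 ^ g * |∑ ε, S.coeff ε * P ε| := by
  obtain ⟨p, hp⟩ := hS.exists_coordinates H
  have hsym := IsAdapted.form_symm (S := S) H
  have hself := hS.form_self H
  set G : ℝ := ∑ ε : Fin (2 * g) → ZMod 2, zsign (quad S.form ε) with hG
  have hG2 : |G| = 2 ^ g := by
    have h2 : G ^ 2 = (2 ^ g) ^ 2 := by
      rw [hG, gauss_sum_sq hsym hself fun a ha => hS.form_nondegenerate H ha, ← pow_mul, mul_comm]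
    rw [← abs_of_pos (show (0 : ℝ) < 2 ^ g by positivity)]
    exact (sq_eq_sq_iff_abs_eq_abs _ _).1 h2
  set Θ : Finset X.Edge → ZMod 2 := fun D => q (edgeChain D) + quad S.form (p (edgeChain D)) +
    quad offDiag (fun l => dot (S.β l).chain (edgeChain D)) with hΘ
  -- By the choice of `p`, the twist by `ε` is the linear term needed to complete the square.
  have hlin : ∀ ε D, dot (fun e => ∑ j, ε j * (S.α j).chain e) (edgeChain D) =
      bilin S.form ε (p (edgeChain D)) := by
    intro ε D
    rw [dot_sum_left, bilin_eq_dot, dot]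
    refine Finset.sum_congr rfl fun j _ => ?_
    rw [← hp]
    congr 1
    exact Finset.sum_congr rfl fun k _ => mul_comm _ _
  have hsum : ∑ ε, S.coeff ε * P ε =
      G * ∑ D ∈ (Finset.univ : Finset (Finset X.Edge)).filter X.IsDimer,
        zsign (Θ D) * ∏ e ∈ D, w e := by
    simp only [hP, Finset.mul_sum]
    rw [Finset.sum_comm]
    refine Finset.sum_congr rfl fun D _ => ?_
    have hs := sum_zsign_quad_add hsym hself (p (edgeChain D))
    have : ∀ ε, S.coeff ε * (zsign (q (edgeChain D) +
        dot (fun e => ∑ j, ε j * (S.α j).chain e) (edgeChain D) +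
        quad offDiag fun l => dot (S.β l).chain (edgeChain D)) * ∏ e ∈ D, w e) =
        (zsign (quad S.form ε) * zsign (bilin S.form ε (p (edgeChain D)))) *
        (zsign (q (edgeChain D)) * zsign (quad offDiag fun l => dot (S.β l).chain (edgeChain D)) *
          ∏ e ∈ D, w e) := by
      intro ε
      rw [coeff_eq H, hlin, zsign_add, zsign_add]; ring
    rw [Finset.sum_congr rfl fun ε _ => this ε, ← Finset.sum_mul, hs, hΘ]
    simp only [zsign_add]
    ring
  rw [hsum, abs_mul, hG2, one_div, inv_mul_cancel_left₀ (by positivity)]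
  unfold partitionFunction
  rcases (Finset.univ.filter X.IsDimer).eq_empty_or_nonempty with he | ⟨D₀, hD₀⟩
  · rw [he]; simp
  · have hD : ∀ D ∈ Finset.univ.filter X.IsDimer, Θ D = Θ D₀ := by
      intro D hD
      exact hS.sign_eq H hK hN h0 h1 hq hp ((Finset.mem_filter.1 hD).2.isOddChain num)
        ((Finset.mem_filter.1 hD₀).2.isOddChain num)
    have hconst : ∑ D ∈ Finset.univ.filter X.IsDimer, zsign (Θ D) * ∏ e ∈ D, w e =
        zsign (Θ D₀) * ∑ D ∈ Finset.univ.filter X.IsDimer, ∏ e ∈ D, w e := by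
      rw [Finset.mul_sum]
      exact Finset.sum_congr rfl fun D hD' => by rw [hD D hD']
    rw [hconst, abs_mul]
    have habs : |(zsign (Θ D₀) : ℝ)| = 1 := by
      rcases zmod2_cases (Θ D₀) with h | h <;> rw [h] <;> simp
    rw [habs, one_mul, abs_of_nonneg]
    exact Finset.sum_nonneg fun D _ => Finset.prod_nonneg fun e _ => (hw e).le

theorem zsign_complex (a : ZMod 2) : (zsign a : ℂ) = ((zsign a : ℝ) : ℂ) := by
  rcases zmod2_cases a with rfl | rfl <;> simp

theorem re_term (a u : ZMod 2) (r : ℝ) :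
    ((zsign a : ℂ) * Complex.I ^ u.val * (r : ℂ)).re = zsign a * (if u = 0 then 1 else 0) * r := by
  rw [zsign_complex]
  rcases zmod2_cases u with rfl | rfl
  · simp
  · simp [show (1 : ZMod 2).val = 1 from rfl]

theorem im_term (a u : ZMod 2) (r : ℝ) :
    ((zsign a : ℂ) * Complex.I ^ u.val * (r : ℂ)).im = zsign a * (if u = 0 then 0 else 1) * r := by
  rw [zsign_complex]
  rcases zmod2_cases u with rfl | rfl
  · simp
  · simp [show (1 : ZMod 2).val = 1 from rfl]

end CurveSystem

end CellSurface

theorem mainTheorem1 {F : Type*} [Fintype F] (X : CellSurface F)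
    (w : X.Edge → ℝ) (hw : ∀ e, 0 < w e)
    {n : ℕ} (num : X.Vertex ≃ Fin (2 * n))
    (hX : X.IsNonorientable) (g : ℕ) :
    -- `Σ = Σ_g # ℝP²`
    (X.eulerChar = 1 - 2 * g →
      ∀ (S : X.CurveSystem g 1) (o : X.LocalOrientation S.ω), S.IsAdapted o →
      ∀ K : X.EdgeOrientation, K.IsKasteleyn o → S.IsNormalized K →
        X.partitionFunction w = 1 / 2 ^ g *
          |∑ ε : Fin (2 * g) → ZMod 2, S.coeff ε *
            ((pfaffian ((S.twisted K ε).adjMatrix S.ω w num)).re +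
             (pfaffian ((S.twisted K ε).adjMatrix S.ω w num)).im)|) ∧
    -- `Σ = Σ_g # K`, the connected sum with a Klein bottle
    (X.eulerChar = - 2 * g →
      ∀ (S : X.CurveSystem g 2) (o : X.LocalOrientation S.ω), S.IsAdapted o →
      ∀ K : X.EdgeOrientation, K.IsKasteleyn o → S.IsNormalized K →
        X.partitionFunction w = 1 / 2 ^ g *
          |∑ ε : Fin (2 * g) → ZMod 2, S.coeff ε *
            ((pfaffian ((S.twisted K ε).adjMatrix S.ω w num)).im +
             (pfaffian (((S.twisted K ε).twist (S.β 0).chain).adjMatrix S.ω w num)).re)|) := by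
  constructor
  · intro _ S o hS K hK hN
    obtain ⟨H⟩ := CellSurface.nonempty_halfEdgeOrder o num
    obtain ⟨q, h0, h1, hq⟩ :=
      exists_quadratic H.signMatrix H.signMatrix_symm H.signMatrix_self (H.edgeSign K)
    refine hS.partitionFunction_eq H hK hN h0 h1 hq w hw fun ε => ?_
    rw [CellSurface.CurveSystem.twisted, CellSurface.pfaffian_adjMatrix H K h0 h1 hq,
      Complex.re_sum, Complex.im_sum, ← Finset.sum_add_distrib]
    refine Finset.sum_congr rfl fun D _ => ?_
    rw [CellSurface.CurveSystem.re_term, CellSurface.CurveSystem.im_term]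
    -- A single `β` gives no pairs; `Re + Im` sends both `1` and `i` to `1`.
    have : quad offDiag (fun l => dot (S.β l).chain (CellSurface.edgeChain D)) = 0 := by
      simp [quad]
    rw [this, add_zero]
    split_ifs <;> ring
  · intro _ S o hS K hK hN
    obtain ⟨H⟩ := CellSurface.nonempty_halfEdgeOrder o num
    obtain ⟨q, h0, h1, hq⟩ :=
      exists_quadratic H.signMatrix H.signMatrix_symm H.signMatrix_self (H.edgeSign K)
    refine hS.partitionFunction_eq H hK hN h0 h1 hq w hw fun ε => ?_
    rw [CellSurface.CurveSystem.twisted, CellSurface.EdgeOrientation.twist_twist,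
      CellSurface.pfaffian_adjMatrix H K h0 h1 hq, CellSurface.pfaffian_adjMatrix H K h0 h1 hq,
      Complex.re_sum, Complex.im_sum, ← Finset.sum_add_distrib]
    refine Finset.sum_congr rfl fun D _ => ?_
    rw [CellSurface.CurveSystem.re_term, CellSurface.CurveSystem.im_term]
    have hquad : quad offDiag (fun l => dot (S.β l).chain (CellSurface.edgeChain D)) =
        dot (S.β 0).chain (CellSurface.edgeChain D) *
          dot (S.β 1).chain (CellSurface.edgeChain D) := by
      simp [quad, Fin.sum_univ_two, offDiag]
    have hω : dot S.ω (CellSurface.edgeChain D) =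
        dot (S.β 0).chain (CellSurface.edgeChain D) +
          dot (S.β 1).chain (CellSurface.edgeChain D) := by
      rw [CellSurface.CurveSystem.ω_eq_sum, dot_sum_smul_left, Fin.sum_univ_two, one_mul, one_mul]
    rw [hquad, hω, dot_add_left]
    generalize dot (S.β 0).chain (CellSurface.edgeChain D) = s
    generalize dot (S.β 1).chain (CellSurface.edgeChain D) = t
    -- If `s ≠ t`, only the imaginary part contributes and `s * t = 0`. If `s = t`, only the real
    -- part contributes, and the twist along the first `β` gives the sign of `s = s * t`.
    rcases zmod2_cases s with rfl | rfl <;> rcases zmod2_cases t with rfl | rfl <;>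
      simp [zmod2_add_self, ← add_assoc, zsign_add]
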